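/- Let $\alpha\in\mathbb R$, $\alpha\neq0$. A $W^*$-non-commutative probability space $(\mathcal A,\varphi,\psi)$ consists of a von Neumann algebra $\mathcal A$, a faithful normal state $\varphi$ and a normal state $\psi$ (not necessarily faithful) on $\mathcal A$. For $X\in\mathcal A$ the free cumulants $R^\psi_n(X)$ and the two-state free cumulants $R^{\varphi,\psi}_n(X)$, $n\ge1$, are defined by \[ \psi[X^n]=\sum_{\pi\in NC(n)}\prod_{V\in\pi}R^\psi_{|V|}(X),\qquad \varphi[X^n]=\sum_{\pi\in NC(n)}\ \prod_{V\in\mathrm{Outer}(\pi)}R^{\varphi,\psi}_{|V|}(X)\prod_{V\in\mathrm{Inner}(\pi)}R^\psi_{|V|}(X), \] where $NC(n)$ is the set of non-crossing partitions of $\{1,\dots,n\}$ and a block is inner if it lies strictly between two elements of another block, and outer otherwise. Unital subalgebras $\mathcal A_1,\dots,\mathcal A_k\subseteq\mathcal A$ are two-state freely independent if for all $n\ge1$ and $a_j\in\mathcal A_{i(j)}$ ($1\le j\le n$) with $i(j)\ne i(j+1)$ and $\psi[a_j]=0$ one has $\psi[a_1\cdots a_n]=0$ and $\varphi[a_1\cdots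 a_n]=\varphi[a_1]\cdots\varphi[a_n]$. A two-state free Brownian motion with parameter $\alpha$ on $[0,T]$ in $(\mathcal A,\varphi,\psi)$ is a family of self-adjoint elements $X(t)\in\mathcal A$, $0\le t\le T$, such that $X(0)=0$; $\varphi[X(t)]=0$; for $0\le s\le t\le T$ the increment $X(t)-X(s)$ has the same moments as $X(t-s)$ with respect to both $\varphi$ and $\psi$; for pairwise disjoint intervals $[s_j,t_j)\subseteq[0,T]$ the unital algebras generated by the increments $X(t_j)-X(s_j)$ are two-state freely independent; $R^{\varphi,\psi}_n(X(t)-X(s))=0$ for all $n>2$ and $\varphi[(X(t)-X(s))^2]=t-s$ for $0\le s\le t\le T$; and $R^\psi_1(X(t))=\alpha t$ for $0\le t\le T$. Then: (1) for every $T$ with $0\le T\le 1/\alpha^2$ there exist a $W^*$-non-commutative probability space $(\mathcal A,\varphi,\psi)$ and a two-state free Brownian motion $\{X(t)\}_{0\le t\le T}$ with parameter $\alpha$ in it which generates $\mathcal A$ as a von Neumann algebra; (2) for $T>1/\alpha^2$ there is no two-state free Brownian motion $\{X(t)\}_{0\le t\le T}$ with parameter $\alpha$ in any $W^*$-non-commutative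 probability space, whether or not it generates the algebra. -/

import Mathlib

universe u

/-! ### Non-crossing partitions -/

/-- A partition of `{0, …, n - 1}` is non-crossing if `x₁ < y₁ < x₂ < y₂` with `x₁, x₂ ∈ U` and
`y₁, y₂ ∈ V` (`U`, `V` blocks) forces `U = V`. -/
def IsNoncrossing {n : ℕ} (π : Finpartition (Finset.univ : Finset (Fin n))) : Prop :=
  ∀ U ∈ π.parts, ∀ V ∈ π.parts, ∀ x₁ ∈ U, ∀ y₁ ∈ V, ∀ x₂ ∈ U, ∀ y₂ ∈ V,
    x₁ < y₁ → y₁ < x₂ → x₂ < y₂ → U = V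

/-- A set `V` (a block of `π`) is inner if it lies strictly between two elements of some block of
`π` (necessarily a different one). The other blocks are called outer. -/
def IsInnerBlock {n : ℕ} (π : Finpartition (Finset.univ : Finset (Fin n)))
    (V : Finset (Fin n)) : Prop :=
  ∃ U ∈ π.parts, ∃ y₁ ∈ U, ∃ y₂ ∈ U, ∀ x ∈ V, y₁ < x ∧ x < y₂

open Classical in
/-- The finite set of all non-crossing partitions of `{0, …, n - 1}`. -/
noncomputable def noncrossingPartitions (n : ℕ) :
    Finset (Finpartition (Finset.univ : Finset (Fin n))) :=
  Finset.univ.filter fun π => IsNoncrossing π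

open Classical in
/-- The outer blocks of a partition. -/
noncomputable def outerBlocks {n : ℕ} (π : Finpartition (Finset.univ : Finset (Fin n))) :
    Finset (Finset (Fin n)) :=
  π.parts.filter fun V => ¬ IsInnerBlock π V

open Classical in
/-- The inner blocks of a partition. -/
noncomputable def innerBlocks {n : ℕ} (π : Finpartition (Finset.univ : Finset (Fin n))) :
    Finset (Finset (Fin n)) :=
  π.parts.filter fun V => IsInnerBlock π V

/-! ### Cumulants of a single variable

The cumulants are the unique solutions of the moment-cumulant formulas
`moment_eq_sum_freeCumulant` and `moment_eq_sum_twoStateFreeCumulant` below; these formulas are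
solved recursively, by separating the term of the one-block partition. -/

open Classical in
/-- The `n`-th free cumulant (`n ≥ 1`) of the moment sequence `m`. -/
noncomputable def freeCumulantSeq (m : ℕ → ℂ) (n : ℕ) : ℂ :=
  m n - ∑ π ∈ (noncrossingPartitions n).filter (fun π => Finset.univ ∉ π.parts),
    ∏ V ∈ π.parts, if _h : V.card < n then freeCumulantSeq m V.card else 0
termination_by n

open Classical in
/-- The `n`-th two-state free cumulant (`n ≥ 1`) of a variable with moment sequence `m` for the
first state and `m'` for the second state. -/
noncomputable def twoStateFreeCumulantSeq (m m' : ℕ → ℂ) (n : ℕ) : ℂ :=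
  m n - ∑ π ∈ (noncrossingPartitions n).filter (fun π => Finset.univ ∉ π.parts),
    (∏ V ∈ outerBlocks π,
      if _h : V.card < n then twoStateFreeCumulantSeq m m' V.card else 0) *
    ∏ V ∈ innerBlocks π, freeCumulantSeq m' V.card
termination_by n

theorem card_lt_of_univ_notMem {n : ℕ} {π : Finpartition (Finset.univ : Finset (Fin n))}
    (h : Finset.univ ∉ π.parts) {V : Finset (Fin n)} (hV : V ∈ π.parts) : V.card < n := by
  have h1 : V ≠ Finset.univ := fun e => h (e ▸ hV)
  simpa using Finset.card_lt_univ_of_notMem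
    (s := V) (Classical.choose_spec (not_forall.1 fun hall => h1 (Finset.eq_univ_iff_forall.2 hall)))

theorem parts_eq_singleton_univ {n : ℕ} {π : Finpartition (Finset.univ : Finset (Fin n))}
    (h : Finset.univ ∈ π.parts) : π.parts = {Finset.univ} := by
  refine Finset.eq_singleton_iff_unique_mem.2 ⟨h, fun V hV => ?_⟩
  obtain ⟨x, hx⟩ := π.nonempty_of_mem_parts hV
  exact π.eq_of_mem_parts hV h hx (Finset.mem_univ x)

theorem filter_univ_mem_parts {n : ℕ} (hn : n ≠ 0) :
    ∃ π₀ : Finpartition (Finset.univ : Finset (Fin n)), π₀.parts = {Finset.univ} ∧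
      (noncrossingPartitions n).filter (fun π => Finset.univ ∈ π.parts) = {π₀} := by
  classical
  have hne : (Finset.univ : Finset (Fin n)) ≠ ⊥ := by
    have : NeZero n := ⟨hn⟩
    exact Finset.univ_nonempty.ne_empty
  refine ⟨Finpartition.indiscrete hne, rfl, ?_⟩
  refine Finset.eq_singleton_iff_unique_mem.2 ⟨?_, fun π hπ => ?_⟩
  · simp only [noncrossingPartitions, Finset.mem_filter, Finset.mem_univ, true_and]
    refine ⟨?_, by simp [Finpartition.indiscrete]⟩
    intro U hU V hV
    simp only [Finpartition.indiscrete, Finset.mem_singleton] at hU hV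
    intros
    rw [hU, hV]
  · exact Finpartition.ext (parts_eq_singleton_univ (Finset.mem_filter.1 hπ).2)

/-- The free moment-cumulant formula. -/
theorem moment_eq_sum_freeCumulant (m : ℕ → ℂ) {n : ℕ} (hn : n ≠ 0) :
    m n = ∑ π ∈ noncrossingPartitions n, ∏ V ∈ π.parts, freeCumulantSeq m V.card := by
  classical
  obtain ⟨π₀, h₀, hs⟩ := filter_univ_mem_parts hn
  rw [← Finset.sum_filter_add_sum_filter_not _ (fun π => Finset.univ ∈ π.parts), hs,
    Finset.sum_singleton, h₀, Finset.prod_singleton, Finset.card_univ, Fintype.card_fin,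
    freeCumulantSeq]
  rw [sub_add_eq_add_sub, eq_sub_iff_add_eq]
  congr 1
  refine Finset.sum_congr rfl fun π hπ => Finset.prod_congr rfl fun V hV => ?_
  rw [dif_pos (card_lt_of_univ_notMem (Finset.mem_filter.1 hπ).2 hV)]

/-- The two-state free moment-cumulant formula. -/
theorem moment_eq_sum_twoStateFreeCumulant (m m' : ℕ → ℂ) {n : ℕ} (hn : n ≠ 0) :
    m n = ∑ π ∈ noncrossingPartitions n,
      (∏ V ∈ outerBlocks π, twoStateFreeCumulantSeq m m' V.card) *
        ∏ V ∈ innerBlocks π, freeCumulantSeq m' V.card := by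
  classical
  obtain ⟨π₀, h₀, hs⟩ := filter_univ_mem_parts hn
  have hnot : ¬ IsInnerBlock π₀ Finset.univ := by
    rintro ⟨U, -, y₁, -, y₂, -, h⟩
    exact lt_irrefl _ (h y₁ (Finset.mem_univ _)).1
  have hout : outerBlocks π₀ = {Finset.univ} := by
    rw [outerBlocks, h₀, Finset.filter_singleton, if_pos hnot]
  have hin : innerBlocks π₀ = ∅ := by
    rw [innerBlocks, h₀, Finset.filter_singleton, if_neg hnot]
  rw [← Finset.sum_filter_add_sum_filter_not _ (fun π => Finset.univ ∈ π.parts), hs,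
    Finset.sum_singleton, hout, hin, Finset.prod_singleton, Finset.prod_empty, mul_one,
    Finset.card_univ, Fintype.card_fin, twoStateFreeCumulantSeq]
  rw [sub_add_eq_add_sub, eq_sub_iff_add_eq]
  congr 1
  refine Finset.sum_congr rfl fun π hπ => ?_
  congr 1
  refine Finset.prod_congr rfl fun V hV => ?_
  rw [dif_pos (card_lt_of_univ_notMem (Finset.mem_filter.1 hπ).2 (Finset.mem_filter.1 hV).1)]

/-! ### Two-state non-commutative probability spaces -/

section Algebraic

variable {A : Type*} [Ring A] [StarRing A] [Algebra ℂ A]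

open scoped ComplexOrder in
/-- A state: a positive unital linear functional (`0 ≤ z` means that `z` is real and
nonnegative). -/
def IsState (φ : A →ₗ[ℂ] ℂ) : Prop :=
  φ 1 = 1 ∧ ∀ a : A, 0 ≤ φ (star a * a)

/-- A functional is faithful if `φ (a* a) = 0` only for `a = 0`. -/
def IsFaithfulFunctional (φ : A →ₗ[ℂ] ℂ) : Prop :=
  ∀ a : A, φ (star a * a) = 0 → a = 0

/-- The `n`-th free cumulant `R^ψ_n(x)` of `x` with respect to `ψ`. -/
noncomputable def freeCumulant (ψ : A →ₗ[ℂ] ℂ) (x : A) (n : ℕ) : ℂ :=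
  freeCumulantSeq (fun k => ψ (x ^ k)) n

/-- The `n`-th two-state free cumulant `R^{φ,ψ}_n(x)` of `x` with respect to `(φ, ψ)`. -/
noncomputable def twoStateFreeCumulant (φ ψ : A →ₗ[ℂ] ℂ) (x : A) (n : ℕ) : ℂ :=
  twoStateFreeCumulantSeq (fun k => φ (x ^ k)) (fun k => ψ (x ^ k)) n

/-- Two-state free independence of a family of (unital) subalgebras `S i`. A nonempty word
`a₁ ⋯ aₙ` with `aⱼ ∈ S (i j)` is encoded by the list of the pairs `(i j, aⱼ)`; the chain condition
says that neighbouring indices are different. -/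
def IsTwoStateFree (φ ψ : A →ₗ[ℂ] ℂ) {ι : Type*} (S : ι → Subalgebra ℂ A) : Prop :=
  ∀ w : List (ι × A), w ≠ [] →
    w.IsChain (fun p q => p.1 ≠ q.1) →
    (∀ p ∈ w, p.2 ∈ S p.1 ∧ ψ p.2 = 0) →
    ψ (w.map Prod.snd).prod = 0 ∧
      φ (w.map Prod.snd).prod = (w.map fun p => φ p.2).prod

/-- `X(t)`, `0 ≤ t ≤ T`, is a process with two-state freely independent increments: it starts at
`0`, is self-adjoint and `φ`-centered, its increments have stationary distributions for both
functionals, and the increments over disjoint intervals `[s j, t j) ⊆ [0, T]` are two-state freely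
independent. Values of `X` outside `[0, T]` are irrelevant. -/
structure HasTwoStateFreeIncrements (φ ψ : A →ₗ[ℂ] ℂ) (T : ℝ) (X : ℝ → A) : Prop where
  selfAdjoint : ∀ t, 0 ≤ t → t ≤ T → IsSelfAdjoint (X t)
  start : X 0 = 0
  centered : ∀ t, 0 ≤ t → t ≤ T → φ (X t) = 0
  stationary_fst : ∀ s t, 0 ≤ s → s ≤ t → t ≤ T → ∀ n : ℕ,
    φ ((X t - X s) ^ n) = φ (X (t - s) ^ n)
  stationary_snd : ∀ s t, 0 ≤ s → s ≤ t → t ≤ T → ∀ n : ℕ,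
    ψ ((X t - X s) ^ n) = ψ (X (t - s) ^ n)
  free : ∀ (k : ℕ) (s t : Fin k → ℝ), (∀ j, 0 ≤ s j ∧ s j ≤ t j ∧ t j ≤ T) →
    Pairwise (fun i j => Disjoint (Set.Ico (s i) (t i)) (Set.Ico (s j) (t j))) →
    IsTwoStateFree φ ψ (fun j => Algebra.adjoin ℂ {X (t j) - X (s j)})

/-- A two-state normal distribution: all two-state free cumulants of order `> 2` vanish. -/
def HasTwoStateNormalDistribution (φ ψ : A →ₗ[ℂ] ℂ) (x : A) : Prop :=
  ∀ n : ℕ, 2 < n → twoStateFreeCumulant φ ψ x n = 0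

/-- Algebraic two-state free Brownian motion on `[0, T]`. -/
structure IsTwoStateFreeBrownianMotion (φ ψ : A →ₗ[ℂ] ℂ) (T : ℝ) (X : ℝ → A) : Prop
    extends HasTwoStateFreeIncrements φ ψ T X where
  normal : ∀ s t, 0 ≤ s → s ≤ t → t ≤ T → HasTwoStateNormalDistribution φ ψ (X t - X s)
  variance : ∀ s t, 0 ≤ s → s ≤ t → t ≤ T → φ ((X t - X s) ^ 2) = ((t - s : ℝ) : ℂ)

/-- The process has parameter `α`: the first `ψ`-free cumulant (the `ψ`-mean) of `X(t)` is
`α t`. -/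
def HasParameter (ψ : A →ₗ[ℂ] ℂ) (T : ℝ) (X : ℝ → A) (α : ℝ) : Prop :=
  ∀ t, 0 ≤ t → t ≤ T → freeCumulant ψ (X t) 1 = ((α * t : ℝ) : ℂ)

end Algebraic

/-! ### The von Neumann algebra setting -/

section VonNeumann

variable {H : Type*} [NormedAddCommGroup H] [InnerProductSpace ℂ H] [CompleteSpace H]

/-- A functional on a von Neumann algebra `M ⊆ B(H)` is normal if it is ultraweakly
(σ-weakly) continuous, i.e. of the form `a ↦ ∑ₙ ⟨ξₙ, a ηₙ⟩` with `∑ₙ ‖ξₙ‖² < ∞` and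
`∑ₙ ‖ηₙ‖² < ∞`. -/
def IsNormalFunctional {M : VonNeumannAlgebra H} (φ : M.toStarSubalgebra →ₗ[ℂ] ℂ) : Prop :=
  ∃ ξ η : ℕ → H, Summable (fun n => ‖ξ n‖ ^ 2) ∧ Summable (fun n => ‖η n‖ ^ 2) ∧
    ∀ a : M.toStarSubalgebra, HasSum (fun n => inner ℂ (ξ n) ((a : H →L[ℂ] H) (η n))) (φ a)

/-- `(M, φ, ψ)` is a `W*`-non-commutative probability space: `φ` is a faithful normal state and `ψ`
is a normal state on the von Neumann algebra `M`. -/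
structure IsWStarProbabilitySpace (M : VonNeumannAlgebra H)
    (φ ψ : M.toStarSubalgebra →ₗ[ℂ] ℂ) : Prop where
  state_fst : IsState φ
  normal_fst : IsNormalFunctional φ
  faithful_fst : IsFaithfulFunctional φ
  state_snd : IsState ψ
  normal_snd : IsNormalFunctional ψ

/-- `M` is the von Neumann algebra generated by `X(t)`, `0 ≤ t ≤ T`. -/
def IsGeneratedBy (M : VonNeumannAlgebra H) (T : ℝ) (X : ℝ → M.toStarSubalgebra) : Prop :=
  ∀ N : VonNeumannAlgebra H, (∀ t, 0 ≤ t → t ≤ T → (X t : H →L[ℂ] H) ∈ N) → M ≤ N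

end VonNeumann

/-! Existence. On the full Fock space take vectors `e t` with `⟨e s, e t⟩ = min s t` and a unit
vector `f` orthogonal to all of them. Put `X t = ℓ(e t) + ℓ(e t)* + α t (1 - P)` with `P` the vacuum
projection, let `φ` be the vacuum state and `ψ` the vector state of `f`. Orthogonality of increments
gives two-state freeness (`exists_word_apply_eq`), and commuting `X t` past right creation operators
gives the moment recursion that characterizes centered two-state normal laws
(`twoStateFreeCumulantSeq_eq_zero`). The only delicate point is faithfulness of `φ`, i.e. that the
vacuum is separating. The commutant contains `(1 + α r(e T)) r(f)*` and `r(f) (r(h) + r(h)*) r(f)*`;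
these suffice as soon as `1 + α r(e T)` has dense range, which holds for `α ^ 2 * T ≤ 1`
(`eq_zero_of_apply_vac_eq_zero`).

Nonexistence. The `ψ`-law of `X t` is not given, only its mean. Over `N` short increments, the sum
of the squares minus `t`, and the sum of the `k`-th powers for `k > 2`, tend to `0` in the `L²`-norm
of `φ`. Since `φ` is faithful and `ψ` normal, their `ψ`-means tend to `0` as well
(`tendsto_mul_snd`). A limit theorem for free increments then shows that `X t` is semicircular under
`ψ`, with mean `α t` and variance `t`; this is expressed by the vanishing `ψ`-means of Chebyshev
polynomials (`snd_chebyshevSeq`). For `α ^ 2 * t > 1` the `φ`-law of `X t` acquires an atom (at `-1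
/ α`) which the `ψ`-law does not see. Normalized Chebyshev polynomials `p n` detect it: `φ (p n) =
1` and `φ (p n ^ 2)` stays bounded, while `ψ (p n ^ 2) → 0`. If `T > t`, there is room for a later
increment, and it yields `b` with `φ b = ψ b = 0` and `φ (b ^ 2) ≠ 0`. Two-state freeness gives `φ
(b * p n ^ 2 * b) = φ (b ^ 2) * ψ (p n ^ 2) → 0`, so `b` annihilates a weak limit of truncated `p n`
by faithfulness; but `φ (b ^ 2 * p n) = φ (b ^ 2)` does not tend to `0` (`false_of_free`). -/

/-! ### Weighted sums over non-crossing partitions -/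

section WeightedSums

variable {α β : Type*} [LinearOrder α] [LinearOrder β]

/-- The finite set of blocks `p` is a non-crossing partition of the finite set `s`. -/
structure IsNCPartition (s : Finset α) (p : Finset (Finset α)) : Prop where
  nonempty : ∀ V ∈ p, V.Nonempty
  subset : ∀ V ∈ p, V ⊆ s
  cover : ∀ x ∈ s, ∃ V ∈ p, x ∈ V
  unique : ∀ U ∈ p, ∀ V ∈ p, ∀ x, x ∈ U → x ∈ V → U = V
  noncrossing : ∀ U ∈ p, ∀ V ∈ p, ∀ x₁ ∈ U, ∀ y₁ ∈ V, ∀ x₂ ∈ U, ∀ y₂ ∈ V,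
    x₁ < y₁ → y₁ < x₂ → x₂ < y₂ → U = V

/-- `V` lies strictly between two elements of a block of `p`. -/
def IsInnerIn (p : Finset (Finset α)) (V : Finset α) : Prop :=
  ∃ U ∈ p, ∃ y₁ ∈ U, ∃ y₂ ∈ U, ∀ x ∈ V, y₁ < x ∧ x < y₂

open Classical in
/-- The non-crossing partitions of a finite subset of a linear order. -/
noncomputable def ncPartitions (s : Finset α) : Finset (Finset (Finset α)) :=
  s.powerset.powerset.filter (IsNCPartition s)

open Classical in
/-- The product over the blocks of `p`, with weights `c` for outer and `r` for inner blocks. -/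
noncomputable def ncWeight (c r : ℕ → ℂ) (p : Finset (Finset α)) : ℂ :=
  ∏ V ∈ p, if IsInnerIn p V then r V.card else c V.card

/-- The sum of the weights of all non-crossing partitions of `s`. -/
noncomputable def ncSum (c r : ℕ → ℂ) (s : Finset α) : ℂ :=
  ∑ p ∈ ncPartitions s, ncWeight c r p

theorem mem_ncPartitions {s : Finset α} {p : Finset (Finset α)} :
    p ∈ ncPartitions s ↔ IsNCPartition s p := by
  simp only [ncPartitions, Finset.mem_filter, Finset.mem_powerset, and_iff_right_iff_imp]
  exact fun h V hV => Finset.mem_powerset.2 (h.subset V hV)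

theorem isNCPartition_map (e : α ↪o β) {s : Finset α} {p : Finset (Finset α)} :
    IsNCPartition (s.map e.toEmbedding) (p.map (Finset.mapEmbedding e.toEmbedding).toEmbedding) ↔
      IsNCPartition s p := by
  constructor
  · intro h
    have hm : ∀ V ∈ p, V.map e.toEmbedding ∈
        p.map (Finset.mapEmbedding e.toEmbedding).toEmbedding := fun V hV =>
      Finset.mem_map_of_mem (Finset.mapEmbedding e.toEmbedding).toEmbedding hV
    have hx : ∀ (V : Finset α), ∀ x ∈ V, e x ∈ V.map e.toEmbedding := fun V x hx =>
      Finset.mem_map_of_mem e.toEmbedding hx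
    refine ⟨fun V hV => ?_, fun V hV => ?_, fun x hxs => ?_, fun U hU V hV x hxU hxV => ?_, ?_⟩
    · simpa using h.nonempty _ (hm V hV)
    · exact Finset.map_subset_map.1 (h.subset _ (hm V hV))
    · obtain ⟨V', hV', hxV⟩ := h.cover _ (hx s x hxs)
      obtain ⟨V, hV, rfl⟩ := Finset.mem_map.1 hV'
      refine ⟨V, hV, ?_⟩
      obtain ⟨y, hy, hyx⟩ := Finset.mem_map.1 hxV
      rwa [← e.injective hyx]
    · exact Finset.map_injective _ (h.unique _ (hm U hU) _ (hm V hV) _ (hx U x hxU) (hx V x hxV))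
    · intro U hU V hV x₁ h1 y₁ h2 x₂ h3 y₂ h4 a b c
      exact Finset.map_injective _ (h.noncrossing _ (hm U hU) _ (hm V hV) _ (hx U x₁ h1) _
        (hx V y₁ h2) _ (hx U x₂ h3) _ (hx V y₂ h4) (e.lt_iff_lt.2 a) (e.lt_iff_lt.2 b)
        (e.lt_iff_lt.2 c))
  · intro h
    refine ⟨?_, ?_, ?_, ?_, ?_⟩
    · simp only [Finset.mem_map]
      rintro _ ⟨V, hV, rfl⟩
      simpa using h.nonempty V hV
    · simp only [Finset.mem_map]
      rintro _ ⟨V, hV, rfl⟩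
      exact Finset.map_subset_map.2 (h.subset V hV)
    · simp only [Finset.mem_map]
      rintro _ ⟨x, hx, rfl⟩
      obtain ⟨V, hV, hxV⟩ := h.cover x hx
      exact ⟨_, ⟨V, hV, rfl⟩, Finset.mem_map_of_mem e.toEmbedding hxV⟩
    · simp only [Finset.mem_map]
      rintro _ ⟨U, hU, rfl⟩ _ ⟨V, hV, rfl⟩ x hxU hxV
      obtain ⟨y, hy, rfl⟩ := Finset.mem_map.1 hxU
      obtain ⟨z, hz, hzy⟩ := Finset.mem_map.1 hxV
      rw [e.injective hzy] at hz
      rw [h.unique U hU V hV y hy hz]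
    · simp only [Finset.mem_map]
      rintro _ ⟨U, hU, rfl⟩ _ ⟨V, hV, rfl⟩ x₁ h1 y₁ h2 x₂ h3 y₂ h4 a b c
      obtain ⟨x₁, k1, rfl⟩ := Finset.mem_map.1 h1
      obtain ⟨y₁, k2, rfl⟩ := Finset.mem_map.1 h2
      obtain ⟨x₂, k3, rfl⟩ := Finset.mem_map.1 h3
      obtain ⟨y₂, k4, rfl⟩ := Finset.mem_map.1 h4
      rw [h.noncrossing U hU V hV x₁ k1 y₁ k2 x₂ k3 y₂ k4 (e.lt_iff_lt.1 a) (e.lt_iff_lt.1 b)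
        (e.lt_iff_lt.1 c)]

theorem isInnerIn_map (e : α ↪o β) {p : Finset (Finset α)} {V : Finset α} :
    IsInnerIn (p.map (Finset.mapEmbedding e.toEmbedding).toEmbedding) (V.map e.toEmbedding) ↔
      IsInnerIn p V := by
  simp [IsInnerIn]

theorem ncWeight_map (e : α ↪o β) (c r : ℕ → ℂ) (p : Finset (Finset α)) :
    ncWeight c r (p.map (Finset.mapEmbedding e.toEmbedding).toEmbedding) = ncWeight c r p := by
  classical
  rw [ncWeight, Finset.prod_map, ncWeight]
  refine Finset.prod_congr rfl fun V _ => ?_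
  have := isInnerIn_map e (p := p) (V := V)
  simp only [RelEmbedding.coe_toEmbedding, Finset.mapEmbedding_apply, Finset.card_map]
  simp only [this]

/-- Crossings, inner blocks and block sizes depend only on the order pattern. This allows passing
from `Fin n` to `range n` and from an interval to an initial segment. -/
theorem ncSum_map (e : α ↪o β) (c r : ℕ → ℂ) (s : Finset α) :
    ncSum c r (s.map e.toEmbedding) = ncSum c r s := by
  classical
  symm
  refine Finset.sum_bij (fun p _ => p.map (Finset.mapEmbedding e.toEmbedding).toEmbedding)
    (fun p hp => ?_) (fun p _ q _ h => Finset.map_injective _ h) (fun q hq => ?_)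
    (fun p _ => (ncWeight_map e c r p).symm)
  · rw [mem_ncPartitions] at hp ⊢
    exact (isNCPartition_map e).2 hp
  · rw [mem_ncPartitions] at hq
    have hqe : (s.powerset.filter fun V => V.map e.toEmbedding ∈ q).map
        (Finset.mapEmbedding e.toEmbedding).toEmbedding = q := by
      ext W
      simp only [Finset.mem_map, Finset.mem_filter, Finset.mem_powerset]
      constructor
      · rintro ⟨V, ⟨-, hV⟩, rfl⟩
        exact hV
      · intro hW
        obtain ⟨V, hV, rfl⟩ := Finset.subset_map_iff.1 (hq.subset W hW)
        exact ⟨V, ⟨hV, hW⟩, rfl⟩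
    refine ⟨_, ?_, hqe⟩
    rw [mem_ncPartitions, ← isNCPartition_map e, hqe]
    exact hq

theorem ncSum_Ico (c r : ℕ → ℂ) (a b : ℕ) :
    ncSum c r (Finset.Ico a b) = ncSum c r (Finset.range (b - a)) := by
  rw [← ncSum_map (OrderEmbedding.addLeft a) c r (Finset.range (b - a))]
  congr 1
  ext x
  simp only [Finset.mem_Ico, Finset.mem_map, Finset.mem_range]
  constructor
  · intro h
    exact ⟨x - a, by omega, by simp; omega⟩
  · rintro ⟨y, hy, rfl⟩
    simp
    omega

theorem ncPartitions_empty : ncPartitions (∅ : Finset α) = {∅} := by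
  refine Finset.eq_singleton_iff_unique_mem.2 ⟨?_, fun p hp => ?_⟩
  · rw [mem_ncPartitions]
    constructor <;> simp
  · rw [mem_ncPartitions] at hp
    refine Finset.eq_empty_of_forall_notMem fun V hV => ?_
    obtain ⟨x, hx⟩ := hp.nonempty V hV
    exact absurd (hp.subset V hV hx) (Finset.notMem_empty x)

theorem ncSum_range_zero (c r : ℕ → ℂ) : ncSum c r (Finset.range 0) = 1 := by
  rw [Finset.range_zero, ncSum, ncPartitions_empty, Finset.sum_singleton, ncWeight,
    Finset.prod_empty]

theorem not_isInnerIn_of_zero_mem {p : Finset (Finset ℕ)} {B : Finset ℕ} (h : 0 ∈ B) :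
    ¬ IsInnerIn p B := by
  rintro ⟨U, -, y₁, -, y₂, -, h'⟩
  exact Nat.not_lt_zero _ (h' 0 h).1

theorem ncWeight_eq_zero {c r : ℕ → ℂ} {p : Finset (Finset ℕ)} {B : Finset ℕ} (hB : B ∈ p)
    (h0 : 0 ∈ B) (hc : c B.card = 0) : ncWeight c r p = 0 := by
  rw [ncWeight]
  refine Finset.prod_eq_zero hB ?_
  rw [if_neg (not_isInnerIn_of_zero_mem h0), hc]

theorem ncSum_range_one (c r : ℕ → ℂ) (hc : c 1 = 0) : ncSum c r (Finset.range 1) = 0 := by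
  refine Finset.sum_eq_zero fun p hp => ?_
  rw [mem_ncPartitions] at hp
  obtain ⟨B, hB, h0⟩ := hp.cover 0 (by simp)
  refine ncWeight_eq_zero hB h0 ?_
  have : B = {0} := by
    refine Finset.eq_singleton_iff_unique_mem.2 ⟨h0, fun x hx => ?_⟩
    simpa using hp.subset B hB hx
  rw [this, Finset.card_singleton, hc]

/-- A block with elements on both sides of `j + 1` would cross the pair `{0, j + 1}`. -/
theorem IsNCPartition.subset_or_subset {n j : ℕ} {p : Finset (Finset ℕ)}
    (hp : IsNCPartition (Finset.range (n + 2)) p) (hB : {0, j + 1} ∈ p) {V : Finset ℕ}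
    (hV : V ∈ p) (hne : V ≠ {0, j + 1}) :
    V ⊆ Finset.Ico 1 (j + 1) ∨ V ⊆ Finset.Ico (j + 2) (n + 2) := by
  have h0 : ∀ x ∈ V, x ≠ 0 := fun x hx h =>
    hne (hp.unique V hV _ hB x hx (by simp [h]))
  have h1 : ∀ x ∈ V, x ≠ j + 1 := fun x hx h =>
    hne (hp.unique V hV _ hB x hx (by simp [h]))
  have hlt : ∀ x ∈ V, x < n + 2 := fun x hx => by simpa using hp.subset V hV hx
  by_cases h : ∃ x ∈ V, x < j + 1
  · left
    obtain ⟨x, hx, hxj⟩ := h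
    intro y hy
    have := h0 y hy
    have := h1 y hy
    have := h0 x hx
    rw [Finset.mem_Ico]
    refine ⟨by omega, ?_⟩
    by_contra hyj
    exact hne (hp.noncrossing _ hB _ hV 0 (by simp) x hx (j + 1) (by simp) y hy (by omega) hxj
      (by omega)).symm
  · right
    intro y hy
    have := h1 y hy
    have := hlt y hy
    have : ¬ y < j + 1 := fun hyj => h ⟨y, hy, hyj⟩
    rw [Finset.mem_Ico]
    omega

/-- Gluing a pair `{0, j + 1}`, a non-crossing partition of the elements in between and one of the
elements to the right. -/
theorem IsNCPartition.glue {n j : ℕ} (hj : j ≤ n) {p q : Finset (Finset ℕ)}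
    (hp : IsNCPartition (Finset.Ico 1 (j + 1)) p)
    (hq : IsNCPartition (Finset.Ico (j + 2) (n + 2)) q) :
    IsNCPartition (Finset.range (n + 2)) (insert {0, j + 1} (p ∪ q)) := by
  have hp' : ∀ V ∈ p, ∀ x ∈ V, 1 ≤ x ∧ x < j + 1 := fun V hV x hx => by
    simpa using hp.subset V hV hx
  have hq' : ∀ V ∈ q, ∀ x ∈ V, j + 2 ≤ x ∧ x < n + 2 := fun V hV x hx => by
    simpa using hq.subset V hV hx
  refine ⟨?_, ?_, ?_, ?_, ?_⟩
  · simp only [Finset.mem_insert, Finset.mem_union]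
    rintro V (rfl | hV | hV)
    · simp
    · exact hp.nonempty V hV
    · exact hq.nonempty V hV
  · simp only [Finset.mem_insert, Finset.mem_union]
    rintro V (rfl | hV | hV) x hx
    · simp only [Finset.mem_insert, Finset.mem_singleton, Finset.mem_range] at hx ⊢
      omega
    · have := hp' V hV x hx
      rw [Finset.mem_range]
      omega
    · have := hq' V hV x hx
      rw [Finset.mem_range]
      omega
  · intro x hx
    simp only [Finset.mem_range] at hx
    by_cases h1 : 1 ≤ x ∧ x < j + 1
    · obtain ⟨V, hV, hxV⟩ := hp.cover x (by simpa using h1)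
      exact ⟨V, by simp [hV], hxV⟩
    · by_cases h2 : j + 2 ≤ x
      · obtain ⟨V, hV, hxV⟩ := hq.cover x (by simpa using ⟨h2, hx⟩)
        exact ⟨V, by simp [hV], hxV⟩
      · refine ⟨{0, j + 1}, by simp, ?_⟩
        simp only [Finset.mem_insert, Finset.mem_singleton]
        omega
  · simp only [Finset.mem_insert, Finset.mem_union]
    rintro U (rfl | hU | hU) V (rfl | hV | hV) x hxU hxV
    · rfl
    · have := hp' V hV x hxV
      simp only [Finset.mem_insert, Finset.mem_singleton] at hxU
      omega
    · have := hq' V hV x hxV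
      simp only [Finset.mem_insert, Finset.mem_singleton] at hxU
      omega
    · have := hp' U hU x hxU
      simp only [Finset.mem_insert, Finset.mem_singleton] at hxV
      omega
    · exact hp.unique U hU V hV x hxU hxV
    · have := hp' U hU x hxU
      have := hq' V hV x hxV
      omega
    · have := hq' U hU x hxU
      simp only [Finset.mem_insert, Finset.mem_singleton] at hxV
      omega
    · have := hq' U hU x hxU
      have := hp' V hV x hxV
      omega
    · exact hq.unique U hU V hV x hxU hxV
  · simp only [Finset.mem_insert, Finset.mem_union]
    rintro U (rfl | hU | hU) V (rfl | hV | hV) x₁ h1 y₁ h2 x₂ h3 y₂ h4 a b c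
    · rfl
    · have := hp' V hV y₁ h2
      have := hp' V hV y₂ h4
      simp only [Finset.mem_insert, Finset.mem_singleton] at h1 h3
      omega
    · have := hq' V hV y₁ h2
      simp only [Finset.mem_insert, Finset.mem_singleton] at h1 h3
      omega
    · have := hp' U hU x₁ h1
      have := hp' U hU x₂ h3
      simp only [Finset.mem_insert, Finset.mem_singleton] at h2 h4
      omega
    · exact hp.noncrossing U hU V hV x₁ h1 y₁ h2 x₂ h3 y₂ h4 a b c
    · have := hp' U hU x₂ h3
      have := hq' V hV y₁ h2
      omega
    · have := hq' U hU x₁ h1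
      simp only [Finset.mem_insert, Finset.mem_singleton] at h2 h4
      omega
    · have := hq' U hU x₁ h1
      have := hp' V hV y₁ h2
      omega
    · exact hq.noncrossing U hU V hV x₁ h1 y₁ h2 x₂ h3 y₂ h4 a b c

/-- Everything under the arc from `0` to `j + 1` becomes inner, whence the weights `r, r` for `p`.
Blocks to the right of the arc keep their status, since no block outside `q` reaches beyond them. -/
theorem ncWeight_glue {n j : ℕ} (c r : ℕ → ℂ) {p q : Finset (Finset ℕ)}
    (hp : IsNCPartition (Finset.Ico 1 (j + 1)) p)
    (hq : IsNCPartition (Finset.Ico (j + 2) (n + 2)) q) :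
    ncWeight c r (insert {0, j + 1} (p ∪ q)) = c 2 * (ncWeight r r p * ncWeight c r q) := by
  classical
  have hp' : ∀ V ∈ p, ∀ x ∈ V, 1 ≤ x ∧ x < j + 1 := fun V hV x hx => by
    simpa using hp.subset V hV hx
  have hq' : ∀ V ∈ q, ∀ x ∈ V, j + 2 ≤ x ∧ x < n + 2 := fun V hV x hx => by
    simpa using hq.subset V hV hx
  have hB : ({0, j + 1} : Finset ℕ) ∉ p ∪ q := by
    rw [Finset.mem_union]
    rintro (h | h)
    · have := hp' _ h 0 (by simp)
      omega
    · have := hq' _ h 0 (by simp)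
      omega
  have hd : Disjoint p q := by
    rw [Finset.disjoint_left]
    intro V hV hV'
    obtain ⟨x, hx⟩ := hp.nonempty V hV
    have := hp' V hV x hx
    have := hq' V hV' x hx
    omega
  rw [ncWeight, Finset.prod_insert hB, Finset.prod_union hd,
    if_neg (not_isInnerIn_of_zero_mem (by simp)), Finset.card_pair (by omega)]
  congr 2
  · refine Finset.prod_congr rfl fun V hV => ?_
    rw [if_pos, ite_self]
    refine ⟨{0, j + 1}, by simp, 0, by simp, j + 1, by simp, fun x hx => ?_⟩
    have := hp' V hV x hx
    omega
  · refine Finset.prod_congr rfl fun V hV => ?_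
    congr 1
    obtain ⟨x, hx⟩ := hq.nonempty V hV
    rw [eq_iff_iff]
    constructor
    · rintro ⟨U, hU, y₁, hy₁, y₂, hy₂, h⟩
      have h1 := (h x hx).2
      have h2 := hq' V hV x hx
      simp only [Finset.mem_insert, Finset.mem_union] at hU
      rcases hU with rfl | hU | hU
      · simp only [Finset.mem_insert, Finset.mem_singleton] at hy₂
        omega
      · have := hp' U hU y₂ hy₂
        omega
      · exact ⟨U, hU, y₁, hy₁, y₂, hy₂, h⟩
    · rintro ⟨U, hU, h⟩
      exact ⟨U, by simp [hU], h⟩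

theorem IsNCPartition.filter_left {n j : ℕ} {p : Finset (Finset ℕ)}
    (hp : IsNCPartition (Finset.range (n + 2)) p) (hB : {0, j + 1} ∈ p) :
    IsNCPartition (Finset.Ico 1 (j + 1)) (p.filter (· ⊆ Finset.Ico 1 (j + 1))) ∧
      IsNCPartition (Finset.Ico (j + 2) (n + 2)) (p.filter (· ⊆ Finset.Ico (j + 2) (n + 2))) := by
  have hjn : j + 1 < n + 2 := by
    have := hp.subset _ hB (show j + 1 ∈ _ by simp)
    rwa [Finset.mem_range] at this
  have key : ∀ s : Finset ℕ, (∀ x ∈ s, x < n + 2 ∧ ∀ V ∈ p, x ∈ V → V ⊆ s) →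
      IsNCPartition s (p.filter (· ⊆ s)) := by
    intro s hs
    refine ⟨fun V hV => hp.nonempty V (Finset.mem_filter.1 hV).1,
      fun V hV => (Finset.mem_filter.1 hV).2, fun x hx => ?_, fun U hU V hV =>
      hp.unique U (Finset.mem_filter.1 hU).1 V (Finset.mem_filter.1 hV).1, fun U hU V hV =>
      hp.noncrossing U (Finset.mem_filter.1 hU).1 V (Finset.mem_filter.1 hV).1⟩
    obtain ⟨V, hV, hxV⟩ := hp.cover x (Finset.mem_range.2 (hs x hx).1)
    exact ⟨V, Finset.mem_filter.2 ⟨hV, (hs x hx).2 V hV hxV⟩, hxV⟩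
  constructor
  · refine key _ fun x hx => ?_
    rw [Finset.mem_Ico] at hx
    refine ⟨by omega, fun V hV hxV => ?_⟩
    refine (hp.subset_or_subset hB hV ?_).resolve_right fun h => ?_
    · rintro rfl
      simp only [Finset.mem_insert, Finset.mem_singleton] at hxV
      omega
    · have := Finset.mem_Ico.1 (h hxV)
      omega
  · refine key _ fun x hx => ?_
    rw [Finset.mem_Ico] at hx
    refine ⟨by omega, fun V hV hxV => ?_⟩
    refine (hp.subset_or_subset hB hV ?_).resolve_left fun h => ?_
    · rintro rfl
      simp only [Finset.mem_insert, Finset.mem_singleton] at hxV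
      omega
    · have := Finset.mem_Ico.1 (h hxV)
      omega

theorem sum_ncWeight_of_pair_mem (c r : ℕ → ℂ) {n j : ℕ} (hj : j ≤ n) :
    ∑ p ∈ (ncPartitions (Finset.range (n + 2))).filter ({0, j + 1} ∈ ·), ncWeight c r p =
      c 2 * (ncSum r r (Finset.range j) * ncSum c r (Finset.range (n - j))) := by
  classical
  have e1 : Finset.range j = Finset.range (j + 1 - 1) := by simp
  have e2 : Finset.range (n - j) = Finset.range (n + 2 - (j + 2)) := by simp
  rw [e1, e2, ← ncSum_Ico, ← ncSum_Ico, ncSum, ncSum, Finset.sum_mul_sum, ← Finset.sum_product',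
    Finset.mul_sum]
  symm
  refine Finset.sum_bij' (fun pq _ => insert {0, j + 1} (pq.1 ∪ pq.2))
    (fun p _ => (p.filter (· ⊆ Finset.Ico 1 (j + 1)),
      p.filter (· ⊆ Finset.Ico (j + 2) (n + 2)))) ?_ ?_ ?_ ?_ ?_
  · rintro ⟨p, q⟩ h
    simp only [Finset.mem_product, mem_ncPartitions] at h
    simp only [Finset.mem_filter, mem_ncPartitions, Finset.mem_insert, true_or, and_true]
    exact h.1.glue hj h.2
  · intro p hp
    simp only [Finset.mem_filter, mem_ncPartitions] at hp
    simp only [Finset.mem_product, mem_ncPartitions]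
    exact hp.1.filter_left hp.2
  · rintro ⟨p, q⟩ h
    simp only [Finset.mem_product, mem_ncPartitions] at h
    have hsub : ∀ V ∈ p, ∀ W ∈ q, Disjoint V W := fun V hV W hW => by
      rw [Finset.disjoint_left]
      intro x hx hx'
      have := Finset.mem_Ico.1 (h.1.subset V hV hx)
      have := Finset.mem_Ico.1 (h.2.subset W hW hx')
      omega
    have hdis : Disjoint (Finset.Ico 1 (j + 1)) (Finset.Ico (j + 2) (n + 2)) := by
      rw [Finset.disjoint_left]
      intro x hx hx'
      rw [Finset.mem_Ico] at hx hx'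
      omega
    have hB : ∀ a b, 1 ≤ a → ¬ ({0, j + 1} : Finset ℕ) ⊆ Finset.Ico a b := fun a b ha hs => by
      have := Finset.mem_Ico.1 (hs (show 0 ∈ _ by simp))
      omega
    refine Prod.ext ?_ ?_
    · ext V
      simp only [Finset.mem_filter, Finset.mem_insert, Finset.mem_union]
      constructor
      · rintro ⟨rfl | hV | hV, hs⟩
        · exact absurd hs (hB _ _ le_rfl)
        · exact hV
        · obtain ⟨x, hx⟩ := h.2.nonempty V hV
          exact absurd (h.2.subset V hV hx) (Finset.disjoint_left.1 hdis (hs hx))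
      · exact fun hV => ⟨Or.inr (Or.inl hV), h.1.subset V hV⟩
    · ext V
      simp only [Finset.mem_filter, Finset.mem_insert, Finset.mem_union]
      constructor
      · rintro ⟨rfl | hV | hV, hs⟩
        · exact absurd hs (hB _ _ (by omega))
        · obtain ⟨x, hx⟩ := h.1.nonempty V hV
          exact absurd (hs hx) (Finset.disjoint_left.1 hdis (h.1.subset V hV hx))
        · exact hV
      · exact fun hV => ⟨Or.inr (Or.inr hV), h.2.subset V hV⟩
  · intro p hp
    simp only [Finset.mem_filter, mem_ncPartitions] at hp
    ext V
    simp only [Finset.mem_insert, Finset.mem_union, Finset.mem_filter]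
    constructor
    · rintro (rfl | hV | hV)
      exacts [hp.2, hV.1, hV.1]
    · intro hV
      by_cases hne : V = {0, j + 1}
      · exact Or.inl hne
      · rcases hp.1.subset_or_subset hp.2 hV hne with h | h
        exacts [Or.inr (Or.inl ⟨hV, h⟩), Or.inr (Or.inr ⟨hV, h⟩)]
  · rintro ⟨p, q⟩ h
    simp only [Finset.mem_product, mem_ncPartitions] at h
    exact (ncWeight_glue c r h.1 h.2).symm

/-- If only pairs are allowed as outer blocks, then splitting off the outer pair that contains the
first element gives a recursion. -/
theorem ncSum_range_add_two (c r : ℕ → ℂ) (hc : ∀ k, k ≠ 0 → k ≠ 2 → c k = 0) (n : ℕ) :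
    ncSum c r (Finset.range (n + 2)) = c 2 * ∑ j ∈ Finset.range (n + 1),
      ncSum r r (Finset.range j) * ncSum c r (Finset.range (n - j)) := by
  classical
  rw [Finset.mul_sum]
  -- The block of `0` is always outer, so a partition of nonzero weight has a pair there, and this
  -- pair determines `j`.
  have key : ∀ p ∈ ncPartitions (Finset.range (n + 2)), ncWeight c r p =
      ∑ j ∈ Finset.range (n + 1), if {0, j + 1} ∈ p then ncWeight c r p else 0 := by
    intro p hp
    rw [mem_ncPartitions] at hp
    obtain ⟨B, hB, h0⟩ := hp.cover 0 (by simp)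
    by_cases h2 : B.card = 2
    · obtain ⟨k, hk, rfl⟩ : ∃ k ∈ Finset.range (n + 1), B = {0, k + 1} := by
        obtain ⟨x, y, hxy, rfl⟩ := Finset.card_eq_two.1 h2
        have hx := Finset.mem_range.1 (hp.subset _ hB (show x ∈ _ by simp))
        have hy := Finset.mem_range.1 (hp.subset _ hB (show y ∈ _ by simp))
        simp only [Finset.mem_insert, Finset.mem_singleton] at h0
        rcases h0 with rfl | rfl
        · exact ⟨y - 1, by rw [Finset.mem_range]; omega, by rw [Nat.sub_add_cancel (by omega)]⟩
        · exact ⟨x - 1, by rw [Finset.mem_range]; omega,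
            by rw [Nat.sub_add_cancel (by omega), Finset.pair_comm]⟩
      rw [Finset.sum_eq_single_of_mem k hk, if_pos hB]
      intro j _ hjk
      rw [if_neg]
      intro hj
      have := hp.unique _ hB _ hj 0 (by simp) (by simp)
      have h3 : k + 1 ∈ ({0, j + 1} : Finset ℕ) := by rw [← this]; simp
      simp only [Finset.mem_insert, Finset.mem_singleton] at h3
      omega
    · have hw : ncWeight c r p = 0 :=
        ncWeight_eq_zero hB h0 (hc _ (Finset.card_ne_zero_of_mem h0) h2)
      simp [hw]
  rw [ncSum, Finset.sum_congr rfl key, Finset.sum_comm]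
  refine Finset.sum_congr rfl fun j hj => ?_
  rw [← Finset.sum_filter, sum_ncWeight_of_pair_mem c r (by rw [Finset.mem_range] at hj; omega)]

theorem isNCPartition_univ_parts {n : ℕ} (π : Finpartition (Finset.univ : Finset (Fin n))) :
    IsNCPartition Finset.univ π.parts ↔ IsNoncrossing π :=
  ⟨fun h => h.noncrossing, fun h => ⟨fun _ hV => π.nonempty_of_mem_parts hV,
    fun _ _ => Finset.subset_univ _, fun x hx => ⟨π.part x, π.part_mem.2 hx, π.mem_part hx⟩,
    fun _ hU _ hV _ hxU hxV => π.eq_of_mem_parts hU hV hxU hxV, h⟩⟩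

theorem sum_noncrossingPartitions (c r : ℕ → ℂ) (n : ℕ) :
    ∑ π ∈ noncrossingPartitions n,
      (∏ V ∈ outerBlocks π, c V.card) * ∏ V ∈ innerBlocks π, r V.card =
      ncSum c r (Finset.range n) := by
  classical
  have hr : Finset.range n = (Finset.univ : Finset (Fin n)).map (Fin.valOrderEmb n).toEmbedding := by
    ext x
    simp only [Finset.mem_range, Finset.mem_map, Finset.mem_univ, true_and]
    exact ⟨fun h => ⟨⟨x, h⟩, rfl⟩, by rintro ⟨y, rfl⟩; exact y.2⟩
  rw [hr, ncSum_map]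
  refine Finset.sum_bij (fun π _ => π.parts) (fun π hπ => ?_)
    (fun π _ π' _ h => Finpartition.ext h) (fun p hp => ?_) (fun π _ => ?_)
  · rw [mem_ncPartitions, isNCPartition_univ_parts]
    exact (Finset.mem_filter.1 hπ).2
  · rw [mem_ncPartitions] at hp
    refine ⟨⟨p, ?_, ?_, fun h => ?_⟩, ?_, rfl⟩
    · rw [Finset.supIndep_iff_pairwiseDisjoint]
      intro U hU V hV hUV
      rw [Function.onFun, id, id, Finset.disjoint_left]
      exact fun x hxU hxV => hUV (hp.unique U hU V hV x hxU hxV)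
    · ext x
      simpa using hp.cover x (Finset.mem_univ x)
    · exact Finset.not_nonempty_empty (hp.nonempty _ h)
    · rw [noncrossingPartitions, Finset.mem_filter]
      exact ⟨Finset.mem_univ _, hp.noncrossing⟩
  · rw [ncWeight, ← Finset.prod_filter_mul_prod_filter_not π.parts (IsInnerIn π.parts), mul_comm]
    congr 1
    · refine Finset.prod_congr rfl fun V hV => ?_
      rw [if_pos (Finset.mem_filter.1 hV).2]
    · refine Finset.prod_congr rfl fun V hV => ?_
      rw [if_neg (Finset.mem_filter.1 hV).2]

theorem sum_noncrossingPartitions_self (r : ℕ → ℂ) (n : ℕ) :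
    ∑ π ∈ noncrossingPartitions n, ∏ V ∈ π.parts, r V.card = ncSum r r (Finset.range n) := by
  classical
  rw [← sum_noncrossingPartitions]
  refine Finset.sum_congr rfl fun π _ => ?_
  rw [outerBlocks, innerBlocks, mul_comm, Finset.prod_filter_mul_prod_filter_not]

end WeightedSums

/-! ### Two-state normal distributions in terms of moments -/

section Moments

variable {m m' : ℕ → ℂ}

theorem ncSum_freeCumulantSeq (h0 : m 0 = 1) (n : ℕ) :
    ncSum (freeCumulantSeq m) (freeCumulantSeq m) (Finset.range n) = m n := by
  rcases eq_or_ne n 0 with rfl | hn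
  · rw [ncSum_range_zero, h0]
  · rw [← sum_noncrossingPartitions_self, ← moment_eq_sum_freeCumulant m hn]

theorem ncSum_twoStateFreeCumulantSeq (h0 : m 0 = 1) (n : ℕ) :
    ncSum (twoStateFreeCumulantSeq m m') (freeCumulantSeq m') (Finset.range n) = m n := by
  rcases eq_or_ne n 0 with rfl | hn
  · rw [ncSum_range_zero, h0]
  · rw [← sum_noncrossingPartitions, ← moment_eq_sum_twoStateFreeCumulant m m' hn]

theorem sum_eq_add_sum_univ_notMem (n : ℕ) (hn : n ≠ 0) (c r : ℕ → ℂ) :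
    ∑ π ∈ noncrossingPartitions n,
      (∏ V ∈ outerBlocks π, c V.card) * ∏ V ∈ innerBlocks π, r V.card =
    c n + ∑ π ∈ (noncrossingPartitions n).filter (fun π => Finset.univ ∉ π.parts),
      (∏ V ∈ outerBlocks π, c V.card) * ∏ V ∈ innerBlocks π, r V.card := by
  classical
  obtain ⟨π₀, h₀, hs⟩ := filter_univ_mem_parts hn
  have hnot : ¬ IsInnerBlock π₀ Finset.univ := by
    rintro ⟨U, -, y₁, -, y₂, -, h⟩
    exact lt_irrefl _ (h y₁ (Finset.mem_univ _)).1
  have hout : outerBlocks π₀ = {Finset.univ} := by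
    rw [outerBlocks, h₀, Finset.filter_singleton, if_pos hnot]
  have hin : innerBlocks π₀ = ∅ := by
    rw [innerBlocks, h₀, Finset.filter_singleton, if_neg hnot]
  rw [← Finset.sum_filter_add_sum_filter_not _ (fun π => Finset.univ ∈ π.parts), hs,
    Finset.sum_singleton, hout, hin, Finset.prod_singleton, Finset.prod_empty, mul_one,
    Finset.card_univ, Fintype.card_fin]

theorem univ_mem_parts_of_fin_one (π : Finpartition (Finset.univ : Finset (Fin 1))) :
    Finset.univ ∈ π.parts := by
  have hx : (0 : Fin 1) ∈ (Finset.univ : Finset (Fin 1)) := Finset.mem_univ _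
  convert π.part_mem.2 hx
  ext x
  simp only [Finset.mem_univ, true_iff]
  rw [Subsingleton.elim x 0]
  exact π.mem_part hx

/-- The moment-cumulant system is triangular: the one-block partition contributes `c n`, and all
other partitions involve smaller indices only. -/
theorem twoStateFreeCumulantSeq_unique (c : ℕ → ℂ)
    (h : ∀ n, n ≠ 0 → ncSum c (freeCumulantSeq m') (Finset.range n) = m n) (n : ℕ) (hn : n ≠ 0) :
    twoStateFreeCumulantSeq m m' n = c n := by
  classical
  induction n using Nat.strong_induction_on with
  | _ n ih =>
    have h1 := moment_eq_sum_twoStateFreeCumulant m m' hn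
    have h2 := h n hn
    rw [← sum_noncrossingPartitions, sum_eq_add_sum_univ_notMem n hn] at h2
    rw [sum_eq_add_sum_univ_notMem n hn, ← h2] at h1
    have h3 : ∑ π ∈ (noncrossingPartitions n).filter (fun π => Finset.univ ∉ π.parts),
        (∏ V ∈ outerBlocks π, c V.card) * ∏ V ∈ innerBlocks π, freeCumulantSeq m' V.card =
        ∑ π ∈ (noncrossingPartitions n).filter (fun π => Finset.univ ∉ π.parts),
        (∏ V ∈ outerBlocks π, twoStateFreeCumulantSeq m m' V.card) *
          ∏ V ∈ innerBlocks π, freeCumulantSeq m' V.card := by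
      refine Finset.sum_congr rfl fun π hπ => ?_
      congr 1
      refine Finset.prod_congr rfl fun V hV => ?_
      have hV' := (Finset.mem_filter.1 hV).1
      exact (ih _ (card_lt_of_univ_notMem (Finset.mem_filter.1 hπ).2 hV')
        (Finset.card_ne_zero.2 (π.nonempty_of_mem_parts hV'))).symm
    rw [h3] at h1
    exact (add_right_cancel h1).symm

/-- The moments of a centered two-state normal distribution satisfy a recursion. -/
theorem moment_add_two_of_twoStateFreeCumulantSeq_eq_zero (h0 : m 0 = 1) (h0' : m' 0 = 1)
    (h1 : m 1 = 0) (h : ∀ n, 2 < n → twoStateFreeCumulantSeq m m' n = 0) (n : ℕ) :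
    m (n + 2) = m 2 * ∑ j ∈ Finset.range (n + 1), m' j * m (n - j) := by
  have hc1 : twoStateFreeCumulantSeq m m' 1 = 0 := by
    have h2 := moment_eq_sum_twoStateFreeCumulant m m' one_ne_zero
    rw [sum_eq_add_sum_univ_notMem 1 one_ne_zero, h1, Finset.sum_eq_zero, add_zero] at h2
    · exact h2.symm
    · exact fun π hπ => absurd (univ_mem_parts_of_fin_one π) (Finset.mem_filter.1 hπ).2
  have hc : ∀ k, k ≠ 0 → k ≠ 2 → twoStateFreeCumulantSeq m m' k = 0 := by
    intro k hk hk2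
    rcases Nat.lt_or_ge 2 k with h3 | h3
    · exact h k h3
    · obtain rfl : k = 1 := by omega
      exact hc1
  have key : ∀ n, m (n + 2) = twoStateFreeCumulantSeq m m' 2 *
      ∑ j ∈ Finset.range (n + 1), m' j * m (n - j) := by
    intro n
    have := ncSum_range_add_two _ (freeCumulantSeq m') hc n
    simpa only [ncSum_twoStateFreeCumulantSeq h0, ncSum_freeCumulantSeq h0'] using this
  have h2 := key 0
  simp only [zero_add, Finset.sum_range_one, h0', h0, Nat.sub_zero, mul_one] at h2
  rw [key n, h2]

/-- Conversely, the recursion implies that the higher two-state free cumulants vanish. -/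
theorem twoStateFreeCumulantSeq_eq_zero (t : ℂ) (h0 : m 0 = 1) (h0' : m' 0 = 1) (h1 : m 1 = 0)
    (h : ∀ n, m (n + 2) = t * ∑ j ∈ Finset.range (n + 1), m' j * m (n - j)) (n : ℕ)
    (hn : 2 < n) : twoStateFreeCumulantSeq m m' n = 0 := by
  -- The sequence concentrated at `2` solves the moment-cumulant formula; uniqueness identifies it
  -- with the cumulants.
  have key : ∀ n, ncSum (fun k => if k = 2 then t else 0) (freeCumulantSeq m')
      (Finset.range n) = m n := by
    intro n
    induction n using Nat.strong_induction_on with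
    | _ n ih =>
      match n, ih with
      | 0, _ => rw [ncSum_range_zero, h0]
      | 1, _ => rw [ncSum_range_one _ _ (by simp), h1]
      | n + 2, ih =>
        rw [ncSum_range_add_two _ _ (fun k _ hk => if_neg hk), h n, if_pos rfl]
        congr 1
        refine Finset.sum_congr rfl fun j _ => ?_
        rw [ncSum_freeCumulantSeq h0', ih _ (by omega)]
  rw [twoStateFreeCumulantSeq_unique _ (fun n _ => key n) n (by omega)]
  exact if_neg (by omega)

theorem freeCumulantSeq_one (m : ℕ → ℂ) : freeCumulantSeq m 1 = m 1 := by
  have h2 := moment_eq_sum_freeCumulant m one_ne_zero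
  rw [h2]
  have hN : noncrossingPartitions 1 = (noncrossingPartitions 1).filter
      (fun π => Finset.univ ∈ π.parts) :=
    (Finset.filter_true_of_mem fun π _ => univ_mem_parts_of_fin_one π).symm
  obtain ⟨π₀, h₀, hs⟩ := filter_univ_mem_parts one_ne_zero
  rw [hN, hs, Finset.sum_singleton, h₀, Finset.prod_singleton, Finset.card_univ, Fintype.card_fin]

end Moments

/-! ### Creation operators on the full Fock space -/

section Creation

open scoped ENNReal ComplexConjugate

/-- The complex Hilbert space of square summable families indexed by `κ`. -/
noncomputable abbrev L2C (κ : Type*) := lp (fun _ : κ => ℂ) 2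

/-- The real Hilbert space of square summable families indexed by `ι`. -/
abbrev L2R (ι : Type*) := lp (fun _ : ι => ℝ) 2

variable {ι κ : Type*} {e : ι × κ → κ}

section Coord

variable {𝕜 : Type*} [RCLike 𝕜]

/-- The coordinates of a vector in `ℓ²`. -/
def coord (x : lp (fun _ : κ => 𝕜) 2) (w : κ) : 𝕜 := (x : κ → 𝕜) w

theorem coord_ext {x y : lp (fun _ : κ => 𝕜) 2} (h : ∀ w, coord x w = coord y w) : x = y :=
  lp.ext (funext h)

theorem coord_add (x y : lp (fun _ : κ => 𝕜) 2) (w : κ) :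
    coord (x + y) w = coord x w + coord y w := rfl

theorem coord_smul (c : 𝕜) (x : lp (fun _ : κ => 𝕜) 2) (w : κ) :
    coord (c • x) w = c * coord x w := rfl

theorem coord_zero (w : κ) : coord (0 : lp (fun _ : κ => 𝕜) 2) w = 0 := rfl

theorem summable_coord_sq (x : lp (fun _ : κ => 𝕜) 2) : Summable fun i => ‖coord x i‖ ^ 2 := by
  have := (lp.memℓp x).summable (by norm_num)
  simpa [coord] using this

theorem hasSum_coord (x y : lp (fun _ : κ => 𝕜) 2) :
    HasSum (fun i => conj (coord x i) * coord y i) (inner 𝕜 x y) := by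
  have h := lp.hasSum_inner (𝕜 := 𝕜) x y
  simp only [RCLike.inner_apply'] at h
  exact h

/-- The standard basis vectors of `ℓ²`. -/
noncomputable def basisVec (w : κ) : lp (fun _ : κ => 𝕜) 2 := by
  classical exact lp.single 2 w (1 : 𝕜)

theorem coord_basisVec_self (w : κ) : coord (basisVec w : lp (fun _ : κ => 𝕜) 2) w = 1 := by
  classical
  simp [basisVec, coord]

theorem coord_basisVec_ne {v w : κ} (h : v ≠ w) :
    coord (basisVec w : lp (fun _ : κ => 𝕜) 2) v = 0 := by
  classical
  simp [basisVec, coord, h]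

theorem inner_basisVec (w : κ) (x : lp (fun _ : κ => 𝕜) 2) :
    inner 𝕜 (basisVec w) x = coord x w := by
  classical
  rw [basisVec, lp.inner_single_left]
  simp [coord]

theorem hasSum_coord_real (x y : L2R κ) :
    HasSum (fun i => ((coord x i * coord y i : ℝ) : ℂ)) ((inner ℝ x y : ℝ) : ℂ) := by
  have h := hasSum_coord x y
  simp only [conj_trivial] at h
  exact Complex.hasSum_ofReal.2 h

end Coord

theorem hasSum_mul_prod {f : ι → ℂ} {g : κ → ℂ} {a b : ℂ} (hf : HasSum f a) (hg : HasSum g b) :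
    HasSum (fun p : ι × κ => f p.1 * g p.2) (a * b) :=
  hf.mul hg (summable_mul_of_summable_norm hf.summable.norm hg.summable.norm)

/-- The coordinates of the vector `creation he g x`. -/
noncomputable def creationFun (e : ι × κ → κ) (g : L2R ι) (x : L2C κ) : κ → ℂ :=
  Function.extend e (fun p => ((coord g p.1 : ℝ) : ℂ) * coord x p.2) 0

theorem creationFun_apply (he : Function.Injective e) (g : L2R ι) (x : L2C κ) (p : ι × κ) :
    creationFun e g x (e p) = coord g p.1 * coord x p.2 :=
  he.extend_apply _ _ _

theorem creationFun_apply_of_notMem (g : L2R ι) (x : L2C κ) {v : κ} (hv : ¬ ∃ p, e p = v) :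
    creationFun e g x v = 0 :=
  Function.extend_apply' _ _ _ hv

theorem creationFun_memℓp (he : Function.Injective e) (g : L2R ι) (x : L2C κ) :
    Memℓp (creationFun e g x) 2 := by
  refine memℓp_gen ?_
  have h : (fun v => ‖creationFun e g x v‖ ^ (2 : ℝ≥0∞).toReal) =
      Function.extend e (fun p => ‖coord g p.1‖ ^ 2 * ‖coord x p.2‖ ^ 2) 0 := by
    funext v
    by_cases hv : ∃ p, e p = v
    · obtain ⟨p, rfl⟩ := hv
      rw [he.extend_apply, creationFun_apply he]
      simp [mul_pow]
    · rw [Function.extend_apply' _ _ _ hv, creationFun_apply_of_notMem _ _ hv]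
      simp
  rw [h, summable_extend_zero he]
  exact (summable_coord_sq g).mul_of_nonneg (summable_coord_sq x) (fun _ => by positivity)
    (fun _ => by positivity)

/-- The underlying linear map of `creation`. -/
noncomputable def creationLinear (he : Function.Injective e) (g : L2R ι) : L2C κ →ₗ[ℂ] L2C κ where
  toFun x := ⟨creationFun e g x, creationFun_memℓp he g x⟩
  map_add' x y := by
    refine lp.ext (funext fun v => ?_)
    change creationFun e g (x + y) v = creationFun e g x v + creationFun e g y v
    by_cases hv : ∃ p, e p = v
    · obtain ⟨p, rfl⟩ := hv
      simp only [creationFun_apply he, coord_add, mul_add]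
    · simp only [creationFun_apply_of_notMem _ _ hv, add_zero]
  map_smul' c x := by
    refine lp.ext (funext fun v => ?_)
    change creationFun e g (c • x) v = c * creationFun e g x v
    by_cases hv : ∃ p, e p = v
    · obtain ⟨p, rfl⟩ := hv
      simp only [creationFun_apply he, coord_smul, mul_left_comm]
    · simp only [creationFun_apply_of_notMem _ _ hv, mul_zero]

theorem coord_creationLinear (he : Function.Injective e) (g : L2R ι) (x : L2C κ) (v : κ) :
    coord (creationLinear he g x) v = creationFun e g x v := rfl

/-- By injectivity of `e`, the nonzero coordinates are indexed by `ι × κ`, and the sum over them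
factors. Prepending and appending a letter are the two instances used. -/
theorem inner_creationLinear (he : Function.Injective e) (g h : L2R ι) (x y : L2C κ) :
    inner ℂ (creationLinear he g x) (creationLinear he h y) =
      ((inner ℝ g h : ℝ) : ℂ) * inner ℂ x y := by
  have h1 : HasSum (fun i => ((coord g i * coord h i : ℝ) : ℂ)) ((inner ℝ g h : ℝ) : ℂ) :=
    hasSum_coord_real g h
  have h2 := hasSum_coord x y
  have h3 := hasSum_mul_prod h1 h2
  refine (hasSum_coord (creationLinear he g x) (creationLinear he h y)).unique ?_
  rw [← hasSum_extend_zero he] at h3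
  refine h3.congr_fun fun v => ?_
  rw [coord_creationLinear, coord_creationLinear]
  by_cases hv : ∃ p, e p = v
  · obtain ⟨p, rfl⟩ := hv
    rw [he.extend_apply, creationFun_apply he, creationFun_apply he, map_mul, Complex.conj_ofReal]
    push_cast
    ring
  · rw [Function.extend_apply' _ _ _ hv, creationFun_apply_of_notMem g x hv, map_zero, zero_mul,
      Pi.zero_apply]

/-- The creation operator `δ_w ↦ ∑ᵢ gᵢ δ_{e (i, w)}`. -/
noncomputable def creation (he : Function.Injective e) (g : L2R ι) : L2C κ →L[ℂ] L2C κ :=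
  (creationLinear he g).mkContinuous ‖g‖ fun x => by
    have h := inner_creationLinear he g g x x
    rw [inner_self_eq_norm_sq_to_K, inner_self_eq_norm_sq_to_K (𝕜 := ℂ) x,
      real_inner_self_eq_norm_sq] at h
    have h' : ‖creationLinear he g x‖ ^ 2 = (‖g‖ * ‖x‖) ^ 2 := by
      rw [mul_pow]
      exact Complex.ofReal_injective (by push_cast at h ⊢; exact h)
    exact (abs_le_of_sq_le_sq' h'.le (by positivity)).2

theorem coord_creation (he : Function.Injective e) (g : L2R ι) (x : L2C κ) (p : ι × κ) :
    coord (creation he g x) (e p) = coord g p.1 * coord x p.2 :=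
  creationFun_apply he g x p

theorem coord_creation_of_notMem (he : Function.Injective e) (g : L2R ι) (x : L2C κ) {v : κ}
    (hv : ¬ ∃ p, e p = v) : coord (creation he g x) v = 0 :=
  creationFun_apply_of_notMem g x hv

theorem inner_creation (he : Function.Injective e) (g h : L2R ι) (x y : L2C κ) :
    inner ℂ (creation he g x) (creation he h y) = ((inner ℝ g h : ℝ) : ℂ) * inner ℂ x y :=
  inner_creationLinear he g h x y

theorem creation_add (he : Function.Injective e) (g h : L2R ι) :
    creation he (g + h) = creation he g + creation he h := by
  refine ContinuousLinearMap.ext fun x => coord_ext fun v => ?_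
  rw [add_apply, coord_add]
  by_cases hv : ∃ p, e p = v
  · obtain ⟨p, rfl⟩ := hv
    simp only [coord_creation, coord_add, Complex.ofReal_add, add_mul]
  · simp only [coord_creation_of_notMem he _ _ hv, add_zero]

theorem creation_sub (he : Function.Injective e) (g h : L2R ι) :
    creation he (g - h) = creation he g - creation he h := by
  rw [eq_sub_iff_add_eq, ← creation_add, sub_add_cancel]

open ContinuousLinearMap in
theorem adjoint_creation_creation (he : Function.Injective e) (g h : L2R ι) (x : L2C κ) :
    adjoint (creation he g) (creation he h x) = ((inner ℝ g h : ℝ) : ℂ) • x := by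
  refine ext_inner_left ℂ fun y => ?_
  rw [adjoint_inner_right, inner_creation, inner_smul_right]

open ContinuousLinearMap in
theorem hasSum_adjoint_creation (he : Function.Injective e) (g : L2R ι) (y : L2C κ) (w : κ) :
    HasSum (fun i => ((coord g i : ℝ) : ℂ) * coord y (e (i, w)))
      (coord (adjoint (creation he g) y) w) := by
  rw [← inner_basisVec w, adjoint_inner_right]
  have h := hasSum_coord (creation he g (basisVec w)) y
  have hw : Function.Injective fun i => e (i, w) := fun i j hij => by simpa using he hij
  rw [← hw.hasSum_iff] at h
  · refine h.congr_fun fun i => ?_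
    rw [Function.comp_apply, coord_creation, coord_basisVec_self, mul_one, Complex.conj_ofReal]
  · intro v hv
    by_cases hv' : ∃ p, e p = v
    · obtain ⟨⟨i, u⟩, rfl⟩ := hv'
      have hu : u ≠ w := fun h => hv ⟨i, by rw [h]⟩
      rw [coord_creation, coord_basisVec_ne hu, mul_zero, map_zero, zero_mul]
    · rw [coord_creation_of_notMem he _ _ hv', map_zero, zero_mul]

end Creation

/-! ### The full Fock space -/

section Fock

open ContinuousLinearMap

variable {ι : Type*}

/-- The full Fock space over `ℓ²(ι)`, with the orthonormal basis of words in the alphabet `ι`. -/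
noncomputable abbrev Fock (ι : Type*) := L2C (List ι)

theorem cons_uncurry_injective : Function.Injective fun p : ι × List ι => p.1 :: p.2 := by
  rintro ⟨i, v⟩ ⟨j, w⟩ h
  simpa using h

theorem concat_uncurry_injective : Function.Injective fun p : ι × List ι => p.2 ++ [p.1] := by
  rintro ⟨i, v⟩ ⟨j, w⟩ h
  have := List.append_inj' h rfl
  simpa [and_comm] using this

/-- The left creation operators. -/
noncomputable def leftC (g : L2R ι) : Fock ι →L[ℂ] Fock ι := creation cons_uncurry_injective g

/-- The right creation operators. -/
noncomputable def rightC (g : L2R ι) : Fock ι →L[ℂ] Fock ι := creation concat_uncurry_injective g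

/-- The vacuum vector. -/
noncomputable def vac : Fock ι := basisVec []

theorem inner_vac (x : Fock ι) : inner ℂ (vac : Fock ι) x = coord x [] :=
  inner_basisVec _ _

theorem vac_nil : coord (vac : Fock ι) [] = 1 :=
  coord_basisVec_self _

theorem vac_of_ne {w : List ι} (h : w ≠ []) : coord (vac : Fock ι) w = 0 :=
  coord_basisVec_ne h

theorem inner_vac_vac : inner ℂ (vac : Fock ι) vac = 1 := by
  rw [inner_vac, vac_nil]

theorem leftC_nil (g : L2R ι) (x : Fock ι) : coord (leftC g x) [] = 0 :=
  coord_creation_of_notMem _ _ _ (by simp)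

theorem leftC_cons (g : L2R ι) (x : Fock ι) (i : ι) (w : List ι) :
    coord (leftC g x) (i :: w) = coord g i * coord x w :=
  coord_creation cons_uncurry_injective g x (i, w)

theorem rightC_nil (g : L2R ι) (x : Fock ι) : coord (rightC g x) [] = 0 :=
  coord_creation_of_notMem _ _ _ (by simp)

theorem rightC_concat (g : L2R ι) (x : Fock ι) (i : ι) (w : List ι) :
    coord (rightC g x) (w ++ [i]) = coord g i * coord x w :=
  coord_creation concat_uncurry_injective g x (i, w)

theorem rightC_singleton (g : L2R ι) (x : Fock ι) (i : ι) :
    coord (rightC g x) [i] = coord g i * coord x [] :=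
  rightC_concat g x i []

theorem rightC_cons_concat (g : L2R ι) (x : Fock ι) (i j : ι) (w : List ι) :
    coord (rightC g x) (i :: (w ++ [j])) = coord g j * coord x (i :: w) :=
  rightC_concat g x j (i :: w)

theorem hasSum_adjoint_leftC (g : L2R ι) (x : Fock ι) (w : List ι) :
    HasSum (fun i => ((coord g i : ℝ) : ℂ) * coord x (i :: w)) (coord (adjoint (leftC g) x) w) :=
  hasSum_adjoint_creation cons_uncurry_injective g x w

theorem adjoint_leftC_leftC (g h : L2R ι) (x : Fock ι) :
    adjoint (leftC g) (leftC h x) = ((inner ℝ g h : ℝ) : ℂ) • x :=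
  adjoint_creation_creation _ g h x

theorem adjoint_rightC_rightC (g h : L2R ι) (x : Fock ι) :
    adjoint (rightC g) (rightC h x) = ((inner ℝ g h : ℝ) : ℂ) • x :=
  adjoint_creation_creation _ g h x

theorem inner_vac_leftC (g : L2R ι) (x : Fock ι) : inner ℂ (vac : Fock ι) (leftC g x) = 0 := by
  rw [inner_vac, leftC_nil]

theorem inner_vac_rightC (g : L2R ι) (x : Fock ι) : inner ℂ (vac : Fock ι) (rightC g x) = 0 := by
  rw [inner_vac, rightC_nil]

theorem adjoint_leftC_vac (g : L2R ι) : adjoint (leftC g) (vac : Fock ι) = 0 := by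
  refine ext_inner_right ℂ fun y => ?_
  rw [adjoint_inner_left, inner_vac_leftC, inner_zero_left]

theorem adjoint_rightC_vac (g : L2R ι) : adjoint (rightC g) (vac : Fock ι) = 0 := by
  refine ext_inner_right ℂ fun y => ?_
  rw [adjoint_inner_left, inner_vac_rightC, inner_zero_left]

theorem leftC_rightC (g h : L2R ι) (x : Fock ι) :
    leftC g (rightC h x) = rightC h (leftC g x) := by
  refine coord_ext fun w => ?_
  match w with
  | [] => rw [leftC_nil, rightC_nil]
  | i :: w =>
    rw [leftC_cons]
    rcases List.eq_nil_or_concat' w with rfl | ⟨v, j, rfl⟩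
    · rw [rightC_nil, mul_zero, rightC_singleton, leftC_nil, mul_zero]
    · rw [rightC_concat, rightC_cons_concat, leftC_cons]
      ring

theorem leftC_vac (g : L2R ι) : leftC g vac = rightC g vac := by
  refine coord_ext fun w => ?_
  match w with
  | [] => rw [leftC_nil, rightC_nil]
  | i :: w =>
    rw [leftC_cons]
    rcases List.eq_nil_or_concat' w with rfl | ⟨v, j, rfl⟩
    · rw [rightC_singleton]
    · rw [rightC_cons_concat, vac_of_ne (by simp), vac_of_ne (by simp), mul_zero, mul_zero]

/-- Removing the first letter and appending a last one commute except on the empty word, where the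
appended letter is itself the first. All later vacuum corrections come from this defect. -/
theorem adjoint_leftC_rightC (g h : L2R ι) (x : Fock ι) :
    adjoint (leftC g) (rightC h x) = rightC h (adjoint (leftC g) x) +
      (((inner ℝ g h : ℝ) : ℂ) * inner ℂ vac x) • vac := by
  refine coord_ext fun w => ?_
  refine (hasSum_adjoint_leftC g (rightC h x) w).unique ?_
  rw [coord_add, coord_smul]
  rcases List.eq_nil_or_concat' w with rfl | ⟨v, j, rfl⟩
  · have h1 : HasSum (fun i => ((coord g i * coord h i : ℝ) : ℂ)) ((inner ℝ g h : ℝ) : ℂ) :=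
      hasSum_coord_real g h
    rw [rightC_nil, vac_nil, inner_vac, mul_one, zero_add]
    refine (h1.mul_right (coord x [])).congr_fun fun i => ?_
    rw [rightC_singleton]
    push_cast
    ring
  · rw [rightC_concat, vac_of_ne (by simp), mul_zero, add_zero]
    refine ((hasSum_adjoint_leftC g x v).mul_left ((coord h j : ℝ) : ℂ)).congr_fun fun i => ?_
    rw [rightC_cons_concat]
    ring

theorem adjoint_rightC_leftC (g h : L2R ι) (x : Fock ι) :
    adjoint (rightC h) (leftC g x) = leftC g (adjoint (rightC h) x) +
      (((inner ℝ g h : ℝ) : ℂ) * inner ℂ vac x) • vac := by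
  refine ext_inner_left ℂ fun y => ?_
  have h1 : inner ℂ (adjoint (leftC g) (rightC h y)) x = inner ℂ y
      (adjoint (rightC h) (leftC g x)) := by
    rw [adjoint_inner_left, adjoint_inner_right]
  have h2 : inner ℂ (rightC h (adjoint (leftC g) y)) x = inner ℂ y
      (leftC g (adjoint (rightC h) x)) := by
    rw [← adjoint_inner_right, adjoint_inner_left]
  rw [← h1, adjoint_leftC_rightC, inner_add_left, inner_add_right, h2, inner_smul_left,
    inner_smul_right, map_mul, inner_conj_symm, Complex.conj_ofReal]
  ring

theorem adjoint_leftC_adjoint_rightC (g h : L2R ι) (x : Fock ι) :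
    adjoint (leftC g) (adjoint (rightC h) x) = adjoint (rightC h) (adjoint (leftC g) x) := by
  refine ext_inner_left ℂ fun y => ?_
  simp only [adjoint_inner_right, leftC_rightC]

end Fock

/-! ### Field operators on the Fock space: action, freeness and moments -/

section FieldOperators

open ContinuousLinearMap Polynomial

variable {ι : Type*}

theorem op_mul_apply {E : Type*} [NormedAddCommGroup E] [NormedSpace ℂ E] (S T : E →L[ℂ] E)
    (x : E) : (S * T) x = S (T x) := rfl

/-- The orthogonal projection onto the vacuum vector. -/
noncomputable def vacProj : Fock ι →L[ℂ] Fock ι := (innerSL ℂ (vac : Fock ι)).smulRight vac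

theorem vacProj_apply (x : Fock ι) : vacProj x = inner ℂ vac x • (vac : Fock ι) := rfl

theorem isSelfAdjoint_vacProj : IsSelfAdjoint (vacProj : Fock ι →L[ℂ] Fock ι) := by
  rw [ContinuousLinearMap.isSelfAdjoint_iff_isSymmetric]
  intro x y
  simp only [coe_coe, vacProj_apply, inner_smul_left, inner_smul_right, inner_conj_symm]
  ring

/-- The operators `ℓ(g) + ℓ(g)* + c (1 - P)`, where `P` projects onto the vacuum. -/
noncomputable def fieldOp (g : L2R ι) (c : ℝ) : Fock ι →L[ℂ] Fock ι :=
  leftC g + adjoint (leftC g) + (c : ℂ) • (1 - vacProj)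

/-- The operators `ℓ(g) + ℓ(g)* + c`. -/
noncomputable def shiftedFieldOp (g : L2R ι) (c : ℝ) : Fock ι →L[ℂ] Fock ι :=
  leftC g + adjoint (leftC g) + (c : ℂ) • 1

variable (g : L2R ι) (c : ℝ)

theorem fieldOp_apply (x : Fock ι) : fieldOp g c x =
    leftC g x + adjoint (leftC g) x + (c : ℂ) • (x - inner ℂ vac x • vac) := rfl

theorem shiftedFieldOp_apply (x : Fock ι) : shiftedFieldOp g c x =
    leftC g x + adjoint (leftC g) x + (c : ℂ) • x := rfl

theorem leftC_sub (g h : L2R ι) : leftC (g - h) = leftC g - leftC h := creation_sub _ g h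

theorem fieldOp_sub (g h : L2R ι) (c d : ℝ) :
    fieldOp (g - h) (c - d) = fieldOp g c - fieldOp h d := by
  refine ContinuousLinearMap.ext fun x => ?_
  rw [sub_apply, fieldOp_apply, fieldOp_apply, fieldOp_apply, leftC_sub, map_sub, sub_apply,
    sub_apply, Complex.ofReal_sub, sub_smul]
  abel

theorem isSelfAdjoint_fieldOp : IsSelfAdjoint (fieldOp g c) := by
  refine IsSelfAdjoint.add ?_ ?_
  · exact IsSelfAdjoint.add_star_self _
  · refine IsSelfAdjoint.smul ?_ ((IsSelfAdjoint.one _).sub isSelfAdjoint_vacProj)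
    exact Complex.conj_ofReal c

theorem fieldOp_vac : fieldOp g c vac = leftC g vac := by
  rw [fieldOp_apply, adjoint_leftC_vac, inner_vac_vac, one_smul, sub_self, smul_zero, add_zero,
    add_zero]

theorem fieldOp_leftC (x : Fock ι) : fieldOp g c (leftC g x) =
    leftC g (leftC g x) + ((‖g‖ ^ 2 : ℝ) : ℂ) • x + (c : ℂ) • leftC g x := by
  rw [fieldOp_apply, adjoint_leftC_leftC, real_inner_self_eq_norm_sq, inner_vac_leftC, zero_smul,
    sub_zero]

theorem fieldOp_of_reduced {v : Fock ι} (h1 : adjoint (leftC g) v = 0) (h2 : inner ℂ vac v = 0) :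
    fieldOp g c v = leftC g v + (c : ℂ) • v := by
  rw [fieldOp_apply, h1, h2, zero_smul, sub_zero, add_zero]

/-- For `T = ℓ(g)` and `ℓ(g)* v = 0`, this makes `divX` the polynomial counterpart of `ℓ(g)*`. -/
theorem aeval_eq_add_divX (T : Fock ι →L[ℂ] Fock ι) (p : ℂ[X]) (v : Fock ι) :
    aeval T p v = p.coeff 0 • v + T (aeval T p.divX v) := by
  conv_lhs => rw [← p.divX_mul_X_add, mul_comm p.divX X]
  rw [map_add, map_mul, aeval_X, aeval_C, add_comm]
  rfl

/-- On vectors that do not start with a multiple of `g`, the elements of the algebra generated by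
`fieldOp g c` act as polynomials in `ℓ(g)`. -/
theorem exists_polynomial_of_mem_adjoin {a : Fock ι →L[ℂ] Fock ι}
    (ha : a ∈ Algebra.adjoin ℂ {fieldOp g c}) :
    ∃ p : ℂ[X], ∀ v, adjoint (leftC g) v = 0 → inner ℂ vac v = 0 → a v = aeval (leftC g) p v := by
  rw [Algebra.adjoin_singleton_eq_range_aeval] at ha
  obtain ⟨q, rfl⟩ := ha
  change ∃ p : ℂ[X], ∀ v, _ → _ → aeval (fieldOp g c) q v = _
  induction q using Polynomial.induction_on with
  | C z => exact ⟨C z, fun v _ _ => by rw [aeval_C, aeval_C]⟩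
  | add q₁ q₂ h₁ h₂ =>
    obtain ⟨p₁, h₁⟩ := h₁
    obtain ⟨p₂, h₂⟩ := h₂
    refine ⟨p₁ + p₂, fun v hv hv' => ?_⟩
    rw [map_add, map_add, add_apply, add_apply, h₁ v hv hv', h₂ v hv hv']
  | monomial n z h =>
    obtain ⟨p, h⟩ := h
    -- Creation multiplies by `X`, annihilation is `divX` times `‖g‖ ^ 2`, and `c` acts on every
    -- term because no vacuum component arises.
    refine ⟨X * p + C ((‖g‖ ^ 2 : ℝ) : ℂ) * p.divX + C (c : ℂ) * p, fun v hv hv' => ?_⟩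
    have e1 : C z * X ^ (n + 1) = X * (C z * X ^ n) := by ring
    rw [e1, map_mul, aeval_X, op_mul_apply, h v hv hv', aeval_eq_add_divX, map_add, map_smul,
      fieldOp_leftC, fieldOp_of_reduced g c hv hv', map_add, map_add, map_mul, map_mul, map_mul,
      aeval_X, aeval_C, aeval_C, add_apply, add_apply, op_mul_apply, op_mul_apply, op_mul_apply,
      aeval_eq_add_divX _ p v, Algebra.algebraMap_eq_smul_one, Algebra.algebraMap_eq_smul_one]
    simp only [map_add, map_smul, smul_apply, one_apply_eq_self, smul_add]
    rw [smul_comm (p.coeff 0)]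
    abel

theorem exists_polynomial_vac_of_mem_adjoin {a : Fock ι →L[ℂ] Fock ι}
    (ha : a ∈ Algebra.adjoin ℂ {fieldOp g c}) :
    ∃ p : ℂ[X], a vac = aeval (leftC g) p vac := by
  rw [Algebra.adjoin_singleton_eq_range_aeval] at ha
  obtain ⟨q, rfl⟩ := ha
  change ∃ p : ℂ[X], aeval (fieldOp g c) q vac = _
  induction q using Polynomial.induction_on with
  | C z => exact ⟨C z, by rw [aeval_C, aeval_C]⟩
  | add q₁ q₂ h₁ h₂ =>
    obtain ⟨p₁, h₁⟩ := h₁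
    obtain ⟨p₂, h₂⟩ := h₂
    refine ⟨p₁ + p₂, ?_⟩
    rw [map_add, map_add, add_apply, add_apply, h₁, h₂]
  | monomial n z h =>
    obtain ⟨p, h⟩ := h
    -- Starting from the vacuum, `c (1 - P)` kills the constant term, so `c` multiplies `p - p.coeff
    -- 0 = X * p.divX` only.
    refine ⟨X * p + C ((‖g‖ ^ 2 : ℝ) : ℂ) * p.divX + C (c : ℂ) * (X * p.divX), ?_⟩
    have e1 : C z * X ^ (n + 1) = X * (C z * X ^ n) := by ring
    rw [e1, map_mul, aeval_X, op_mul_apply, h, aeval_eq_add_divX, map_add, map_smul,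
      fieldOp_leftC, fieldOp_vac, map_add, map_add, map_mul, map_mul, map_mul, map_mul,
      aeval_X, aeval_C, aeval_C, add_apply, add_apply, op_mul_apply, op_mul_apply, op_mul_apply, op_mul_apply,
      aeval_eq_add_divX _ p vac, Algebra.algebraMap_eq_smul_one, Algebra.algebraMap_eq_smul_one]
    simp only [map_add, map_smul, smul_apply, one_apply_eq_self]
    abel

theorem inner_leftC_of_adjoint_eq_zero {f : Fock ι} (hf : adjoint (leftC g) f = 0) (x : Fock ι) :
    inner ℂ f (leftC g x) = 0 := by
  rw [← adjoint_inner_left, hf, inner_zero_left]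

/-- The action on vectors that do not start with a multiple of `g`, up to the range of `ℓ(g)`. -/
theorem exists_apply_eq_of_mem_adjoin {a : Fock ι →L[ℂ] Fock ι}
    (ha : a ∈ Algebra.adjoin ℂ {fieldOp g c}) {f : Fock ι} (hf : adjoint (leftC g) f = 0)
    (hf' : inner ℂ vac f = 0) (hf1 : inner ℂ f f = 1) {v : Fock ι} (h1 : adjoint (leftC g) v = 0)
    (h2 : inner ℂ vac v = 0) : ∃ x, a v = inner ℂ f (a f) • v + leftC g x := by
  obtain ⟨p, hp⟩ := exists_polynomial_of_mem_adjoin g c ha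
  refine ⟨aeval (leftC g) p.divX v, ?_⟩
  -- The polynomial `p` is the same for all reduced vectors, so its constant coefficient can be read
  -- off at `f`: it is the `ψ`-value of `a`.
  rw [hp v h1 h2, hp f hf hf', aeval_eq_add_divX, aeval_eq_add_divX _ p f, inner_add_right,
    inner_leftC_of_adjoint_eq_zero g hf, inner_smul_right, hf1, mul_one, add_zero]

theorem exists_apply_vac_eq_of_mem_adjoin {a : Fock ι →L[ℂ] Fock ι}
    (ha : a ∈ Algebra.adjoin ℂ {fieldOp g c}) :
    ∃ x, a vac = inner ℂ vac (a vac) • vac + leftC g x := by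
  obtain ⟨p, hp⟩ := exists_polynomial_vac_of_mem_adjoin g c ha
  refine ⟨aeval (leftC g) p.divX vac, ?_⟩
  rw [hp, aeval_eq_add_divX, inner_add_right, inner_vac_leftC, inner_smul_right, inner_vac_vac,
    mul_one, add_zero]

/-- Two-state freeness of field operators with orthogonal test functions, at the level of
vectors. -/
theorem exists_word_apply_eq {J : Type*} {γ : J → L2R ι} {κ : J → ℝ}
    (horth : ∀ i j, i ≠ j → inner ℝ (γ i) (γ j) = 0) {f : Fock ι}
    (hf : ∀ j, adjoint (leftC (γ j)) f = 0) (hf' : inner ℂ vac f = 0) (hf1 : inner ℂ f f = 1)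
    (i : J) (a : Fock ι →L[ℂ] Fock ι) (w : List (J × (Fock ι →L[ℂ] Fock ι)))
    (hw : ((i, a) :: w).IsChain (fun p q => p.1 ≠ q.1))
    (hmem : ∀ p ∈ (i, a) :: w, p.2 ∈ Algebra.adjoin ℂ {fieldOp (γ p.1) (κ p.1)} ∧
      inner ℂ f (p.2 f) = 0) :
    (∃ x, ((((i, a) :: w).map Prod.snd).prod) f = leftC (γ i) x) ∧
      ∃ x, ((((i, a) :: w).map Prod.snd).prod) vac =
        (((i, a) :: w).map fun p => inner ℂ (vac : Fock ι) (p.2 vac)).prod • vac +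
          leftC (γ i) x := by
  -- The tail of the word maps `f`, and the vacuum up to a multiple of itself, into the range of
  -- `ℓ(γ j)`. By orthogonality this range is reduced with respect to `γ i`, where a centered first
  -- letter has no constant term and therefore lands in the range of `ℓ(γ i)`.
  induction w generalizing i a with
  | nil =>
    obtain ⟨ha, ha'⟩ := hmem (i, a) (by simp)
    constructor
    · obtain ⟨x, hx⟩ := exists_apply_eq_of_mem_adjoin _ _ ha (hf i) hf' hf1 (hf i) hf'
      refine ⟨x, ?_⟩
      rw [ha', zero_smul, zero_add] at hx
      simpa using hx
    · obtain ⟨x, hx⟩ := exists_apply_vac_eq_of_mem_adjoin _ _ ha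
      exact ⟨x, by simpa using hx⟩
  | cons q w ih =>
    obtain ⟨j, b⟩ := q
    obtain ⟨ha, ha'⟩ := hmem (i, a) (by simp)
    rw [List.isChain_cons_cons] at hw
    obtain ⟨⟨x, hx⟩, y, hy⟩ := ih j b hw.2 fun p hp => hmem p (List.mem_cons_of_mem _ hp)
    have hred : ∀ z, adjoint (leftC (γ i)) (leftC (γ j) z) = 0 := fun z => by
      rw [adjoint_leftC_leftC, horth i j hw.1, Complex.ofReal_zero, zero_smul]
    constructor
    · obtain ⟨x', hx'⟩ := exists_apply_eq_of_mem_adjoin _ _ ha (hf i) hf' hf1 (hred x)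
        (inner_vac_leftC _ _)
      refine ⟨x', ?_⟩
      rw [List.map_cons, List.prod_cons, op_mul_apply, hx, hx', ha', zero_smul, zero_add]
    · obtain ⟨y', hy'⟩ := exists_apply_eq_of_mem_adjoin _ _ ha (hf i) hf' hf1 (hred y)
        (inner_vac_leftC _ _)
      obtain ⟨z, hz⟩ := exists_apply_vac_eq_of_mem_adjoin _ _ ha
      rw [ha', zero_smul, zero_add] at hy'
      generalize hπ : (((j, b) :: w).map fun p => inner ℂ (vac : Fock ι) (p.2 vac)).prod = π at hy
      have hs : (((i, a) :: (j, b) :: w).map fun p => inner ℂ (vac : Fock ι) (p.2 vac)).prod =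
          inner ℂ (vac : Fock ι) (a vac) * π := by
        rw [← hπ]
        rfl
      dsimp only at hz hy' ⊢
      generalize inner ℂ (vac : Fock ι) (a vac) = s at hz hs
      refine ⟨π • z + y', ?_⟩
      rw [hs, List.map_cons, List.prod_cons, op_mul_apply, hy, map_add, map_smul, hy', hz, map_add,
        map_smul, smul_add, smul_smul, mul_comm π, add_assoc]

/-! ### Moments of the field operators -/

/-- Behind an appended letter the vacuum is out of reach, so `c (1 - P)` acts as `c`. The correction
appears when annihilation reaches that letter. -/
theorem fieldOp_rightC (h : L2R ι) (x : Fock ι) : fieldOp g c (rightC h x) =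
    rightC h (shiftedFieldOp g c x) + (((inner ℝ g h : ℝ) : ℂ) * inner ℂ vac x) • vac := by
  rw [fieldOp_apply, shiftedFieldOp_apply, leftC_rightC, adjoint_leftC_rightC, inner_vac_rightC,
    zero_smul, sub_zero, map_add, map_add, map_smul]
  abel

theorem shiftedFieldOp_rightC (h : L2R ι) (x : Fock ι) : shiftedFieldOp g c (rightC h x) =
    rightC h (shiftedFieldOp g c x) + (((inner ℝ g h : ℝ) : ℂ) * inner ℂ vac x) • vac := by
  rw [shiftedFieldOp_apply, shiftedFieldOp_apply, leftC_rightC, adjoint_leftC_rightC, map_add,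
    map_add, map_smul]
  abel

theorem fieldOp_pow_rightC_of_orthogonal {h : L2R ι} (hgh : inner ℝ g h = 0) (x : Fock ι) (n : ℕ) :
    (fieldOp g c ^ n) (rightC h x) = rightC h ((shiftedFieldOp g c ^ n) x) := by
  induction n with
  | zero => rfl
  | succ n ih =>
    rw [pow_succ', pow_succ', op_mul_apply, op_mul_apply, ih, fieldOp_rightC, hgh, Complex.ofReal_zero,
      zero_mul, zero_smul, add_zero]

/-- The index `j` counts the steps before the appended letter is annihilated; until then
`shiftedFieldOp` acts, and afterwards `Z` restarts from the vacuum. Both kinds of field operators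
satisfy the hypothesis on `Z`. -/
theorem pow_rightC_vac (Z : Fock ι →L[ℂ] Fock ι)
    (hZ : ∀ x, Z (rightC g x) =
      rightC g (shiftedFieldOp g c x) + (((‖g‖ ^ 2 : ℝ) : ℂ) * inner ℂ vac x) • vac) (n : ℕ) :
    (Z ^ n) (rightC g vac) = rightC g ((shiftedFieldOp g c ^ n) vac) +
      ((‖g‖ ^ 2 : ℝ) : ℂ) • ∑ j ∈ Finset.range n,
        inner ℂ vac ((shiftedFieldOp g c ^ j) vac) • (Z ^ (n - 1 - j)) vac := by
  induction n with
  | zero => simp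
  | succ n ih =>
    rw [pow_succ', op_mul_apply, ih, map_add, hZ, map_smul, map_sum, Finset.sum_range_succ,
      pow_succ' (shiftedFieldOp g c), op_mul_apply, smul_add, Nat.add_sub_cancel, Nat.sub_self,
      pow_zero, one_apply_eq_self, add_assoc, add_comm (_ • ∑ _ ∈ _, _), mul_smul]
    congr 3
    refine Finset.sum_congr rfl fun j hj => ?_
    rw [Finset.mem_range] at hj
    rw [map_smul, ← op_mul_apply, ← pow_succ', show n - 1 - j + 1 = n - j by omega]

/-- This is the two-state normal recursion, with `shiftedFieldOp` providing the moments of the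
second state. -/
theorem inner_vac_fieldOp_pow_succ (n : ℕ) :
    inner ℂ vac ((fieldOp g c ^ (n + 1)) vac) = ((‖g‖ ^ 2 : ℝ) : ℂ) * ∑ j ∈ Finset.range n,
      inner ℂ vac ((shiftedFieldOp g c ^ j) vac) *
        inner ℂ vac ((fieldOp g c ^ (n - 1 - j)) vac) := by
  rw [pow_succ, op_mul_apply, fieldOp_vac, leftC_vac, pow_rightC_vac g c (fieldOp g c) fun x => by
      rw [fieldOp_rightC, real_inner_self_eq_norm_sq],
    inner_add_right, inner_vac_rightC, zero_add, inner_smul_right, inner_sum]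
  simp only [inner_smul_right]

theorem inner_vac_shiftedFieldOp_pow_succ (n : ℕ) :
    inner ℂ vac ((shiftedFieldOp g c ^ (n + 1)) vac) =
      ((‖g‖ ^ 2 : ℝ) : ℂ) * ∑ j ∈ Finset.range n, inner ℂ vac ((shiftedFieldOp g c ^ j) vac) *
        inner ℂ vac ((shiftedFieldOp g c ^ (n - 1 - j)) vac) +
      c * inner ℂ vac ((shiftedFieldOp g c ^ n) vac) := by
  rw [pow_succ, op_mul_apply, shiftedFieldOp_apply, adjoint_leftC_vac, add_zero, leftC_vac, map_add,
    map_smul, pow_rightC_vac g c (shiftedFieldOp g c) fun x => by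
      rw [shiftedFieldOp_rightC, real_inner_self_eq_norm_sq],
    inner_add_right, inner_add_right, inner_vac_rightC, zero_add, inner_smul_right,
    inner_smul_right, inner_sum]
  simp only [inner_smul_right]

variable {g} {h : L2R ι}

/-- The recursion sees the test vector only through its norm; stationarity of the increments rests
on this. -/
theorem inner_vac_shiftedFieldOp_pow_congr (hgh : ‖g‖ = ‖h‖) (n : ℕ) :
    inner ℂ vac ((shiftedFieldOp g c ^ n) vac) = inner ℂ vac ((shiftedFieldOp h c ^ n) vac) := by
  induction n using Nat.strong_induction_on with
  | _ n ih =>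
    match n, ih with
    | 0, _ => rw [pow_zero, pow_zero]
    | n + 1, ih =>
      rw [inner_vac_shiftedFieldOp_pow_succ, inner_vac_shiftedFieldOp_pow_succ, hgh,
        ih n (by omega)]
      congr 2
      refine Finset.sum_congr rfl fun j hj => ?_
      rw [Finset.mem_range] at hj
      rw [ih j (by omega), ih (n - 1 - j) (by omega)]

theorem inner_vac_fieldOp_pow_congr (hgh : ‖g‖ = ‖h‖) (n : ℕ) :
    inner ℂ vac ((fieldOp g c ^ n) vac) = inner ℂ vac ((fieldOp h c ^ n) vac) := by
  induction n using Nat.strong_induction_on with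
  | _ n ih =>
    match n, ih with
    | 0, _ => rw [pow_zero, pow_zero]
    | n + 1, ih =>
      rw [inner_vac_fieldOp_pow_succ, inner_vac_fieldOp_pow_succ, hgh]
      congr 1
      refine Finset.sum_congr rfl fun j hj => ?_
      rw [Finset.mem_range] at hj
      rw [ih (n - 1 - j) (by omega), inner_vac_shiftedFieldOp_pow_congr c hgh]

end FieldOperators

/-! ### Operators commuting with the process, and the separating vacuum vector -/

section Commutant

open ContinuousLinearMap

variable {ι : Type*}

theorem adjoint_rightC_fieldOp {g f : L2R ι} (hgf : inner ℝ g f = 0) (c : ℝ) (x : Fock ι) :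
    adjoint (rightC f) (fieldOp g c x) = shiftedFieldOp g c (adjoint (rightC f) x) := by
  rw [fieldOp_apply, shiftedFieldOp_apply, map_add, map_add, map_smul, map_sub, map_smul,
    adjoint_rightC_vac, smul_zero, sub_zero, adjoint_rightC_leftC, hgf, Complex.ofReal_zero,
    zero_mul, zero_smul, add_zero, adjoint_leftC_adjoint_rightC]

/-- The operator `(1 + α r(e)) r(f)*`, which commutes with the field operators. -/
noncomputable def intertwiner (α : ℝ) (e f : L2R ι) : Fock ι →L[ℂ] Fock ι :=
  (1 + (α : ℂ) • rightC e) * adjoint (rightC f)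

/-- The constant `α * ⟨g, e⟩` is chosen so that the vacuum term of `c (1 - P) x` cancels the one
created by `α r(e) x`. Hence `1 + α r(e)` intertwines the two kinds of field operators. -/
theorem fieldOp_one_add_rightC (α : ℝ) (g e : L2R ι) (x : Fock ι) :
    fieldOp g (α * inner ℝ g e) (x + (α : ℂ) • rightC e x) =
      shiftedFieldOp g (α * inner ℝ g e) x +
        (α : ℂ) • rightC e (shiftedFieldOp g (α * inner ℝ g e) x) := by
  rw [map_add, map_smul, fieldOp_rightC, fieldOp_apply, shiftedFieldOp_apply, smul_add, smul_sub,
    smul_smul, smul_smul, Complex.ofReal_mul, mul_assoc]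
  abel

theorem commute_intertwiner {g f : L2R ι} (hgf : inner ℝ g f = 0) (α : ℝ) (e : L2R ι) :
    Commute (fieldOp g (α * inner ℝ g e)) (intertwiner α e f) := by
  refine ContinuousLinearMap.ext fun x => ?_
  change fieldOp g (α * inner ℝ g e) (adjoint (rightC f) x +
    (α : ℂ) • rightC e (adjoint (rightC f) x)) =
    adjoint (rightC f) (fieldOp g (α * inner ℝ g e) x) +
      (α : ℂ) • rightC e (adjoint (rightC f) (fieldOp g (α * inner ℝ g e) x))
  rw [fieldOp_one_add_rightC, adjoint_rightC_fieldOp hgf]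

/-- The operator `r(f) (r(h) + r(h)*) r(f)*`, which commutes with the field operators. -/
noncomputable def rightField (f h : L2R ι) : Fock ι →L[ℂ] Fock ι :=
  rightC f * ((rightC h + adjoint (rightC h)) * adjoint (rightC f))

/-- Left and right semicircular operators commute: the same vacuum term arises from `ℓ(g)* r(h)` on
one side and from `r(h)* ℓ(g)` on the other. -/
theorem shiftedFieldOp_right_comm (g h : L2R ι) (c : ℝ) (x : Fock ι) :
    shiftedFieldOp g c (rightC h x + adjoint (rightC h) x) =
      rightC h (shiftedFieldOp g c x) + adjoint (rightC h) (shiftedFieldOp g c x) := by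
  rw [map_add, shiftedFieldOp_rightC, shiftedFieldOp_apply _ _ (adjoint _ _),
    shiftedFieldOp_apply _ _ x, map_add (adjoint (rightC h)), map_add (adjoint (rightC h)),
    adjoint_rightC_leftC, adjoint_leftC_adjoint_rightC, map_smul (adjoint (rightC h))]
  abel

theorem commute_rightField {g f : L2R ι} (hgf : inner ℝ g f = 0) (c : ℝ) (h : L2R ι) :
    Commute (fieldOp g c) (rightField f h) := by
  refine ContinuousLinearMap.ext fun x => ?_
  change fieldOp g c (rightC f (rightC h (adjoint (rightC f) x) +
    adjoint (rightC h) (adjoint (rightC f) x))) =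
    rightC f (rightC h (adjoint (rightC f) (fieldOp g c x)) +
      adjoint (rightC h) (adjoint (rightC f) (fieldOp g c x)))
  rw [fieldOp_rightC, hgf, Complex.ofReal_zero, zero_mul, zero_smul, add_zero,
    adjoint_rightC_fieldOp hgf, shiftedFieldOp_right_comm]

theorem basisVec_concat (w : List ι) (i : ι) :
    (basisVec (w ++ [i]) : Fock ι) = rightC (basisVec i) (basisVec w) := by
  refine coord_ext fun v => ?_
  rcases List.eq_nil_or_concat' v with rfl | ⟨v, j, rfl⟩
  · rw [rightC_nil, coord_basisVec_ne (by simp)]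
  · rw [rightC_concat]
    by_cases hj : j = i
    · subst hj
      rw [coord_basisVec_self, Complex.ofReal_one, one_mul]
      by_cases hv : v = w
      · rw [hv, coord_basisVec_self, coord_basisVec_self]
      · rw [coord_basisVec_ne hv, coord_basisVec_ne (by simpa using hv)]
    · rw [coord_basisVec_ne hj, Complex.ofReal_zero, zero_mul, coord_basisVec_ne]
      intro h
      exact hj (by simpa using (List.append_inj' h rfl).2)

theorem basisVec_orthonormal (i j : ι) :
    inner ℝ (basisVec i : L2R ι) (basisVec j) = 0 ∨ i = j := by
  by_cases h : i = j
  · exact Or.inr h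
  · left
    rw [inner_basisVec, coord_basisVec_ne h]

theorem ext_basisVec {E : Type*} [NormedAddCommGroup E] [NormedSpace ℂ E] {κ : Type*}
    {S T : L2C κ →L[ℂ] E} (h : ∀ w, S (basisVec w) = T (basisVec w)) : S = T := by
  classical
  refine lp.ext_continuousLinearMap ENNReal.ofNat_ne_top fun w => ContinuousLinearMap.ext_ring ?_
  exact h w

/-- An operator that commutes with the right fields and kills the vector `f` vanishes on
`r(f)`-translates of all vectors. -/
theorem mul_rightC_eq_zero {f : L2R ι} (hf : inner ℝ f f = (1 : ℝ)) {a : Fock ι →L[ℂ] Fock ι}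
    (ha : ∀ h, Commute a (rightField f h)) (h0 : a (rightC f vac) = 0) : a * rightC f = 0 := by
  have hstep : ∀ h x, a (rightC f x) = 0 →
      a (rightC f (rightC h x)) + a (rightC f (adjoint (rightC h) x)) = 0 := by
    intro h x hx
    have h1 := DFunLike.congr_fun (ha h).eq (rightC f x)
    change a (rightC f (rightC h (adjoint (rightC f) (rightC f x)) +
      adjoint (rightC h) (adjoint (rightC f) (rightC f x)))) = rightField f h (a (rightC f x)) at h1
    rw [hx, map_zero, adjoint_rightC_rightC, hf, Complex.ofReal_one, one_smul] at h1
    rwa [map_add, map_add] at h1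
  -- Applying `r(h) + r(h)*` to a word adds a letter up to a multiple of a shorter word, so all
  -- words are reached by induction on the length.
  have key : ∀ n, ∀ w : List ι, w.length ≤ n → a (rightC f (basisVec w)) = 0 := by
    intro n
    induction n with
    | zero =>
      intro w hw
      rw [List.length_eq_zero_iff.1 (Nat.le_zero.1 hw)]
      exact h0
    | succ n ih =>
      intro w hw
      rcases List.eq_nil_or_concat' w with rfl | ⟨v, i, rfl⟩
      · exact h0
      · rw [List.length_append, List.length_singleton] at hw
        have h1 := hstep (basisVec i) (basisVec v) (ih v (by omega))
        rw [basisVec_concat]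
        have h2 : a (rightC f (adjoint (rightC (basisVec i)) (basisVec v))) = 0 := by
          rcases List.eq_nil_or_concat' v with rfl | ⟨u, j, rfl⟩
          · have : adjoint (rightC (basisVec i)) (basisVec [] : Fock ι) = 0 :=
              adjoint_rightC_vac _
            rw [this, map_zero, map_zero]
          · rw [basisVec_concat, adjoint_rightC_rightC, map_smul, map_smul]
            rcases basisVec_orthonormal i j with h3 | rfl
            · rw [h3, Complex.ofReal_zero, zero_smul]
            · rw [List.length_append, List.length_singleton] at hw
              rw [ih u (by omega), smul_zero]
        rwa [h2, add_zero] at h1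
  exact ext_basisVec fun w => key _ w le_rfl

/-- This is where `α ^ 2 * T ≤ 1` enters. The equation gives `‖x + α r(e) x‖² = (α² ‖e‖² - 1) ‖x‖² ≤
0`, hence `x = -α r(e) x`; since `r(e)` raises the word length, all coordinates of such an `x`
vanish. The boundary case is included. -/
theorem eq_zero_of_add_adjoint_rightC_eq_zero {α : ℝ} {e : L2R ι} (he : (|α| * ‖e‖) ^ 2 ≤ 1)
    {x : Fock ι} (hx : x + (α : ℂ) • adjoint (rightC e) x = 0) : x = 0 := by
  have h1 : inner ℂ x (rightC e x) * (α : ℂ) = - inner ℂ x x := by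
    have : inner ℂ (x + (α : ℂ) • adjoint (rightC e) x) x = 0 := by rw [hx, inner_zero_left]
    rw [inner_add_left, inner_smul_left, adjoint_inner_left, Complex.conj_ofReal] at this
    linear_combination this
  have h2 : inner ℂ (rightC e x) (rightC e x) = ((‖e‖ ^ 2 : ℝ) : ℂ) * inner ℂ x x := by
    rw [← real_inner_self_eq_norm_sq]
    exact inner_creation _ e e x x
  have h3 : inner ℂ (rightC e x) x * (α : ℂ) = - inner ℂ x x := by
    have := congrArg (starRingEnd ℂ) h1
    rwa [map_mul, map_neg, inner_conj_symm, inner_conj_symm, Complex.conj_ofReal] at this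
  have h4 : x + (α : ℂ) • rightC e x = 0 := by
    have h5 : inner ℂ (x + (α : ℂ) • rightC e x) (x + (α : ℂ) • rightC e x) =
        (((|α| * ‖e‖) ^ 2 - 1 : ℝ) : ℂ) * inner ℂ x x := by
      rw [inner_add_left, inner_add_right, inner_add_right, inner_smul_left, inner_smul_left,
        inner_smul_right, inner_smul_right, h2, Complex.conj_ofReal, mul_pow, sq_abs]
      push_cast
      linear_combination h1 + h3
    rw [inner_self_eq_norm_sq_to_K, inner_self_eq_norm_sq_to_K (𝕜 := ℂ) x] at h5
    have h6 : ‖x + (α : ℂ) • rightC e x‖ ^ 2 = ((|α| * ‖e‖) ^ 2 - 1) * ‖x‖ ^ 2 :=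
      Complex.ofReal_injective (by push_cast at h5 ⊢; exact h5)
    have h7 : ‖x + (α : ℂ) • rightC e x‖ ^ 2 ≤ 0 := by
      rw [h6]
      exact mul_nonpos_of_nonpos_of_nonneg (by linarith) (by positivity)
    exact norm_eq_zero.1 (pow_eq_zero_iff two_ne_zero |>.1 (le_antisymm h7 (by positivity)))
  have h5 : ∀ w, coord x w + α * coord (rightC e x) w = 0 := fun w => by
    rw [← coord_smul, ← coord_add, h4, coord_zero]
  refine coord_ext fun w => ?_
  rw [coord_zero]
  induction w using List.reverseRecOn with
  | nil => simpa only [rightC_nil, mul_zero, add_zero] using h5 []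
  | append_singleton w i ih =>
    simpa only [rightC_concat, ih, mul_zero, add_zero] using h5 (w ++ [i])

/-- The vacuum vector is separating for the operators that commute with the intertwiner and the
right fields. -/
theorem eq_zero_of_apply_vac_eq_zero {α : ℝ} {e f : L2R ι} (he : (|α| * ‖e‖) ^ 2 ≤ 1)
    (hf : inner ℝ f f = (1 : ℝ)) {a : Fock ι →L[ℂ] Fock ι}
    (ha : ∀ h, Commute a (rightField f h)) (hC : Commute a (intertwiner α e f))
    (hC' : Commute a (adjoint (intertwiner α e f))) (h0 : a vac = 0) : a = 0 := by
  -- The adjoint is `r(f) (1 + α r(e)*)`, and `r(e)*` kills the vacuum. So `a vac = 0` carries over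
  -- to the vector `r(f) vac`, the starting point for the right fields.
  have hCv : adjoint (intertwiner α e f) vac = rightC f vac := by
    refine ext_inner_right ℂ fun y => ?_
    rw [adjoint_inner_left]
    change inner ℂ vac (adjoint (rightC f) y + (α : ℂ) • rightC e (adjoint (rightC f) y)) = _
    rw [inner_add_right, inner_smul_right, inner_vac_rightC, mul_zero, add_zero,
      adjoint_inner_right]
  have h1 : a * rightC f = 0 := by
    refine mul_rightC_eq_zero hf ha ?_
    rw [← hCv]
    have := DFunLike.congr_fun hC'.eq vac
    change a (adjoint (intertwiner α e f) vac) = adjoint (intertwiner α e f) (a vac) at this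
    rw [this, h0, map_zero]
  -- As `r(f)* r(f) = 1`, the intertwiner maps `r(f) x` to `(1 + α r(e)) x`, while `a` kills `r(f)
  -- x`.
  have h2 : ∀ x, a (x + (α : ℂ) • rightC e x) = 0 := by
    intro x
    have h3 := DFunLike.congr_fun hC.eq (rightC f x)
    change a (adjoint (rightC f) (rightC f x) + (α : ℂ) • rightC e (adjoint (rightC f)
      (rightC f x))) = intertwiner α e f ((a * rightC f) x) at h3
    rwa [h1, zero_apply, map_zero, adjoint_rightC_rightC, hf, Complex.ofReal_one, one_smul] at h3
  -- Dense range of `1 + α r(e)` is used in the form of injectivity of its adjoint.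
  have h3 : adjoint a = 0 := by
    refine ContinuousLinearMap.ext fun y => eq_zero_of_add_adjoint_rightC_eq_zero he ?_
    refine ext_inner_right ℂ fun x => ?_
    have h4 : inner ℂ (adjoint a y) (x + (α : ℂ) • rightC e x) = 0 := by
      rw [adjoint_inner_left, h2, inner_zero_right]
    rw [inner_add_left, inner_smul_left, adjoint_inner_left (rightC e), Complex.conj_ofReal,
      inner_zero_left, ← h4, inner_add_right, inner_smul_right]
  rw [← adjoint_adjoint a, h3, map_zero]

end Commutant

/-! ### Vector functionals and generated von Neumann algebras -/

section VectorStates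

variable {H : Type*} [NormedAddCommGroup H] [InnerProductSpace ℂ H] [CompleteSpace H]

/-- The von Neumann algebra generated by a set of operators. -/
noncomputable def generatedVN (S : Set (H →L[ℂ] H)) : VonNeumannAlgebra H where
  toStarSubalgebra := StarSubalgebra.centralizer ℂ
    (StarSubalgebra.centralizer ℂ S : Set (H →L[ℂ] H))
  centralizer_centralizer' := by
    change Set.centralizer (Set.centralizer ((StarSubalgebra.centralizer ℂ
      (StarSubalgebra.centralizer ℂ S : Set (H →L[ℂ] H)) : StarSubalgebra ℂ (H →L[ℂ] H)) :
        Set (H →L[ℂ] H))) = ((StarSubalgebra.centralizer ℂ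
      (StarSubalgebra.centralizer ℂ S : Set (H →L[ℂ] H)) : StarSubalgebra ℂ (H →L[ℂ] H)) :
        Set (H →L[ℂ] H))
    rw [StarSubalgebra.coe_centralizer, Set.centralizer_centralizer_centralizer]

theorem commute_of_mem_generatedVN {S : Set (H →L[ℂ] H)} {a b : H →L[ℂ] H}
    (ha : a ∈ generatedVN S) (hb : ∀ x ∈ S, Commute x b ∧ Commute (star x) b) : Commute a b := by
  have ha' : a ∈ StarSubalgebra.centralizer ℂ
    (StarSubalgebra.centralizer ℂ S : Set (H →L[ℂ] H)) := ha
  rw [StarSubalgebra.mem_centralizer_iff] at ha'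
  refine ((ha' b ?_).1 : b * a = a * b).symm
  rw [SetLike.mem_coe, StarSubalgebra.mem_centralizer_iff]
  exact fun x hx => ⟨(hb x hx).1, (hb x hx).2⟩

theorem subset_generatedVN (S : Set (H →L[ℂ] H)) {x : H →L[ℂ] H} (hx : x ∈ S) :
    x ∈ generatedVN S := by
  change x ∈ StarSubalgebra.centralizer ℂ
    (StarSubalgebra.centralizer ℂ S : Set (H →L[ℂ] H))
  rw [StarSubalgebra.mem_centralizer_iff]
  intro b hb
  have hb' := hb
  rw [SetLike.mem_coe, StarSubalgebra.mem_centralizer_iff] at hb hb'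
  refine ⟨((hb x hx).1).symm, ?_⟩
  have := congrArg star (hb x hx).2
  simpa using this

theorem generatedVN_le {S : Set (H →L[ℂ] H)} {N : VonNeumannAlgebra H} (h : ∀ x ∈ S, x ∈ N) :
    generatedVN S ≤ N := by
  intro a ha
  rw [← N.commutant_commutant, VonNeumannAlgebra.mem_commutant_iff]
  intro b hb
  rw [VonNeumannAlgebra.mem_commutant_iff] at hb
  exact (commute_of_mem_generatedVN ha fun x hx =>
    ⟨hb x (h x hx), hb _ (star_mem (h x hx))⟩).eq.symm

/-- The functional `a ↦ ⟨ξ, a ξ⟩`. -/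
noncomputable def vectorFunctional (M : VonNeumannAlgebra H) (ξ : H) :
    M.toStarSubalgebra →ₗ[ℂ] ℂ where
  toFun a := inner ℂ ξ ((a : H →L[ℂ] H) ξ)
  map_add' _ _ := inner_add_right _ _ _
  map_smul' _ _ := inner_smul_right _ _ _

variable {M : VonNeumannAlgebra H} {ξ : H}

theorem vectorFunctional_apply (a : M.toStarSubalgebra) :
    vectorFunctional M ξ a = inner ℂ ξ ((a : H →L[ℂ] H) ξ) := rfl

theorem vectorFunctional_star_mul_self (a : M.toStarSubalgebra) :
    vectorFunctional M ξ (star a * a) = ((‖(a : H →L[ℂ] H) ξ‖ ^ 2 : ℝ) : ℂ) := by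
  rw [vectorFunctional_apply]
  change inner ℂ ξ (ContinuousLinearMap.adjoint (a : H →L[ℂ] H) ((a : H →L[ℂ] H) ξ)) = _
  rw [ContinuousLinearMap.adjoint_inner_right, inner_self_eq_norm_sq_to_K]
  push_cast
  rfl

theorem isState_vectorFunctional (h : inner ℂ ξ ξ = (1 : ℂ)) : IsState (vectorFunctional M ξ) := by
  refine ⟨h, fun a => ?_⟩
  rw [vectorFunctional_star_mul_self, Complex.zero_le_real]
  positivity

theorem isNormalFunctional_vectorFunctional : IsNormalFunctional (vectorFunctional M ξ) := by
  have hs : Summable fun n : ℕ => ‖if n = 0 then ξ else 0‖ ^ 2 :=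
    summable_of_ne_finset_zero (s := {0}) fun n hn => by
      rw [if_neg (by simpa using hn), norm_zero, zero_pow two_ne_zero]
  refine ⟨fun n => if n = 0 then ξ else 0, fun n => if n = 0 then ξ else 0, hs, hs, fun a => ?_⟩
  · have := hasSum_single (f := fun n : ℕ => inner ℂ (if n = 0 then ξ else 0)
      ((a : H →L[ℂ] H) (if n = 0 then ξ else 0))) 0 fun n hn => by
        rw [if_neg hn, inner_zero_left]
    simp only [if_pos] at this
    exact this

end VectorStates

/-! ### Construction of the process for `T ≤ 1 / α ^ 2` -/

section Existence

open ContinuousLinearMap MeasureTheory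

/-- A realization of Brownian motion as a family of vectors in a real Hilbert space, together with
a unit vector that is orthogonal to all of them. -/
theorem exists_brownian_vectors : ∃ (ι : Type) (e : ℝ → L2R ι) (f : L2R ι),
    (∀ s t, 0 ≤ s → s ≤ t → inner ℝ (e s) (e t) = s) ∧ inner ℝ f f = (1 : ℝ) ∧
      ∀ t, inner ℝ (e t) f = 0 := by
  obtain ⟨w, b, -⟩ := exists_hilbertBasis ℝ (Lp ℝ 2 (volume : Measure ℝ))
  have hmeas : ∀ s t : ℝ, MeasurableSet (Set.Ioc s t) := fun s t => measurableSet_Ioc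
  have hfin : ∀ s t : ℝ, volume (Set.Ioc s t) ≠ ⊤ := fun s t => by simp
  have hinner : ∀ s t s' t' : ℝ,
      inner ℝ (b.repr (indicatorConstLp 2 (hmeas s t) (hfin s t) (1 : ℝ)))
        (b.repr (indicatorConstLp 2 (hmeas s' t') (hfin s' t') (1 : ℝ))) =
      volume.real (Set.Ioc s t ∩ Set.Ioc s' t') := by
    intro s t s' t'
    rw [LinearIsometryEquiv.inner_map_map, L2.inner_indicatorConstLp_indicatorConstLp
        (hμs := hfin s t) (hμt := hfin s' t')]
    simp
  -- The vectors are the indicators of `(0, t]` and `(-1, 0]` in `L²(ℝ)`, written in coordinates of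
  -- a Hilbert basis.
  refine ⟨w, fun t => b.repr (indicatorConstLp 2 (hmeas 0 t) (hfin 0 t) 1),
    b.repr (indicatorConstLp 2 (hmeas (-1) 0) (hfin (-1) 0) 1), fun s t hs hst => ?_, ?_,
    fun t => ?_⟩
  · rw [hinner, Set.inter_eq_left.2 (Set.Ioc_subset_Ioc_right hst)]
    simp [hs]
  · rw [hinner, Set.inter_self]
    simp
  · rw [hinner]
    have : Set.Ioc 0 t ∩ Set.Ioc (-1 : ℝ) 0 = ∅ := by
      ext x
      simp only [Set.mem_inter_iff, Set.mem_Ioc, Set.mem_empty_iff_false, iff_false]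
      rintro ⟨⟨h1, -⟩, -, h2⟩
      linarith
    rw [this]
    simp

variable {ι : Type*} {e : ℝ → L2R ι} {f : L2R ι}

theorem inner_increments (he : ∀ s t, 0 ≤ s → s ≤ t → inner ℝ (e s) (e t) = s) {s t s' t' : ℝ}
    (hs : 0 ≤ s) (hst : s ≤ t) (hts : t ≤ s') (hst' : s' ≤ t') :
    inner ℝ (e t - e s) (e t' - e s') = 0 := by
  rw [inner_sub_left, inner_sub_right, inner_sub_right, he t t' (by linarith) (by linarith),
    he t s' (by linarith) (by linarith), he s t' (by linarith) (by linarith),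
    he s s' (by linarith) (by linarith)]
  ring

theorem inner_increments_of_disjoint (he : ∀ s t, 0 ≤ s → s ≤ t → inner ℝ (e s) (e t) = s)
    {s t s' t' : ℝ} (hs : 0 ≤ s) (hst : s ≤ t) (hs' : 0 ≤ s') (hst' : s' ≤ t')
    (hd : Disjoint (Set.Ico s t) (Set.Ico s' t')) : inner ℝ (e t - e s) (e t' - e s') = 0 := by
  rcases hst.eq_or_lt with rfl | h1
  · rw [sub_self, inner_zero_left]
  rcases hst'.eq_or_lt with rfl | h2
  · rw [sub_self, inner_zero_right]
  rw [Set.Ico_disjoint_Ico] at hd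
  rcases le_total t t' with h3 | h3
  · rw [min_eq_left h3] at hd
    rcases le_max_iff.1 hd with h4 | h4
    · exact absurd h4 (not_le.2 h1)
    · exact inner_increments he hs hst h4 hst'
  · rw [min_eq_right h3] at hd
    rcases le_max_iff.1 hd with h4 | h4
    · rw [real_inner_comm]
      exact inner_increments he hs' hst' h4 hst
    · exact absurd h4 (not_le.2 h2)

theorem norm_increment_sq (he : ∀ s t, 0 ≤ s → s ≤ t → inner ℝ (e s) (e t) = s) {s t : ℝ}
    (hs : 0 ≤ s) (hst : s ≤ t) : ‖e t - e s‖ ^ 2 = t - s := by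
  rw [← real_inner_self_eq_norm_sq, inner_sub_left, inner_sub_right, inner_sub_right,
    he t t (by linarith) le_rfl, he s t hs hst, he s s hs le_rfl, real_inner_comm,
    he s t hs hst]
  ring

variable (e) in
/-- The von Neumann algebra generated by the process on `[0, T]`. -/
noncomputable def processVN (α T : ℝ) : VonNeumannAlgebra (Fock ι) :=
  generatedVN {x | ∃ t, 0 ≤ t ∧ t ≤ T ∧ x = fieldOp (e t) (α * t)}

variable (e) in
/-- The process of field operators, stopped outside of `[0, T]`. -/
noncomputable def fieldProcess (α : ℝ) {T : ℝ} (hT : 0 ≤ T) (t : ℝ) :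
    (processVN e α T).toStarSubalgebra :=
  ⟨fieldOp (e (max 0 (min t T))) (α * max 0 (min t T)), subset_generatedVN _
    ⟨_, le_max_left _ _, max_le hT (min_le_right _ _), rfl⟩⟩

variable {α T : ℝ} {hT : 0 ≤ T}

theorem coe_fieldProcess {t : ℝ} (h0 : 0 ≤ t) (h1 : t ≤ T) :
    (fieldProcess e α hT t : Fock ι →L[ℂ] Fock ι) = fieldOp (e t) (α * t) := by
  have : max 0 (min t T) = t := by rw [min_eq_left h1, max_eq_right h0]
  change fieldOp (e (max 0 (min t T))) (α * max 0 (min t T)) = _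
  rw [this]

theorem coe_fieldProcess_sub {s t : ℝ} (hs : 0 ≤ s) (hst : s ≤ t) (ht : t ≤ T) :
    ((fieldProcess e α hT t - fieldProcess e α hT s :
      (processVN e α T).toStarSubalgebra) : Fock ι →L[ℂ] Fock ι) =
      fieldOp (e t - e s) (α * t - α * s) := by
  rw [fieldOp_sub, ← coe_fieldProcess (hT := hT) (by linarith) ht,
    ← coe_fieldProcess (hT := hT) hs (by linarith)]
  rfl

theorem isWStarProbabilitySpace_processVN
    (he : ∀ s t, 0 ≤ s → s ≤ t → inner ℝ (e s) (e t) = s)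
    (hf : inner ℝ f f = (1 : ℝ)) (hef : ∀ t, inner ℝ (e t) f = 0) (hT : 0 ≤ T)
    (hαT : α ^ 2 * T ≤ 1) :
    IsWStarProbabilitySpace (processVN e α T) (vectorFunctional _ vac)
      (vectorFunctional _ (rightC f vac)) := by
  refine ⟨isState_vectorFunctional inner_vac_vac, isNormalFunctional_vectorFunctional, ?_,
    isState_vectorFunctional ?_, isNormalFunctional_vectorFunctional⟩
  · intro a ha
    rw [vectorFunctional_star_mul_self, Complex.ofReal_eq_zero, pow_eq_zero_iff two_ne_zero,
      norm_eq_zero] at ha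
    have hcomm : ∀ b : Fock ι →L[ℂ] Fock ι, (∀ t, 0 ≤ t → t ≤ T →
        Commute (fieldOp (e t) (α * t)) b) → Commute (a : Fock ι →L[ℂ] Fock ι) b := by
      intro b hb
      refine commute_of_mem_generatedVN a.2 ?_
      rintro _ ⟨t, h0, h1, rfl⟩
      rw [(isSelfAdjoint_fieldOp _ _).star_eq]
      exact ⟨hb t h0 h1, hb t h0 h1⟩
    -- One endpoint vector serves all times, because `⟨e t, e T⟩ = t` is exactly what the constant
    -- `α t` requires.
    have hC : ∀ t, 0 ≤ t → t ≤ T →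
        Commute (fieldOp (e t) (α * t)) (intertwiner α (e T) f) := by
      intro t h0 h1
      have := commute_intertwiner (hef t) α (e T)
      rwa [he t T h0 h1] at this
    refine Subtype.ext (eq_zero_of_apply_vac_eq_zero (α := α) (e := e T) ?_ hf (fun h => ?_)
      (hcomm _ hC) (hcomm _ fun t h0 h1 => ?_) ha)
    · rw [mul_pow, sq_abs, ← real_inner_self_eq_norm_sq, he T T hT le_rfl]
      exact hαT
    · exact hcomm _ fun t _ _ => commute_rightField (hef t) _ _
    · have := (hC t h0 h1).star_star
      rwa [(isSelfAdjoint_fieldOp _ _).star_eq] at this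
  · exact (inner_creation _ f f vac vac).trans (by rw [hf, inner_vac_vac]; simp)

theorem adjoint_leftC_rightC_vac {g : L2R ι} (hgf : inner ℝ g f = 0) :
    adjoint (leftC g) (rightC f (vac : Fock ι)) = 0 := by
  rw [adjoint_leftC_rightC, adjoint_leftC_vac, map_zero, hgf, Complex.ofReal_zero, zero_mul,
    zero_smul, add_zero]

/-- The letter `f` at the end of each word screens off the vacuum projection. Under `ψ` the process
is thus a semicircular one shifted by `c`. -/
theorem inner_fieldOp_pow_rightC_vac (hf : inner ℝ f f = (1 : ℝ)) {g : L2R ι}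
    (hgf : inner ℝ g f = 0) (c : ℝ) (n : ℕ) :
    inner ℂ (rightC f vac) ((fieldOp g c ^ n) (rightC f vac)) =
      inner ℂ vac ((shiftedFieldOp g c ^ n) vac) := by
  rw [fieldOp_pow_rightC_of_orthogonal g c hgf]
  exact (inner_creation _ f f _ _).trans (by rw [hf]; simp)

theorem vectorFunctional_pow {H : Type*} [NormedAddCommGroup H] [InnerProductSpace ℂ H]
    [CompleteSpace H] {M : VonNeumannAlgebra H} (ξ : H) (a : M.toStarSubalgebra) {b : H →L[ℂ] H}
    (h : (a : H →L[ℂ] H) = b) (n : ℕ) :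
    vectorFunctional M ξ (a ^ n) = inner ℂ ξ ((b ^ n) ξ) := by
  rw [← h]
  rfl

theorem inner_sub_test_eq_zero (hef : ∀ t, inner ℝ (e t) f = 0) (s t : ℝ) :
    inner ℝ (e t - e s) f = 0 := by
  rw [inner_sub_left, hef, hef, sub_zero]

set_option maxHeartbeats 400000 in
theorem isTwoStateFree_fieldProcess (he : ∀ s t, 0 ≤ s → s ≤ t → inner ℝ (e s) (e t) = s)
    (hf : inner ℝ f f = (1 : ℝ)) (hef : ∀ t, inner ℝ (e t) f = 0) (k : ℕ) (s t : Fin k → ℝ)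
    (hst : ∀ j, 0 ≤ s j ∧ s j ≤ t j ∧ t j ≤ T)
    (hd : Pairwise fun i j => Disjoint (Set.Ico (s i) (t i)) (Set.Ico (s j) (t j))) :
    IsTwoStateFree (vectorFunctional (processVN e α T) vac) (vectorFunctional _ (rightC f vac))
      (fun j => Algebra.adjoin ℂ {fieldProcess e α hT (t j) - fieldProcess e α hT (s j)}) := by
  set V : (processVN e α T).toStarSubalgebra →ₐ[ℂ] (Fock ι →L[ℂ] Fock ι) :=
    (processVN e α T).toStarSubalgebra.toSubalgebra.val with hV
  have hφ : ∀ x, vectorFunctional (processVN e α T) vac x = inner ℂ vac (V x vac) := fun _ => rfl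
  have hψ : ∀ x, vectorFunctional (processVN e α T) (rightC f vac) x =
    inner ℂ (rightC f vac) (V x (rightC f vac)) := fun _ => rfl
  have hVX : ∀ j, V (fieldProcess e α hT (t j) - fieldProcess e α hT (s j)) =
      fieldOp (e (t j) - e (s j)) (α * t j - α * s j) := fun j =>
    coe_fieldProcess_sub (hst j).1 (hst j).2.1 (hst j).2.2
  clear_value V
  rintro (_ | ⟨⟨i, a⟩, w⟩) hne hchain hmem
  · exact absurd rfl hne
  simp only [hφ, hψ] at hmem ⊢
  set W : List (Fin k × (Fock ι →L[ℂ] Fock ι)) := w.map fun p => (p.1, V p.2) with hW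
  have hWw : (i, V a) :: W = ((i, a) :: w).map fun p => (p.1, V p.2) := rfl
  have hadj : ∀ j, ∀ x ∈ Algebra.adjoin ℂ
      {fieldProcess e α hT (t j) - fieldProcess e α hT (s j)},
      V x ∈ Algebra.adjoin ℂ {fieldOp (e (t j) - e (s j)) (α * t j - α * s j)} := by
    intro j x hx
    have h1 : V x ∈ (Algebra.adjoin ℂ
        {fieldProcess e α hT (t j) - fieldProcess e α hT (s j)}).map V :=
      Subalgebra.mem_map.2 ⟨x, hx, rfl⟩
    rwa [AlgHom.map_adjoin, Set.image_singleton, hVX] at h1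
  have hmemW : ∀ p ∈ (i, V a) :: W, p.2 ∈ Algebra.adjoin ℂ
      {fieldOp (e (t p.1) - e (s p.1)) (α * t p.1 - α * s p.1)} ∧
        inner ℂ (rightC f vac) (p.2 (rightC f vac)) = 0 := by
    rw [hWw]
    intro p hp
    obtain ⟨q, hq, rfl⟩ := List.mem_map.1 hp
    obtain ⟨h1, h2⟩ := hmem q hq
    exact ⟨hadj _ _ h1, h2⟩
  have hchainW : ((i, V a) :: W).IsChain fun p q => p.1 ≠ q.1 := by
    rw [hWw, List.isChain_map]
    exact hchain
  obtain ⟨⟨x, hx⟩, y, hy⟩ := exists_word_apply_eq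
    (γ := fun j => e (t j) - e (s j)) (κ := fun j => α * t j - α * s j) (f := rightC f vac)
    (fun i j hij => inner_increments_of_disjoint he (hst i).1 (hst i).2.1 (hst j).1 (hst j).2.1
      (hd hij))
    (fun j => adjoint_leftC_rightC_vac (inner_sub_test_eq_zero hef _ _)) (inner_vac_rightC _ _)
    ((inner_creation _ f f vac vac).trans (by rw [hf, inner_vac_vac]; simp)) i (V a) W
    hchainW hmemW
  have hprod : ((((i, V a) :: W).map Prod.snd).prod) = V ((((i, a) :: w).map Prod.snd).prod) := by
    rw [map_list_prod, hWw, List.map_map, List.map_map]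
    rfl
  have hscal : (((i, V a) :: W).map fun p => inner ℂ (vac : Fock ι) (p.2 vac)) =
      ((i, a) :: w).map fun p => inner ℂ (vac : Fock ι) (V p.2 vac) := by
    rw [hWw, List.map_map]
    rfl
  rw [hprod] at hx hy
  rw [hscal] at hy
  constructor
  · rw [hx, inner_leftC_of_adjoint_eq_zero _
      (adjoint_leftC_rightC_vac (inner_sub_test_eq_zero hef _ _))]
  · rw [hy, inner_add_right, inner_vac_leftC, inner_smul_right, inner_vac_vac, add_zero, mul_one]

theorem isTwoStateFreeBrownianMotion_fieldProcess
    (he : ∀ s t, 0 ≤ s → s ≤ t → inner ℝ (e s) (e t) = s)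
    (hf : inner ℝ f f = (1 : ℝ)) (hef : ∀ t, inner ℝ (e t) f = 0) :
    IsTwoStateFreeBrownianMotion (vectorFunctional (processVN e α T) vac)
      (vectorFunctional _ (rightC f vac)) T (fieldProcess e α hT) := by
  have he0 : e 0 = 0 := by
    rw [← norm_eq_zero, ← pow_eq_zero_iff two_ne_zero, ← real_inner_self_eq_norm_sq,
      he 0 0 le_rfl le_rfl]
  have hnorm : ∀ s t, 0 ≤ s → s ≤ t → ‖e t - e s‖ = ‖e (t - s)‖ := by
    intro s t hs hst
    rw [← abs_norm, ← abs_norm (e _), ← sq_eq_sq_iff_abs_eq_abs, norm_increment_sq he hs hst,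
      ← real_inner_self_eq_norm_sq, he _ _ (by linarith) le_rfl]
  have hmom : ∀ s t, 0 ≤ s → s ≤ t → t ≤ T → ∀ n,
      vectorFunctional (processVN e α T) vac ((fieldProcess e α hT t - fieldProcess e α hT s) ^ n) =
        inner ℂ vac ((fieldOp (e t - e s) (α * (t - s)) ^ n) vac) := by
    intro s t hs hst ht n
    rw [mul_sub]
    exact vectorFunctional_pow _ _ (coe_fieldProcess_sub hs hst ht) n
  have hmom' : ∀ s t, 0 ≤ s → s ≤ t → t ≤ T → ∀ n, vectorFunctional (processVN e α T)
      (rightC f vac) ((fieldProcess e α hT t - fieldProcess e α hT s) ^ n) =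
        inner ℂ vac ((shiftedFieldOp (e t - e s) (α * (t - s)) ^ n) vac) := by
    intro s t hs hst ht n
    rw [vectorFunctional_pow _ _ (coe_fieldProcess_sub hs hst ht) n, ← mul_sub,
      inner_fieldOp_pow_rightC_vac hf (inner_sub_test_eq_zero hef _ _)]
  have hvar : ∀ s t, 0 ≤ s → s ≤ t → inner ℂ vac
      ((fieldOp (e t - e s) (α * (t - s)) ^ 2) vac) = ((t - s : ℝ) : ℂ) := by
    intro s t hs hst
    rw [inner_vac_fieldOp_pow_succ, Finset.sum_range_one, pow_zero, pow_zero, one_apply_eq_self,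
      inner_vac_vac, norm_increment_sq he hs hst, mul_one, mul_one]
  refine { selfAdjoint := fun t h0 h1 => ?_, start := ?_, centered := fun t h0 h1 => ?_,
           stationary_fst := fun s t hs hst ht n => ?_, stationary_snd := fun s t hs hst ht n => ?_,
           free := isTwoStateFree_fieldProcess he hf hef,
           normal := fun s t hs hst ht n hn => ?_, variance := fun s t hs hst ht => ?_ }
  · refine Subtype.ext ?_
    change star (fieldProcess e α hT t : Fock ι →L[ℂ] Fock ι) = fieldProcess e α hT t
    rw [coe_fieldProcess h0 h1, (isSelfAdjoint_fieldOp _ _).star_eq]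
  · refine Subtype.ext ?_
    have h1 := fieldOp_sub (e 0) (e 0) (α * 0) (α * 0)
    rw [sub_self, sub_self, sub_self] at h1
    rw [coe_fieldProcess le_rfl hT, he0, mul_zero, h1]
    rfl
  · change inner ℂ vac ((fieldProcess e α hT t : Fock ι →L[ℂ] Fock ι) vac) = 0
    rw [coe_fieldProcess h0 h1, fieldOp_vac, inner_vac_leftC]
  · rw [hmom s t hs hst ht, inner_vac_fieldOp_pow_congr _ (hnorm s t hs hst)]
    exact (vectorFunctional_pow _ _ (coe_fieldProcess (by linarith) (by linarith)) n).symm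
  · rw [hmom' s t hs hst ht, inner_vac_shiftedFieldOp_pow_congr _ (hnorm s t hs hst),
      vectorFunctional_pow _ _ (coe_fieldProcess (by linarith) (by linarith)) n,
      inner_fieldOp_pow_rightC_vac hf (hef _)]
  · refine twoStateFreeCumulantSeq_eq_zero ((t - s : ℝ) : ℂ) ?_ ?_ ?_ (fun n => ?_) n hn
    · rw [hmom s t hs hst ht, pow_zero, one_apply_eq_self, inner_vac_vac]
    · rw [hmom' s t hs hst ht, pow_zero, one_apply_eq_self, inner_vac_vac]
    · rw [hmom s t hs hst ht, pow_one, fieldOp_vac, inner_vac_leftC]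
    · simp only [hmom s t hs hst ht, hmom' s t hs hst ht]
      rw [inner_vac_fieldOp_pow_succ, norm_increment_sq he hs hst]
      rfl
  · rw [hmom s t hs hst ht, hvar s t hs hst]

theorem hasParameter_fieldProcess (hf : inner ℝ f f = (1 : ℝ))
    (hef : ∀ t, inner ℝ (e t) f = 0) :
    HasParameter (vectorFunctional (processVN e α T) (rightC f vac)) T (fieldProcess e α hT) α := by
  intro t h0 h1
  rw [freeCumulant, freeCumulantSeq_one, vectorFunctional_pow _ _ (coe_fieldProcess h0 h1),
    inner_fieldOp_pow_rightC_vac hf (hef _), inner_vac_shiftedFieldOp_pow_succ, pow_zero,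
    one_apply_eq_self, inner_vac_vac]
  simp

/-- Two-state free Brownian motions with parameter `α` exist up to time `1 / α ^ 2`. -/
theorem exists_twoStateFreeBrownianMotion (α : ℝ) (hα : α ≠ 0) (T : ℝ) (hT : 0 ≤ T)
    (hT' : T ≤ 1 / α ^ 2) :
    ∃ (H : Type) (_ : NormedAddCommGroup H) (_ : InnerProductSpace ℂ H) (_ : CompleteSpace H)
      (M : VonNeumannAlgebra H) (φ ψ : M.toStarSubalgebra →ₗ[ℂ] ℂ) (X : ℝ → M.toStarSubalgebra),
      IsWStarProbabilitySpace M φ ψ ∧ IsTwoStateFreeBrownianMotion φ ψ T X ∧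
        HasParameter ψ T X α ∧ IsGeneratedBy M T X := by
  obtain ⟨ι, e, f, he, hf, hef⟩ := exists_brownian_vectors
  refine ⟨Fock ι, inferInstance, inferInstance, inferInstance, processVN e α T,
    vectorFunctional _ vac, vectorFunctional _ (rightC f vac), fieldProcess e α hT,
    isWStarProbabilitySpace_processVN he hf hef hT ?_,
    isTwoStateFreeBrownianMotion_fieldProcess he hf hef, hasParameter_fieldProcess hf hef,
    fun N hN => generatedVN_le ?_⟩
  · rw [le_div_iff₀ (by positivity)] at hT'
    linarith
  · rintro _ ⟨t, h0, h1, rfl⟩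
    rw [← coe_fieldProcess (hT := hT) h0 h1]
    exact hN t h0 h1

end Existence

/-! ### States on C*-algebras -/

section States

open ComplexConjugate Filter Topology

section Algebraic

variable {A : Type*} [Ring A] [StarRing A] [Algebra ℂ A] {ω : A →ₗ[ℂ] ℂ}

theorem IsState.re_nonneg (h : IsState ω) (a : A) : 0 ≤ (ω (star a * a)).re :=
  (Complex.nonneg_iff.1 (h.2 a)).1

theorem IsState.im_eq_zero (h : IsState ω) (a : A) : (ω (star a * a)).im = 0 :=
  (Complex.nonneg_iff.1 (h.2 a)).2.symm

theorem IsState.re_mul_self_nonneg (h : IsState ω) {a : A} (ha : IsSelfAdjoint a) :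
    0 ≤ (ω (a * a)).re := by
  simpa [ha.star_eq] using h.re_nonneg a

variable [StarModule ℂ A]

theorem IsState.star_mul_symm (h : IsState ω) (a b : A) :
    ω (star a * b) = conj (ω (star b * a)) := by
  have h1 := h.im_eq_zero (a + b)
  have h2 := h.im_eq_zero (a + Complex.I • b)
  have ha := h.im_eq_zero a
  have hb := h.im_eq_zero b
  simp only [star_add, star_smul, add_mul, mul_add, map_add, smul_mul_assoc, mul_smul_comm,
    map_smul, smul_eq_mul, Complex.add_im, Complex.mul_im, Complex.mul_re, Complex.I_re,
    Complex.I_im, Complex.star_def, Complex.conj_I, Complex.neg_re, Complex.neg_im] at h1 h2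
  apply Complex.ext
  · simp only [Complex.conj_re]; linarith
  · simp only [Complex.conj_im]; linarith

theorem IsState.map_star (h : IsState ω) (a : A) : ω (star a) = conj (ω a) := by
  simpa using h.star_mul_symm a 1

theorem IsState.im_eq_zero_of_isSelfAdjoint (h : IsState ω) {a : A} (ha : IsSelfAdjoint a) :
    (ω a).im = 0 := by
  have h1 := h.map_star a
  rw [ha.star_eq] at h1
  exact Complex.conj_eq_iff_im.1 h1.symm

theorem IsState.ofReal_re (h : IsState ω) {a : A} (ha : IsSelfAdjoint a) :
    (((ω a).re : ℝ) : ℂ) = ω a :=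
  Complex.ext rfl (h.im_eq_zero_of_isSelfAdjoint ha).symm

/-- The pre-inner product `⟪a, b⟫ = ω (a* b)` of a state. -/
@[reducible]
noncomputable def IsState.innerCore (h : IsState ω) : PreInnerProductSpace.Core ℂ A where
  inner a b := ω (star a * b)
  conj_inner_symm a b := (h.star_mul_symm a b).symm
  re_inner_nonneg a := h.re_nonneg a
  add_left a b c := by simp [add_mul]
  smul_left a b r := by simp

/-- The Cauchy-Schwarz inequality for states. -/
theorem IsState.norm_sq_le (h : IsState ω) (a b : A) :
    ‖ω (star a * b)‖ ^ 2 ≤ (ω (star a * a)).re * (ω (star b * b)).re := by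
  let := h.innerCore
  have h1 := InnerProductSpace.Core.inner_mul_inner_self_le (𝕜 := ℂ) a b
  have h2 : ‖ω (star b * a)‖ = ‖ω (star a * b)‖ := by
    rw [h.star_mul_symm a b, Complex.norm_conj]
  calc ‖ω (star a * b)‖ ^ 2 = ‖ω (star a * b)‖ * ‖ω (star b * a)‖ := by rw [h2, sq]
    _ ≤ _ := h1

end Algebraic

variable {A : Type*} [CStarAlgebra A] {ω : A →ₗ[ℂ] ℂ}

theorem exists_star_mul_self_eq_sub {y : A} (hy : IsSelfAdjoint y) {C : ℝ} (hC : ‖y‖ ≤ C) :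
    ∃ b : A, (C : ℂ) • (1 : A) - y = star b * b := by
  let := CStarAlgebra.spectralOrder A
  let := CStarAlgebra.spectralOrderedRing A
  have h1 : y ≤ algebraMap ℝ A ‖y‖ := hy.le_algebraMap_norm_self
  have h2 : algebraMap ℝ A ‖y‖ ≤ algebraMap ℝ A C := algebraMap_mono A hC
  have h3 : (C : ℂ) • (1 : A) = algebraMap ℝ A C := by
    rw [Algebra.algebraMap_eq_smul_one, Complex.coe_smul]
  rw [h3]
  exact CStarAlgebra.nonneg_iff_eq_star_mul_self.1 (sub_nonneg.2 (h1.trans h2))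

/-- `ω (q* y q) ≤ C ω (q* q)` for self-adjoint `y` with `‖y‖ ≤ C`. -/
theorem IsState.conjugate_le (h : IsState ω) {y : A} (hy : IsSelfAdjoint y) {C : ℝ}
    (hC : ‖y‖ ≤ C) (q : A) : (ω (star q * y * q)).re ≤ C * (ω (star q * q)).re := by
  obtain ⟨b, hb⟩ := exists_star_mul_self_eq_sub hy hC
  have h1 := h.re_nonneg (b * q)
  have h2 : star (b * q) * (b * q) = (C : ℂ) • (star q * q) - star q * y * q := by
    rw [star_mul, mul_assoc, ← mul_assoc (star b), ← hb, sub_mul, mul_sub]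
    simp [mul_assoc]
  rw [h2] at h1
  simp only [map_sub, map_smul, smul_eq_mul, Complex.sub_re, Complex.re_ofReal_mul] at h1
  linarith

theorem IsState.norm_le (h : IsState ω) (a : A) : ‖ω a‖ ≤ ‖a‖ := by
  have h1 := h.norm_sq_le 1 a
  have h2 := h.conjugate_le (IsSelfAdjoint.star_mul_self a) (le_of_eq CStarRing.norm_star_mul_self) 1
  simp only [star_one, one_mul, mul_one, h.1, Complex.one_re] at h1 h2
  exact abs_le_of_sq_le_sq' (by nlinarith) (norm_nonneg a) |>.2

theorem IsState.continuous (h : IsState ω) : Continuous ω :=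
  (LinearMap.mkContinuous ω 1 fun a => by simpa using h.norm_le a).continuous

theorem IsState.cfc_nonneg (h : IsState ω) {a : A} {g : ℝ → ℝ} (hg : Continuous g)
    (hg0 : ∀ x, 0 ≤ g x) : 0 ≤ (ω (cfc g a)).re := by
  have h1 : cfc g a = cfc (fun x => √(g x)) a * cfc (fun x => √(g x)) a := by
    rw [← cfc_mul _ _ a (by fun_prop) (by fun_prop)]
    exact cfc_congr fun x _ => (Real.mul_self_sqrt (hg0 x)).symm
  rw [h1]
  exact h.re_mul_self_nonneg IsSelfAdjoint.cfc

theorem IsState.cfc_mono (h : IsState ω) {a : A} {f g : ℝ → ℝ} (hf : Continuous f)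
    (hg : Continuous g) (hfg : ∀ x, f x ≤ g x) : (ω (cfc f a)).re ≤ (ω (cfc g a)).re := by
  have h1 := h.cfc_nonneg (a := a) (g := fun x => g x - f x) (by fun_prop)
    fun x => sub_nonneg.2 (hfg x)
  rw [cfc_sub g f a hg.continuousOn hf.continuousOn] at h1
  simpa using h1

/-- The bounded truncation `a / (1 + δ² a²)` of a self-adjoint element. -/
noncomputable def truncation (δ : ℝ) (a : A) : A := cfc (fun x : ℝ => x / (1 + δ ^ 2 * x ^ 2)) a

theorem continuous_truncation_fun (δ : ℝ) : Continuous fun x : ℝ => x / (1 + δ ^ 2 * x ^ 2) :=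
  continuous_id.div (by fun_prop) fun x => by positivity

theorem isSelfAdjoint_truncation (δ : ℝ) (a : A) : IsSelfAdjoint (truncation δ a) :=
  IsSelfAdjoint.cfc

theorem norm_truncation_le {δ : ℝ} (hδ : 0 < δ) (a : A) : ‖truncation δ a‖ ≤ 1 / δ := by
  refine norm_cfc_le (by positivity) fun x _ => ?_
  rw [Real.norm_eq_abs, abs_div, abs_of_pos (by positivity : 0 < 1 + δ ^ 2 * x ^ 2),
    div_le_div_iff₀ (by positivity) hδ]
  nlinarith [sq_nonneg (δ * |x| - 1), sq_abs x, abs_nonneg x, mul_nonneg hδ.le (abs_nonneg x)]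

theorem IsState.truncation_sq_le (h : IsState ω) (δ : ℝ) {a : A} (ha : IsSelfAdjoint a) :
    (ω (truncation δ a * truncation δ a)).re ≤ (ω (a * a)).re := by
  have hc := continuous_truncation_fun δ
  have h1 : a * a = cfc (fun x : ℝ => x * x) a := by
    rw [cfc_mul (fun x : ℝ => x) (fun x => x) a, cfc_id' ℝ a]
  rw [h1, truncation, ← cfc_mul _ _ a hc.continuousOn hc.continuousOn]
  refine h.cfc_mono (hc.mul hc) (by fun_prop) fun x => ?_
  rw [← sq, ← sq, div_pow]
  exact div_le_self (sq_nonneg _) (one_le_pow₀ (by nlinarith [sq_nonneg (δ * x)]))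

/-- From the scalar inequality `|x - x / (1 + δ² x²)| ≤ δ x²`. Truncation gives bounded sequences,
for which weak limits exist, at a cost controlled by second moments alone. -/
theorem IsState.abs_sub_truncation_le (h : IsState ω) {δ : ℝ} (hδ : 0 < δ) {a : A}
    (ha : IsSelfAdjoint a) : ‖ω a - ω (truncation δ a)‖ ≤ δ * (ω (a * a)).re := by
  have hc := continuous_truncation_fun δ
  have h1 : a * a = cfc (fun x : ℝ => x * x) a := by
    rw [cfc_mul (fun x : ℝ => x) (fun x => x) a, cfc_id' ℝ a]
  have h3 : (δ : ℂ) • (a * a) = cfc (fun x : ℝ => δ * (x * x)) a := by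
    rw [h1, cfc_const_mul δ (fun x : ℝ => x * x) a, Complex.coe_smul]
  have h2 : a - truncation δ a = cfc (fun x : ℝ => x - x / (1 + δ ^ 2 * x ^ 2)) a := by
    rw [cfc_sub (fun x : ℝ => x) _ a (by fun_prop) hc.continuousOn, cfc_id' ℝ a, truncation]
  have key : ∀ x : ℝ, |x - x / (1 + δ ^ 2 * x ^ 2)| ≤ δ * (x * x) := fun x => by
    have hp : 0 < 1 + δ ^ 2 * x ^ 2 := by positivity
    have he : x - x / (1 + δ ^ 2 * x ^ 2) = δ ^ 2 * x ^ 2 * x / (1 + δ ^ 2 * x ^ 2) := by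
      field_simp; ring
    rw [he, abs_div, abs_of_pos hp, div_le_iff₀ hp, abs_mul, abs_of_nonneg (by positivity)]
    have hx := sq_abs x
    have h5 : 0 ≤ |x| := abs_nonneg x
    have h6 : δ * |x| ≤ 1 + δ ^ 2 * |x| ^ 2 := by nlinarith [sq_nonneg (δ * |x| - 1)]
    calc δ ^ 2 * x ^ 2 * |x| = δ * (x * x) * (δ * |x|) := by ring
      _ ≤ δ * (x * x) * (1 + δ ^ 2 * |x| ^ 2) :=
          mul_le_mul_of_nonneg_left h6 (mul_nonneg hδ.le (mul_self_nonneg x))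
      _ = _ := by rw [hx]
  have hsa : IsSelfAdjoint (a - truncation δ a) := ha.sub (isSelfAdjoint_truncation δ a)
  rw [← map_sub, ← h.ofReal_re hsa, Complex.norm_real, Real.norm_eq_abs]
  have h4 : δ * (ω (a * a)).re = (ω (cfc (fun x : ℝ => δ * (x * x)) a)).re := by
    rw [← h3]; simp
  have h5 : -(δ * (ω (a * a)).re) = (ω (cfc (fun x : ℝ => -(δ * (x * x))) a)).re := by
    rw [h4, cfc_neg]; simp
  have hcc : Continuous fun x : ℝ => x - x / (1 + δ ^ 2 * x ^ 2) := continuous_id.sub hc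
  rw [abs_le, h5, h4, h2]
  exact ⟨h.cfc_mono (by fun_prop) hcc fun x => (abs_le.1 (key x)).1,
    h.cfc_mono hcc (by fun_prop) fun x => (abs_le.1 (key x)).2⟩

/-- Truncation leaves `S` but not its norm closure, to which identities coming from freeness extend
by continuity of states. -/
theorem truncation_mem_closure (δ : ℝ) {a : A} (ha : IsSelfAdjoint a) {S : Subalgebra ℂ A}
    (haS : a ∈ S) : truncation δ a ∈ closure (S : Set A) := by
  have h1 := cfc_mem_elemental (fun x : ℝ => x / (1 + δ ^ 2 * x ^ 2)) a
  have h2 : ((StarAlgebra.adjoin ℝ {a} : StarSubalgebra ℝ A) : Set A) ⊆ S := by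
    intro z hz
    have hz' : z ∈ (StarAlgebra.adjoin ℝ {a} : StarSubalgebra ℝ A).toSubalgebra := hz
    rw [StarAlgebra.adjoin_toSubalgebra, Set.star_singleton, ha.star_eq, Set.union_self] at hz'
    have h3 : Algebra.adjoin ℝ {a} ≤ S.restrictScalars ℝ :=
      Algebra.adjoin_le (by simpa using haS)
    exact h3 hz'
  exact closure_mono h2 h1

end States

/-! ### Consequences of two-state freeness for two subalgebras -/

section TwoStateFreeness

variable {A : Type*} [Ring A] [Algebra ℂ A] {φ ψ : A →ₗ[ℂ] ℂ} {ι : Type*}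
  {S : ι → Subalgebra ℂ A} {i j : ι} {a a' b b' : A}

theorem IsTwoStateFree.map_mul_of_centered (h : IsTwoStateFree φ ψ S) (hij : i ≠ j) (ha : a ∈ S i)
    (hb : b ∈ S j) (ha0 : ψ a = 0) (hb0 : ψ b = 0) :
    ψ (a * b) = 0 ∧ φ (a * b) = φ a * φ b := by
  have := h [(i, a), (j, b)] (by simp) (by simpa using hij) (by simp [ha, hb, ha0, hb0])
  simpa using this

theorem IsTwoStateFree.map_mul_mul_of_centered (h : IsTwoStateFree φ ψ S) (hij : i ≠ j)
    (ha : a ∈ S i) (hb : b ∈ S j) (ha' : a' ∈ S i) (ha0 : ψ a = 0) (hb0 : ψ b = 0)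
    (ha0' : ψ a' = 0) :
    ψ (a * b * a') = 0 ∧ φ (a * b * a') = φ a * φ b * φ a' := by
  have := h [(i, a), (j, b), (i, a')] (by simp) (by simpa using ⟨hij, hij.symm⟩)
    (by simp [ha, hb, ha0, hb0, ha', ha0'])
  simpa [mul_assoc] using this

theorem sub_smul_one_mem {T : Subalgebra ℂ A} (ha : a ∈ T) (z : ℂ) : a - z • (1 : A) ∈ T :=
  sub_mem ha (T.smul_mem (one_mem _) z)

theorem map_sub_smul_one {ω : A →ₗ[ℂ] ℂ} (h1 : ω 1 = 1) (a : A) : ω (a - ω a • (1 : A)) = 0 := by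
  simp [h1]

theorem IsTwoStateFree.snd_mul (h : IsTwoStateFree φ ψ S) (h1 : ψ 1 = 1) (hij : i ≠ j)
    (ha : a ∈ S i) (hb : b ∈ S j) : ψ (a * b) = ψ a * ψ b := by
  have := (h.map_mul_of_centered hij (sub_smul_one_mem ha (ψ a)) (sub_smul_one_mem hb (ψ b))
    (map_sub_smul_one h1 a) (map_sub_smul_one h1 b)).1
  simp only [sub_mul, mul_sub, map_sub, smul_mul_assoc, mul_smul_comm, one_mul, mul_one, map_smul,
    smul_eq_mul, h1] at this
  linear_combination this

theorem IsTwoStateFree.fst_mul (h : IsTwoStateFree φ ψ S) (h1 : ψ 1 = 1) (h1' : φ 1 = 1)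
    (hij : i ≠ j) (ha : a ∈ S i) (hb : b ∈ S j) : φ (a * b) = φ a * φ b := by
  have := (h.map_mul_of_centered hij (sub_smul_one_mem ha (ψ a)) (sub_smul_one_mem hb (ψ b))
    (map_sub_smul_one h1 a) (map_sub_smul_one h1 b)).2
  simp only [sub_mul, mul_sub, map_sub, smul_mul_assoc, mul_smul_comm, one_mul, mul_one, map_smul,
    smul_eq_mul, h1'] at this
  linear_combination this

theorem IsTwoStateFree.snd_mul_mul (h : IsTwoStateFree φ ψ S) (h1 : ψ 1 = 1) (hij : i ≠ j)
    (ha : a ∈ S i) (hb : b ∈ S j) (ha' : a' ∈ S i) : ψ (a * b * a') = ψ (a * a') * ψ b := by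
  have hb' := sub_smul_one_mem hb (ψ b)
  have h0 := (h.map_mul_mul_of_centered hij (sub_smul_one_mem ha (ψ a)) hb'
    (sub_smul_one_mem ha' (ψ a')) (map_sub_smul_one h1 a) (map_sub_smul_one h1 b)
    (map_sub_smul_one h1 a')).1
  have h2 := h.snd_mul h1 hij ha hb'
  have h3 := h.snd_mul h1 hij.symm hb' ha'
  rw [map_sub_smul_one h1] at h2 h3
  have h4 : ψ (a * (b - ψ b • (1 : A)) * a') = 0 := by
    have e : a * (b - ψ b • (1 : A)) * a' =
        (a - ψ a • (1 : A)) * (b - ψ b • (1 : A)) * (a' - ψ a' • (1 : A)) +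
          ψ a • ((b - ψ b • (1 : A)) * a') + ψ a' • (a * (b - ψ b • (1 : A))) -
          (ψ a * ψ a') • (b - ψ b • (1 : A)) := by
      generalize b - ψ b • (1 : A) = c
      simp only [sub_mul, mul_sub, smul_mul_assoc, mul_smul_comm, one_mul, mul_one, mul_smul]
      module
    rw [e, map_sub, map_add, map_add, h0, map_smul, map_smul, map_smul, h2, h3,
      map_sub_smul_one h1]
    simp
  rw [mul_sub, sub_mul, map_sub, mul_smul_comm, mul_one, smul_mul_assoc, map_smul, smul_eq_mul,
    sub_eq_zero] at h4
  rw [h4, mul_comm]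

/-- In the centered word `b (a - ψ a) b` the factor `φ b = 0` appears, so only the `ψ a` term
survives. Sandwiching by `b` thus replaces `φ` by `ψ`; the nonexistence proof rests on this
mechanism. -/
theorem IsTwoStateFree.fst_mul_mul_self (h : IsTwoStateFree φ ψ S) (h1 : ψ 1 = 1) (hij : i ≠ j)
    (ha : a ∈ S i) (hb : b ∈ S j) (hb0 : ψ b = 0) (hb1 : φ b = 0) :
    φ (b * a * b) = φ (b * b) * ψ a := by
  have h0 := (h.map_mul_mul_of_centered hij.symm hb (sub_smul_one_mem ha (ψ a)) hb hb0
    (map_sub_smul_one h1 a) hb0).2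
  rw [hb1, mul_zero, mul_sub, sub_mul, map_sub, mul_smul_comm, mul_one, smul_mul_assoc, map_smul,
    smul_eq_mul, sub_eq_zero] at h0
  rw [h0, mul_comm]

/-- The linear span of the nonempty alternating `ψ`-centered words whose first letter is from
`S i`. -/
def alternatingSpan (ψ : A →ₗ[ℂ] ℂ) (S : ι → Subalgebra ℂ A) (i : ι) : Submodule ℂ A :=
  Submodule.span ℂ {z | ∃ (a : A) (w : List (ι × A)),
    ((i, a) :: w).IsChain (fun p q => p.1 ≠ q.1) ∧
    (∀ p ∈ (i, a) :: w, p.2 ∈ S p.1 ∧ ψ p.2 = 0) ∧ z = (((i, a) :: w).map Prod.snd).prod}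

theorem mem_alternatingSpan (ha : a ∈ S i) (h0 : ψ a = 0) : a ∈ alternatingSpan ψ S i :=
  Submodule.subset_span ⟨a, [], by simp, by simp [ha, h0], by simp⟩

theorem mul_mem_alternatingSpan (hij : i ≠ j) (ha : a ∈ S i) (h0 : ψ a = 0)
    (hb : b ∈ alternatingSpan ψ S j) : a * b ∈ alternatingSpan ψ S i := by
  have : alternatingSpan ψ S j ≤ (alternatingSpan ψ S i).comap (LinearMap.mulLeft ℂ a) := by
    refine Submodule.span_le.2 ?_
    rintro _ ⟨c, w, hw, hc, rfl⟩
    refine Submodule.subset_span ⟨a, (j, c) :: w, ?_, ?_, by simp⟩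
    · exact List.isChain_cons_cons.2 ⟨hij, hw⟩
    · intro p hp
      rcases List.mem_cons.1 hp with rfl | hp
      · exact ⟨ha, h0⟩
      · exact hc p hp
  exact this hb

theorem IsTwoStateFree.snd_alternatingSpan (h : IsTwoStateFree φ ψ S)
    (ha : a ∈ alternatingSpan ψ S i) : ψ a = 0 := by
  have : alternatingSpan ψ S i ≤ LinearMap.ker ψ := by
    refine Submodule.span_le.2 ?_
    rintro _ ⟨c, w, hw, hc, rfl⟩
    exact (h _ (by simp) hw hc).1
  exact this ha

open PowerSeries in
theorem coeff_mul_mem_alternatingSpan (hij : i ≠ j) {P Q : PowerSeries A} {n : ℕ}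
    (hP0 : coeff 0 P = 0) (hP : ∀ p, coeff p P ∈ S i ∧ ψ (coeff p P) = 0)
    (hQ : ∀ q < n, coeff q Q ∈ alternatingSpan ψ S j ⊔ Submodule.span ℂ {1}) :
    coeff n (P * Q) ∈ alternatingSpan ψ S i := by
  rw [coeff_mul]
  refine Submodule.sum_mem _ fun x hx => ?_
  rw [Finset.HasAntidiagonal.mem_antidiagonal] at hx
  by_cases h0 : x.1 = 0
  · rw [h0, hP0, zero_mul]
    exact Submodule.zero_mem _
  · obtain ⟨e, he, f, hf, hef⟩ := Submodule.mem_sup.1 (hQ x.2 (by omega))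
    obtain ⟨z, rfl⟩ := Submodule.mem_span_singleton.1 hf
    rw [← hef, mul_add, mul_smul_comm, mul_one]
    exact Submodule.add_mem _ (mul_mem_alternatingSpan hij (hP _).1 (hP _).2 he)
      (Submodule.smul_mem _ _ (mem_alternatingSpan (hP _).1 (hP _).2))

open PowerSeries in
/-- If `V₁`, `V₂` are power series with constant coefficient `1` and other coefficients `ψ`-centered
in `S i`, `S j` respectively, then so is the inverse of `V₁⁻¹ + V₂⁻¹ - 1`. -/
theorem IsTwoStateFree.snd_coeff_inv (h : IsTwoStateFree φ ψ S) (hij : i ≠ j)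
    {V₁ V₂ D₁ D₂ V : PowerSeries A} (h₁ : V₁ * D₁ = 1) (h₂ : V₂ * D₂ = 1) (h₂' : D₂ * V₂ = 1)
    (hc₁ : coeff 0 V₁ = 1) (hc₂ : coeff 0 V₂ = 1)
    (hV₁ : ∀ n, n ≠ 0 → coeff n V₁ ∈ S i ∧ ψ (coeff n V₁) = 0)
    (hV₂ : ∀ n, n ≠ 0 → coeff n V₂ ∈ S j ∧ ψ (coeff n V₂) = 0)
    (hV : (D₁ + D₂ - 1) * V = 1) {n : ℕ} (hn : n ≠ 0) :
    ψ (coeff n V) = 0 := by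
  obtain ⟨R, rfl⟩ : ∃ R, V = V₂ * R := ⟨D₂ * V, by rw [← mul_assoc, h₂, one_mul]⟩
  have key : ∀ {W : PowerSeries A} {k : ι}, coeff 0 W = 1 →
      (∀ n, n ≠ 0 → coeff n W ∈ S k ∧ ψ (coeff n W) = 0) →
      coeff 0 (W - 1) = 0 ∧ ∀ p, coeff p (W - 1) ∈ S k ∧ ψ (coeff p (W - 1)) = 0 := by
    intro W k h0 hW
    have h0' : coeff 0 (W - 1) = 0 := by rw [map_sub, h0]; simp
    refine ⟨h0', fun p => ?_⟩
    by_cases hp : p = 0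
    · rw [hp, h0']
      exact ⟨zero_mem _, map_zero _⟩
    · rw [map_sub, coeff_one, if_neg hp, sub_zero]
      exact hW p hp
  obtain ⟨hb0, hb⟩ := key hc₁ hV₁
  obtain ⟨ha0, ha⟩ := key hc₂ hV₂
  -- With `b = V₁ - 1` and `a = V₂ - 1` this says `V = (1 + a) (1 - b a)⁻¹ (1 + b)`, whose expansion
  -- consists of alternating centered words and the constant `1`. The fixed-point form allows
  -- induction on the coefficients, as `a` and `b` have no constant term.
  have hR : R = V₁ + (V₁ - 1) * ((V₂ - 1) * R) := by
    have e : V₁ * ((D₁ + D₂ - 1) * (V₂ * R)) = V₁ := by rw [hV, mul_one]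
    have e1 : V₁ * ((D₁ + D₂ - 1) * (V₂ * R)) =
        V₁ * D₁ * V₂ * R + V₁ * (D₂ * V₂) * R - V₁ * V₂ * R := by noncomm_ring
    rw [e1, h₁, h₂'] at e
    have e2 : V₁ + (V₁ - 1) * ((V₂ - 1) * R) =
        V₁ - (1 * V₂ * R + V₁ * 1 * R - V₁ * V₂ * R) + R := by noncomm_ring
    rw [e2, e, sub_self, zero_add]
  have hRn : ∀ n, (n ≠ 0 → coeff n R ∈ alternatingSpan ψ S i) ∧
      coeff n R ∈ alternatingSpan ψ S i ⊔ Submodule.span ℂ {1} := by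
    intro n
    induction n using Nat.strong_induction_on with
    | _ n ih =>
      have h3 : ∀ q < n + 1, coeff q ((V₂ - 1) * R) ∈ alternatingSpan ψ S j := fun q hq =>
        coeff_mul_mem_alternatingSpan hij.symm ha0 ha fun q' hq' => (ih q' (by omega)).2
      have h4 : coeff n ((V₁ - 1) * ((V₂ - 1) * R)) ∈ alternatingSpan ψ S i :=
        coeff_mul_mem_alternatingSpan hij hb0 hb fun q hq =>
          Submodule.mem_sup_left (h3 q (by omega))
      by_cases hn : n = 0
      · refine ⟨fun h => absurd hn h, ?_⟩
        rw [hR, map_add]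
        refine Submodule.add_mem _ (Submodule.mem_sup_right ?_) (Submodule.mem_sup_left h4)
        rw [hn, hc₁]
        exact Submodule.mem_span_singleton_self _
      · have : coeff n R ∈ alternatingSpan ψ S i := by
          rw [hR, map_add]
          exact Submodule.add_mem _ (mem_alternatingSpan (hV₁ n hn).1 (hV₁ n hn).2) h4
        exact ⟨fun _ => this, Submodule.mem_sup_left this⟩
  have e : V₂ * R = R + (V₂ - 1) * R := by noncomm_ring
  rw [e, map_add, map_add, h.snd_alternatingSpan ((hRn n).1 hn), zero_add]
  exact h.snd_alternatingSpan
    (coeff_mul_mem_alternatingSpan hij.symm ha0 ha fun q _ => (hRn q).2)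

end TwoStateFreeness

/-! ### Weak limits of bounded sequences -/

section WeakLimits

open Filter Topology

variable {A : Type*} [CStarAlgebra A] {φ ψ : A →ₗ[ℂ] ℂ}

/-- Every bounded sequence in `A` has weak limits along ultrafilters, in the sense tested by the
functionals `φ (c · d)` and `ψ`. -/
def HasWeakLimits (φ ψ : A →ₗ[ℂ] ℂ) : Prop :=
  ∀ (h : ℕ → A) (K : ℝ), (∀ n, ‖h n‖ ≤ K) → ∀ U : Ultrafilter ℕ, ∃ k : A,
    (∀ c d, Tendsto (fun n => φ (c * h n * d)) U (𝓝 (φ (c * k * d)))) ∧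
      Tendsto (fun n => ψ (h n)) U (𝓝 (ψ k))

theorem IsFaithfulFunctional.eq_zero_of_forall_mul (hf : IsFaithfulFunctional φ) {k : A}
    (h : ∀ d, φ (k * d) = 0) : k = 0 := by
  have := hf (star k) (by simpa using h (star k))
  simpa using this

theorem tendsto_fst_mul_of_tendsto_sq (hφ : IsState φ) {h : ℕ → A} {U : Filter ℕ} (c d : A)
    (h0 : Tendsto (fun n => (φ (c * h n * star (c * h n))).re) U (𝓝 0)) :
    Tendsto (fun n => φ (c * h n * d)) U (𝓝 0) := by
  have h1 : Tendsto (fun n => √((φ (c * h n * star (c * h n))).re * (φ (star d * d)).re)) U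
      (𝓝 0) := by
    simpa using (h0.mul_const (φ (star d * d)).re).sqrt
  refine squeeze_zero_norm (fun n => ?_) h1
  refine Real.le_sqrt_of_sq_le ?_
  simpa using hφ.norm_sq_le (star (c * h n)) d

/-- Cauchy-Schwarz gives `φ (k * d) = 0` for every weak limit `k` and every `d`, so `k = 0` by
faithfulness. In effect `ψ` is absolutely continuous with respect to `φ`. -/
theorem HasWeakLimits.tendsto_snd (hw : HasWeakLimits φ ψ) (hφ : IsState φ)
    (hf : IsFaithfulFunctional φ) {h : ℕ → A} {K : ℝ} (hsa : ∀ n, IsSelfAdjoint (h n))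
    (hK : ∀ n, ‖h n‖ ≤ K) (h0 : Tendsto (fun n => (φ (h n * h n)).re) atTop (𝓝 0)) :
    Tendsto (fun n => ψ (h n)) atTop (𝓝 0) := by
  rw [tendsto_iff_ultrafilter]
  intro U hU
  obtain ⟨k, hk, hk'⟩ := hw h K hK U
  have : k = 0 := hf.eq_zero_of_forall_mul fun d => by
    have h1 := hk 1 d
    rw [one_mul] at h1
    refine tendsto_nhds_unique h1 (tendsto_fst_mul_of_tendsto_sq hφ 1 d ?_)
    simpa [(hsa _).star_eq] using h0.mono_left hU
  rwa [this, map_zero] at hk'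

/-- `φ (aₙ²) → 0` and `ψ (aₙ²) = O(1)` imply `ψ (aₙ) → 0`. -/
theorem HasWeakLimits.tendsto_snd_of_sq_le (hw : HasWeakLimits φ ψ) (hφ : IsState φ)
    (hf : IsFaithfulFunctional φ) (hψ : IsState ψ) {a : ℕ → A} {C : ℝ}
    (hsa : ∀ n, IsSelfAdjoint (a n)) (hC : ∀ n, (ψ (a n * a n)).re ≤ C)
    (h0 : Tendsto (fun n => (φ (a n * a n)).re) atTop (𝓝 0)) :
    Tendsto (fun n => ψ (a n)) atTop (𝓝 0) := by
  have hC0 : 0 ≤ C := (hψ.re_mul_self_nonneg (hsa 0)).trans (hC 0)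
  rw [Metric.tendsto_atTop]
  intro ε hε
  -- The truncation error under `ψ` is at most `δ * C` uniformly in `n`; for fixed `δ` the truncated
  -- sequence is bounded.
  obtain ⟨δ, hδ, hδC⟩ : ∃ δ : ℝ, 0 < δ ∧ δ * C ≤ ε / 2 :=
    ⟨ε / (2 * (C + 1)), by positivity, by
      rw [div_mul_eq_mul_div, div_le_div_iff₀ (by positivity) (by positivity)]; nlinarith⟩
  have h1 := hw.tendsto_snd hφ hf (fun n => isSelfAdjoint_truncation δ (a n))
    (fun n => norm_truncation_le hδ (a n))
    (squeeze_zero (fun n => hφ.re_mul_self_nonneg (isSelfAdjoint_truncation δ (a n)))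
      (fun n => hφ.truncation_sq_le δ (hsa n)) h0)
  obtain ⟨N, hN⟩ := Metric.tendsto_atTop.1 h1 (ε / 2) (by positivity)
  refine ⟨N, fun n hn => ?_⟩
  have h2 := hN n hn
  have h3 := hψ.abs_sub_truncation_le hδ (hsa n)
  have h4 : δ * (ψ (a n * a n)).re ≤ δ * C := mul_le_mul_of_nonneg_left (hC n) hδ.le
  rw [dist_zero_right] at h2 ⊢
  calc ‖ψ (a n)‖ = ‖ψ (a n) - ψ (truncation δ (a n)) + ψ (truncation δ (a n))‖ := by simp
    _ ≤ _ + _ := norm_add_le _ _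
    _ < ε := by linarith

end WeakLimits

/-! ### Moments of the increments of a two-state free Brownian motion -/

section IncrementMoments

open Filter Topology Asymptotics

section Algebraic

variable {A : Type*} [Ring A] [Algebra ℂ A] {φ ψ : A →ₗ[ℂ] ℂ} {T α : ℝ} {X : ℝ → A}

theorem HasParameter.snd_apply (hp : HasParameter ψ T X α) {t : ℝ} (h0 : 0 ≤ t) (h1 : t ≤ T) :
    ψ (X t) = ((α * t : ℝ) : ℂ) := by
  have := hp t h0 h1
  rwa [freeCumulant, freeCumulantSeq_one, pow_one] at this

theorem map_sum_mul_self (ω : A →ₗ[ℂ] ℂ) (d : ℕ → A) (N : ℕ) {p q : ℂ}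
    (hd : ∀ i < N, ω (d i * d i) = q) (ho : ∀ i < N, ∀ j < N, i ≠ j → ω (d i * d j) = p) :
    ω ((∑ i ∈ Finset.range N, d i) * ∑ i ∈ Finset.range N, d i) = N * q + N * (N - 1) * p := by
  have h1 : ∀ i ∈ Finset.range N, ∑ j ∈ Finset.range N, ω (d i * d j) = q + (N - 1) * p := by
    intro i hi
    rw [← Finset.add_sum_erase _ _ hi, hd i (Finset.mem_range.1 hi),
      Finset.sum_congr rfl fun j hj => ho i (Finset.mem_range.1 hi) j
        (Finset.mem_range.1 (Finset.mem_of_mem_erase hj)) (Finset.ne_of_mem_erase hj).symm,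
      Finset.sum_const, Finset.card_erase_of_mem hi, Finset.card_range, nsmul_eq_mul,
      Nat.cast_sub (by have := Finset.mem_range.1 hi; omega)]
    simp
  rw [Finset.sum_mul_sum, map_sum, Finset.sum_congr rfl fun i hi => (map_sum ω _ _).trans (h1 i hi)]
  rw [Finset.sum_const, Finset.card_range, nsmul_eq_mul]
  ring

variable [StarRing A]

theorem isSelfAdjoint_ofReal_smul [StarModule ℂ A] {a : A} (ha : IsSelfAdjoint a) (r : ℝ) :
    IsSelfAdjoint ((r : ℂ) • a) := by
  rw [isSelfAdjoint_iff, star_smul, ha.star_eq, Complex.star_def, Complex.conj_ofReal]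

theorem HasTwoStateFreeIncrements.free_pair (h : HasTwoStateFreeIncrements φ ψ T X)
    {s t s' t' : ℝ} (hs : 0 ≤ s) (hst : s ≤ t) (hts' : t ≤ s') (hst' : s' ≤ t') (ht' : t' ≤ T) :
    IsTwoStateFree φ ψ (fun j : Fin 2 => Algebra.adjoin ℂ {X (![t, t'] j) - X (![s, s'] j)}) := by
  refine h.free 2 ![s, s'] ![t, t'] ?_ ?_
  · intro j
    fin_cases j
    · exact ⟨hs, hst, hts'.trans (hst'.trans ht')⟩
    · exact ⟨hs.trans (hst.trans hts'), hst', ht'⟩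
  · have : Disjoint (Set.Ico s t) (Set.Ico s' t') := by
      rw [Set.Ico_disjoint_Ico]
      exact (min_le_left _ _).trans (hts'.trans (le_max_right _ _))
    intro i j hij
    fin_cases i <;> fin_cases j
    · exact absurd rfl hij
    · exact this
    · exact this.symm
    · exact absurd rfl hij

theorem IsTwoStateFreeBrownianMotion.fst_pow_add_two (h : IsTwoStateFreeBrownianMotion φ ψ T X)
    (hφ : φ 1 = 1) (hψ : ψ 1 = 1) {t : ℝ} (h0 : 0 ≤ t) (h1 : t ≤ T) (n : ℕ) :
    φ (X t ^ (n + 2)) =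
      (t : ℂ) * ∑ j ∈ Finset.range (n + 1), ψ (X t ^ j) * φ (X t ^ (n - j)) := by
  have hn := h.normal 0 t le_rfl h0 h1
  have hv := h.variance 0 t le_rfl h0 h1
  rw [h.start, sub_zero] at hn hv
  rw [sub_zero] at hv
  have := moment_add_two_of_twoStateFreeCumulantSeq_eq_zero (m := fun k => φ (X t ^ k))
    (m' := fun k => ψ (X t ^ k)) (by simpa using hφ) (by simpa using hψ)
    (by simpa using h.centered t h0 h1) hn n
  simpa only [hv] using this

/-- The second moment of `X (s + r)` for `ψ`. -/
theorem HasTwoStateFreeIncrements.snd_sq_add (h : HasTwoStateFreeIncrements φ ψ T X)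
    (hp : HasParameter ψ T X α) (hψ : ψ 1 = 1) {s r : ℝ} (hs : 0 ≤ s) (hr : 0 ≤ r)
    (hsr : s + r ≤ T) :
    ψ (X (s + r) ^ 2) = ψ (X s ^ 2) + ψ (X r ^ 2) + 2 * (α * s) * (α * r) := by
  have hf := h.free_pair le_rfl hs le_rfl (le_add_of_nonneg_right hr) hsr
  have hx : X s ∈ Algebra.adjoin ℂ {X s - X 0} := by
    rw [h.start, sub_zero]; exact Algebra.self_mem_adjoin_singleton ℂ _
  have hy : X (s + r) - X s ∈ Algebra.adjoin ℂ {X (s + r) - X s} :=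
    Algebra.self_mem_adjoin_singleton ℂ _
  have h1 := hf.snd_mul hψ (i := 0) (j := 1) (by decide) hx hy
  have h2 := hf.snd_mul hψ (i := 1) (j := 0) (by decide) hy hx
  have h3 := h.stationary_snd s (s + r) hs (le_add_of_nonneg_right hr) hsr 2
  have h4 := h.stationary_snd s (s + r) hs (le_add_of_nonneg_right hr) hsr 1
  rw [add_sub_cancel_left] at h3 h4
  rw [pow_one, pow_one, hp.snd_apply hr (by linarith)] at h4
  rw [h4, hp.snd_apply hs (by linarith)] at h1 h2
  have e : X (s + r) ^ 2 = X s ^ 2 + X s * (X (s + r) - X s) + (X (s + r) - X s) * X s +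
      (X (s + r) - X s) ^ 2 := by noncomm_ring
  rw [e, map_add, map_add, map_add, h1, h2, h3]
  push_cast
  ring

/-- The `ψ`-variance is additive over free increments. Hence `ψ (X (t / N) ^ 2) = O(1 / N)` without
any continuity assumption on the process. -/
theorem HasTwoStateFreeIncrements.snd_sq_nsmul (h : HasTwoStateFreeIncrements φ ψ T X)
    (hp : HasParameter ψ T X α) (hψ : ψ 1 = 1) {r : ℝ} (hr : 0 ≤ r) (k : ℕ) (hk : k * r ≤ T) :
    ψ (X (k * r) ^ 2) - (α * (k * r)) ^ 2 = k * (ψ (X r ^ 2) - (α * r) ^ 2) := by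
  induction k with
  | zero => simp [h.start]
  | succ k ih =>
    have hk' : k * r + r ≤ T := by push_cast at hk; linarith
    have h1 := h.snd_sq_add hp hψ (by positivity) hr hk'
    have h2 := ih (by linarith)
    have e : ((k + 1 : ℕ) : ℝ) * r = k * r + r := by push_cast; ring
    rw [e, h1]
    push_cast at h2 ⊢
    linear_combination h2

end Algebraic

variable {A : Type*} [CStarAlgebra A] {φ ψ : A →ₗ[ℂ] ℂ} {T α : ℝ} {X : ℝ → A}

/-- `X u` acts on polynomials in `X u` as an element whose norm is bounded uniformly in `u`. -/
theorem HasTwoStateFreeIncrements.abs_conjugate_le (h : HasTwoStateFreeIncrements φ ψ T X)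
    (hp : HasParameter ψ T X α) (hψ : IsState ψ) {u t : ℝ} (hu : 0 ≤ u) (hut : u ≤ t)
    (ht : t ≤ T) {q : A} (hq : q ∈ Algebra.adjoin ℂ {X u}) (hsa : IsSelfAdjoint q) :
    |(ψ (q * X u * q)).re| ≤ (‖X t‖ + |α| * t * ‖(1 : A)‖) * (ψ (q * q)).re := by
  -- The increment `X t - X u` is free from `q`, so between two copies of `q` it may be replaced by
  -- its mean: `y` acts like `X u` under `ψ`. Unlike `‖X u‖`, the norm of `y` is visibly bounded
  -- uniformly in `u`.
  set y := X t - ((α * (t - u) : ℝ) : ℂ) • (1 : A) with hy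
  have hysa : IsSelfAdjoint y :=
    (h.selfAdjoint t (hu.trans hut) ht).sub (isSelfAdjoint_ofReal_smul (.one A) _)
  have hyn : ‖y‖ ≤ ‖X t‖ + |α| * t * ‖(1 : A)‖ := by
    refine (norm_sub_le _ _).trans ?_
    rw [norm_smul, Complex.norm_real, Real.norm_eq_abs, abs_mul, abs_of_nonneg (by linarith : 0 ≤ t - u)]
    gcongr
    linarith
  have hf := h.free_pair le_rfl hu le_rfl hut ht
  have hq' : q ∈ Algebra.adjoin ℂ {X u - X 0} := by rwa [h.start, sub_zero]
  have h1 := hf.snd_mul_mul hψ.1 (i := 0) (j := 1) (by decide) hq'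
    (Algebra.self_mem_adjoin_singleton ℂ (X t - X u)) hq'
  have h2 : ψ (q * y * q) = ψ (q * X u * q) := by
    have e : q * y * q = q * X u * q + q * (X t - X u) * q -
        ((α * (t - u) : ℝ) : ℂ) • (q * q) := by
      rw [hy]
      simp only [mul_sub, sub_mul, mul_smul_comm, mul_one, smul_mul_assoc]
      abel
    rw [e, map_sub, map_add, h1, map_sub, hp.snd_apply (hu.trans hut) ht,
      hp.snd_apply hu (hut.trans ht), map_smul, smul_eq_mul]
    push_cast
    ring
  have h3 := hψ.conjugate_le hysa hyn q
  have h4 := hψ.conjugate_le (C := ‖X t‖ + |α| * t * ‖(1 : A)‖) hysa.neg (by rwa [norm_neg]) q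
  rw [hsa.star_eq] at h3 h4
  rw [mul_neg, neg_mul, map_neg, h2, Complex.neg_re] at h4
  rw [h2] at h3
  exact abs_le.2 ⟨by linarith, h3⟩

/-- Multiplication by `X u` is bounded by `C` on polynomials in `X u` with respect to `ψ`, with `C`
independent of `u`. All higher moments of short increments are thereby as small as the second. -/
theorem HasTwoStateFreeIncrements.norm_snd_pow_le (h : HasTwoStateFreeIncrements φ ψ T X)
    (hp : HasParameter ψ T X α) (hψ : IsState ψ) {t : ℝ} (h0 : 0 ≤ t) (ht : t ≤ T) :
    ∃ C : ℝ, 0 < C ∧ ∀ u, 0 ≤ u → u ≤ t → ∀ k : ℕ,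
      ‖ψ (X u ^ (k + 2))‖ ≤ C ^ k * ‖ψ (X u ^ 2)‖ := by
  refine ⟨‖X t‖ + |α| * t * ‖(1 : A)‖ + 1, by positivity, fun u hu hut => ?_⟩
  set C := ‖X t‖ + |α| * t * ‖(1 : A)‖ + 1 with hC
  have hC0 : 0 < C := by positivity
  have hsa : IsSelfAdjoint (X u) := h.selfAdjoint u hu (hut.trans ht)
  have hX := Algebra.self_mem_adjoin_singleton ℂ (X u)
  set m : ℕ → ℝ := fun k => (ψ (X u ^ k)).re with hm
  have hnorm : ∀ k, ‖ψ (X u ^ k)‖ = |m k| := fun k => by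
    rw [← hψ.ofReal_re (hsa.pow k), Complex.norm_real, Real.norm_eq_abs]
  have hpos : ∀ a, 0 ≤ m (2 * a) := fun a => by
    have := hψ.re_mul_self_nonneg (hsa.pow a)
    rwa [← pow_add, ← two_mul] at this
  have key : ∀ q, q ∈ Algebra.adjoin ℂ {X u} → IsSelfAdjoint q →
      |(ψ (q * X u * q)).re| ≤ C * (ψ (q * q)).re := fun q hq hqs => by
    refine (h.abs_conjugate_le hp hψ hu hut ht hq hqs).trans ?_
    exact mul_le_mul_of_nonneg_right (by rw [hC]; linarith) (hψ.re_mul_self_nonneg hqs)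
  have hodd : ∀ a, |m (2 * a + 1)| ≤ C * m (2 * a) := fun a => by
    have := key (X u ^ a) (pow_mem hX a) (hsa.pow a)
    rw [← pow_succ, ← pow_add, ← pow_add, show a + 1 + a = 2 * a + 1 by ring, ← two_mul] at this
    exact this
  -- The form bound for `q = C X^a + X^(a+1)` from above and for `q = C X^a - X^(a+1)` from below
  -- combine so that the odd moments cancel.
  have heven : ∀ a, m (2 * a + 2) ≤ C ^ 2 * m (2 * a) := fun a => by
    have e : ∀ ε : ℝ, ε ^ 2 = 1 → |C ^ 2 * m (2 * a + 1) + 2 * C * ε * m (2 * a + 2) + m (2 * a + 3)|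
        ≤ C * (C ^ 2 * m (2 * a) + 2 * C * ε * m (2 * a + 1) + m (2 * a + 2)) := fun ε hε => by
      have h1 := key ((C : ℂ) • X u ^ a + (ε : ℂ) • X u ^ (a + 1))
        (add_mem (Subalgebra.smul_mem _ (pow_mem hX _) _) (Subalgebra.smul_mem _ (pow_mem hX _) _))
        ((isSelfAdjoint_ofReal_smul (hsa.pow _) C).add (isSelfAdjoint_ofReal_smul (hsa.pow _) ε))
      have hε' : (ε : ℂ) * ε = 1 := by rw [← sq]; exact_mod_cast hε
      have e1 : ((C : ℂ) • X u ^ a + (ε : ℂ) • X u ^ (a + 1)) *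
          ((C : ℂ) • X u ^ a + (ε : ℂ) • X u ^ (a + 1)) = ((C ^ 2 : ℝ) : ℂ) • X u ^ (2 * a) +
          ((2 * C * ε : ℝ) : ℂ) • X u ^ (2 * a + 1) + X u ^ (2 * a + 2) := by
        simp only [add_mul, mul_add, smul_mul_smul_comm, ← pow_add, hε']
        rw [one_smul, show a + 1 + (a + 1) = 2 * a + 2 by ring, show a + 1 + a = 2 * a + 1 by ring,
          show a + (a + 1) = 2 * a + 1 by ring, show a + a = 2 * a by ring]
        push_cast
        module
      have e2 : ((C : ℂ) • X u ^ a + (ε : ℂ) • X u ^ (a + 1)) * X u *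
          ((C : ℂ) • X u ^ a + (ε : ℂ) • X u ^ (a + 1)) = ((C ^ 2 : ℝ) : ℂ) • X u ^ (2 * a + 1) +
          ((2 * C * ε : ℝ) : ℂ) • X u ^ (2 * a + 2) + X u ^ (2 * a + 3) := by
        rw [add_mul, smul_mul_assoc, smul_mul_assoc, ← pow_succ, ← pow_succ]
        simp only [add_mul, mul_add, smul_mul_smul_comm, ← pow_add, hε']
        rw [one_smul, show a + 1 + 1 + (a + 1) = 2 * a + 3 by ring,
          show a + 1 + 1 + a = 2 * a + 2 by ring,
          show a + 1 + (a + 1) = 2 * a + 2 by ring, show a + 1 + a = 2 * a + 1 by ring]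
        push_cast
        module
      rw [e1, e2] at h1
      simpa only [map_add, map_smul, smul_eq_mul, Complex.add_re, Complex.re_ofReal_mul] using h1
    have h1 := (abs_le.1 (e 1 (by norm_num))).2
    have h2 := (abs_le.1 (e (-1) (by norm_num))).1
    have h3 : C * m (2 * a + 2) ≤ C * (C ^ 2 * m (2 * a)) := by nlinarith
    exact le_of_mul_le_mul_left h3 hC0
  have heven' : ∀ a, m (2 * a + 2) ≤ C ^ (2 * a) * m 2 := fun a => by
    induction a with
    | zero => simp
    | succ a ih =>
      calc m (2 * (a + 1) + 2) ≤ C ^ 2 * m (2 * (a + 1)) := heven (a + 1)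
        _ ≤ C ^ 2 * (C ^ (2 * a) * m 2) := mul_le_mul_of_nonneg_left ih (by positivity)
        _ = _ := by ring
  intro k
  rw [hnorm, hnorm, abs_of_nonneg (hpos 1)]
  obtain ⟨a, rfl | rfl⟩ := Nat.even_or_odd' k
  · rw [show 2 * a + 2 = 2 * (a + 1) by ring, abs_of_nonneg (hpos (a + 1))]
    exact heven' a
  · calc |m (2 * a + 1 + 2)| = |m (2 * (a + 1) + 1)| := by ring_nf
      _ ≤ C * m (2 * (a + 1)) := hodd _
      _ ≤ C * (C ^ (2 * a) * m 2) := mul_le_mul_of_nonneg_left (heven' a) hC0.le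
      _ = _ := by ring_nf

end IncrementMoments

/-! ### Asymptotics of the moments of short increments -/

section ShortIncrements

open Filter Topology Asymptotics

variable {A : Type*} [CStarAlgebra A] {φ ψ : A →ₗ[ℂ] ℂ} {T α t : ℝ} {X : ℝ → A}

theorem div_natCast_nonneg (h0 : 0 ≤ t) (N : ℕ) : 0 ≤ t / N := by positivity

theorem div_natCast_le_self (h0 : 0 ≤ t) (N : ℕ) : t / N ≤ t := by
  rcases N.eq_zero_or_pos with rfl | hN
  · simpa using h0
  · exact div_le_self h0 (by exact_mod_cast hN)

theorem isBigO_natCast_inv_one :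
    (fun N : ℕ => (N : ℝ)⁻¹) =O[atTop] (fun _ => (1 : ℝ)) :=
  (tendsto_inv_atTop_nhds_zero_nat (𝕜 := ℝ)).isBigO_one ℝ

theorem HasTwoStateFreeIncrements.snd_sq_div (h : HasTwoStateFreeIncrements φ ψ T X)
    (hp : HasParameter ψ T X α) (hψ : ψ 1 = 1) (h0 : 0 ≤ t) (ht : t ≤ T) {N : ℕ} (hN : N ≠ 0) :
    N * ψ (X (t / N) ^ 2) = ψ (X t ^ 2) - (α * t) ^ 2 + (α * t) ^ 2 / N := by
  have hN' : (N : ℝ) ≠ 0 := by exact_mod_cast hN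
  have hN'' : (N : ℂ) ≠ 0 := by exact_mod_cast hN
  have h1 := h.snd_sq_nsmul hp hψ (div_natCast_nonneg h0 N) N
    (by rwa [mul_div_cancel₀ t hN'])
  rw [mul_div_cancel₀ t hN'] at h1
  push_cast at h1
  field_simp at h1 ⊢
  linear_combination -h1

theorem HasTwoStateFreeIncrements.isBigO_snd (h : HasTwoStateFreeIncrements φ ψ T X)
    (hp : HasParameter ψ T X α) (hψ : IsState ψ) (h0 : 0 ≤ t) (ht : t ≤ T) {k : ℕ} (hk : k ≠ 0) :
    (fun N : ℕ => ψ (X (t / N) ^ k)) =O[atTop] (fun N : ℕ => (N : ℝ)⁻¹) := by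
  have h2 : (fun N : ℕ => ψ (X (t / N) ^ 2)) =O[atTop] (fun N : ℕ => (N : ℝ)⁻¹) := by
    refine IsBigO.of_bound (‖ψ (X t ^ 2) - (α * t) ^ 2‖ + ‖((α * t) ^ 2 : ℂ)‖) ?_
    filter_upwards [eventually_gt_atTop 0] with N hN
    have hN' : (0 : ℝ) < N := by exact_mod_cast hN
    have hN1 : (1 : ℝ) ≤ N := by exact_mod_cast hN
    have e := congrArg norm (h.snd_sq_div hp hψ.1 h0 ht hN.ne')
    rw [norm_mul, Complex.norm_natCast] at e
    rw [norm_inv, Real.norm_natCast, ← div_eq_mul_inv, le_div_iff₀ hN', mul_comm, e]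
    refine (norm_add_le _ _).trans (add_le_add le_rfl ?_)
    rw [norm_div, Complex.norm_natCast]
    exact div_le_self (norm_nonneg _) hN1
  obtain _ | _ | k := k
  · exact absurd rfl hk
  · refine IsBigO.of_bound ‖((α * t : ℝ) : ℂ)‖ (Eventually.of_forall fun N => ?_)
    rw [zero_add, pow_one, hp.snd_apply (div_natCast_nonneg h0 N)
      ((div_natCast_le_self h0 N).trans ht), ← mul_div_assoc, div_eq_mul_inv, Complex.ofReal_mul,
      norm_mul, Complex.norm_real ((N : ℝ)⁻¹)]
  · obtain ⟨C, hC, hb⟩ := h.norm_snd_pow_le hp hψ h0 ht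
    refine IsBigO.trans (IsBigO.of_bound (C ^ k) (Eventually.of_forall fun N => ?_)) h2
    exact hb _ (div_natCast_nonneg h0 N) (div_natCast_le_self h0 N) k

theorem HasTwoStateFreeIncrements.isBigO_snd_one (h : HasTwoStateFreeIncrements φ ψ T X)
    (hp : HasParameter ψ T X α) (hψ : IsState ψ) (h0 : 0 ≤ t) (ht : t ≤ T) (k : ℕ) :
    (fun N : ℕ => ψ (X (t / N) ^ k)) =O[atTop] (fun _ => (1 : ℝ)) := by
  by_cases hk : k = 0
  · simpa [hk] using isBigO_const_const (ψ 1) (one_ne_zero (α := ℝ)) (atTop : Filter ℕ)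
  · exact (h.isBigO_snd hp hψ h0 ht hk).trans isBigO_natCast_inv_one

theorem isBigO_ofReal_div_natCast :
    (fun N : ℕ => ((t / N : ℝ) : ℂ)) =O[atTop] (fun N : ℕ => (N : ℝ)⁻¹) :=
  IsBigO.of_bound ‖t‖ (Eventually.of_forall fun N => by
    rw [Complex.norm_real, div_eq_mul_inv, norm_mul])

theorem IsTwoStateFreeBrownianMotion.isBigO_fst (h : IsTwoStateFreeBrownianMotion φ ψ T X)
    (hp : HasParameter ψ T X α) (hφ : IsState φ) (hψ : IsState ψ) (h0 : 0 ≤ t) (ht : t ≤ T)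
    {k : ℕ} (hk : k ≠ 0) :
    (fun N : ℕ => φ (X (t / N) ^ k)) =O[atTop] (fun N : ℕ => (N : ℝ)⁻¹) := by
  induction k using Nat.strong_induction_on with
  | _ k ih =>
    obtain _ | _ | k := k
    · exact absurd rfl hk
    · have : (fun N : ℕ => φ (X (t / N) ^ (0 + 1))) = fun _ => 0 := by
        funext N
        rw [zero_add, pow_one, h.centered _ (div_natCast_nonneg h0 N)
          ((div_natCast_le_self h0 N).trans ht)]
      rw [this]
      exact isBigO_zero _ _
    · have e : (fun N : ℕ => φ (X (t / N) ^ (k + 2))) = fun N : ℕ => ((t / N : ℝ) : ℂ) *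
          ∑ j ∈ Finset.range (k + 1), ψ (X (t / N) ^ j) * φ (X (t / N) ^ (k - j)) := by
        funext N
        exact h.fst_pow_add_two hφ.1 hψ.1 (div_natCast_nonneg h0 N)
          ((div_natCast_le_self h0 N).trans ht) k
      show (fun N : ℕ => φ (X (t / N) ^ (k + 2))) =O[atTop] _
      rw [e]
      have h1 : (fun N : ℕ => ∑ j ∈ Finset.range (k + 1),
          ψ (X (t / N) ^ j) * φ (X (t / N) ^ (k - j))) =O[atTop] (fun _ => (1 : ℝ)) := by
        refine IsBigO.fun_sum fun j hj => ?_
        have h2 : (fun N : ℕ => φ (X (t / N) ^ (k - j))) =O[atTop] (fun _ => (1 : ℝ)) := by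
          by_cases hkj : k - j = 0
          · simpa [hkj] using isBigO_const_const (φ 1) (one_ne_zero (α := ℝ)) (atTop : Filter ℕ)
          · exact (ih (k - j) (by omega) hkj).trans isBigO_natCast_inv_one
        simpa using (h.isBigO_snd_one hp hψ h0 ht j).mul h2
      simpa using isBigO_ofReal_div_natCast.mul h1

theorem IsTwoStateFreeBrownianMotion.isBigO_fst_one (h : IsTwoStateFreeBrownianMotion φ ψ T X)
    (hp : HasParameter ψ T X α) (hφ : IsState φ) (hψ : IsState ψ) (h0 : 0 ≤ t) (ht : t ≤ T)
    (k : ℕ) : (fun N : ℕ => φ (X (t / N) ^ k)) =O[atTop] (fun _ => (1 : ℝ)) := by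
  by_cases hk : k = 0
  · simpa [hk] using isBigO_const_const (φ 1) (one_ne_zero (α := ℝ)) (atTop : Filter ℕ)
  · exact (h.isBigO_fst hp hφ hψ h0 ht hk).trans isBigO_natCast_inv_one

/-- The recursion has a factor `t / N`, and from order three on each summand contains a `φ`- or
`ψ`-moment of positive order, which supplies the second `1 / N`. -/
theorem IsTwoStateFreeBrownianMotion.isBigO_fst_sq (h : IsTwoStateFreeBrownianMotion φ ψ T X)
    (hp : HasParameter ψ T X α) (hφ : IsState φ) (hψ : IsState ψ) (h0 : 0 ≤ t) (ht : t ≤ T)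
    {k : ℕ} (hk : 3 ≤ k) :
    (fun N : ℕ => φ (X (t / N) ^ k)) =O[atTop] (fun N : ℕ => (N : ℝ)⁻¹ * (N : ℝ)⁻¹) := by
  obtain ⟨k, rfl⟩ := Nat.exists_eq_add_of_le' hk
  have e : (fun N : ℕ => φ (X (t / N) ^ (k + 3))) = fun N : ℕ => ((t / N : ℝ) : ℂ) *
      ∑ j ∈ Finset.range (k + 2), ψ (X (t / N) ^ j) * φ (X (t / N) ^ (k + 1 - j)) := by
    funext N
    exact h.fst_pow_add_two hφ.1 hψ.1 (div_natCast_nonneg h0 N)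
      ((div_natCast_le_self h0 N).trans ht) (k + 1)
  rw [e]
  refine isBigO_ofReal_div_natCast.mul (IsBigO.fun_sum fun j hj => ?_)
  by_cases hj0 : j = 0
  · simpa [hj0, hψ.1] using h.isBigO_fst hp hφ hψ h0 ht (Nat.succ_ne_zero k)
  · simpa using (h.isBigO_snd hp hψ h0 ht hj0).mul (h.isBigO_fst_one hp hφ hψ h0 ht (k + 1 - j))

/-- The `k`-th powers of the increments of `X` over `N` intervals of length `t / N`, centered at
their asymptotic `φ`-mean. -/
noncomputable def centeredPow (X : ℝ → A) (t : ℝ) (k N i : ℕ) : A :=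
  (X ((i + 1 : ℕ) * (t / N)) - X (i * (t / N))) ^ k -
    ((if k = 2 then t / N else 0 : ℝ) : ℂ) • (1 : A)

theorem centeredPow_mem (k N i : ℕ) : centeredPow X t k N i ∈
    Algebra.adjoin ℂ {X ((i + 1 : ℕ) * (t / N)) - X (i * (t / N))} :=
  sub_smul_one_mem (pow_mem (Algebra.self_mem_adjoin_singleton ℂ _) k) _

theorem natCast_mul_div_mono (h0 : 0 ≤ t) {N i j : ℕ} (hij : i ≤ j) :
    (i : ℝ) * (t / N) ≤ j * (t / N) :=
  mul_le_mul_of_nonneg_right (by exact_mod_cast hij) (div_natCast_nonneg h0 N)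

theorem natCast_mul_div_le (h0 : 0 ≤ t) {N i : ℕ} (hi : i ≤ N) : (i : ℝ) * (t / N) ≤ t := by
  refine (natCast_mul_div_mono h0 hi).trans ?_
  by_cases hN : (N : ℝ) = 0
  · simpa [hN] using h0
  · rw [mul_div_cancel₀ t hN]

theorem HasTwoStateFreeIncrements.isSelfAdjoint_centeredPow (h : HasTwoStateFreeIncrements φ ψ T X)
    (h0 : 0 ≤ t) (ht : t ≤ T) (k : ℕ) {N i : ℕ} (hi : i < N) :
    IsSelfAdjoint (centeredPow X t k N i) := by
  have hs : ∀ i ≤ N, IsSelfAdjoint (X (i * (t / N))) := fun i hi =>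
    h.selfAdjoint _ (by positivity) ((natCast_mul_div_le h0 hi).trans ht)
  exact (((hs (i + 1) hi).sub (hs i hi.le)).pow k).sub (isSelfAdjoint_ofReal_smul (.one A) _)

theorem map_centeredPow (ω : A →ₗ[ℂ] ℂ) (hω : ω 1 = 1)
    (hs : ∀ s t, 0 ≤ s → s ≤ t → t ≤ T → ∀ n : ℕ, ω ((X t - X s) ^ n) = ω (X (t - s) ^ n))
    (h0 : 0 ≤ t) (ht : t ≤ T) (k : ℕ) {N i : ℕ} (hi : i < N) :
    ω (centeredPow X t k N i) =
      ω (X (t / N) ^ k) - ((if k = 2 then t / N else 0 : ℝ) : ℂ) ∧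
    ω (centeredPow X t k N i * centeredPow X t k N i) = ω (X (t / N) ^ (2 * k)) -
      2 * ((if k = 2 then t / N else 0 : ℝ) : ℂ) * ω (X (t / N) ^ k) +
      ((if k = 2 then t / N else 0 : ℝ) : ℂ) * ((if k = 2 then t / N else 0 : ℝ) : ℂ) := by
  have h1 := hs (i * (t / N)) ((i + 1 : ℕ) * (t / N)) (by positivity)
    (natCast_mul_div_mono h0 i.le_succ) ((natCast_mul_div_le h0 hi).trans ht)
  have e : ((i + 1 : ℕ) : ℝ) * (t / N) - i * (t / N) = t / N := by push_cast; ring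
  rw [e] at h1
  unfold centeredPow
  generalize ((if k = 2 then t / N else 0 : ℝ) : ℂ) = c
  refine ⟨by rw [map_sub, h1, map_smul, hω, smul_eq_mul, mul_one], ?_⟩
  simp only [sub_mul, mul_sub, smul_mul_assoc, mul_smul_comm, one_mul, mul_one, map_sub, map_smul,
    ← pow_add, h1, hω, smul_eq_mul]
  rw [two_mul k]
  ring

theorem HasTwoStateFreeIncrements.map_centeredPow_mul (h : HasTwoStateFreeIncrements φ ψ T X)
    (hφ : φ 1 = 1) (hψ : ψ 1 = 1) (h0 : 0 ≤ t) (ht : t ≤ T) (k : ℕ) {N i j : ℕ} (hi : i < N)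
    (hj : j < N) (hij : i ≠ j) :
    φ (centeredPow X t k N i * centeredPow X t k N j) =
      φ (centeredPow X t k N i) * φ (centeredPow X t k N j) ∧
    ψ (centeredPow X t k N i * centeredPow X t k N j) =
      ψ (centeredPow X t k N i) * ψ (centeredPow X t k N j) := by
  have hp : ∀ i j, i < N → j < N → i < j → _ := fun i j hi hj hij =>
    h.free_pair (s := i * (t / N)) (t := (i + 1 : ℕ) * (t / N)) (s' := j * (t / N))
      (t' := (j + 1 : ℕ) * (t / N)) (by positivity)
      (natCast_mul_div_mono h0 i.le_succ) (natCast_mul_div_mono h0 hij)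
      (natCast_mul_div_mono h0 j.le_succ) ((natCast_mul_div_le h0 hj).trans ht)
  rcases lt_or_gt_of_ne hij with hlt | hlt
  · exact ⟨(hp i j hi hj hlt).fst_mul hψ hφ (i := 0) (j := 1) (by decide) (centeredPow_mem k N i)
      (centeredPow_mem k N j), (hp i j hi hj hlt).snd_mul hψ (i := 0) (j := 1) (by decide)
        (centeredPow_mem k N i) (centeredPow_mem k N j)⟩
  · exact ⟨(hp j i hj hi hlt).fst_mul hψ hφ (i := 1) (j := 0) (by decide) (centeredPow_mem k N i)
      (centeredPow_mem k N j), (hp j i hj hi hlt).snd_mul hψ (i := 1) (j := 0) (by decide)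
        (centeredPow_mem k N i) (centeredPow_mem k N j)⟩

/-- `N ψ (X (t / N) ^ k) → 0` for `k > 2`, and `N ψ (X (t / N) ^ 2) → t`. -/
theorem IsTwoStateFreeBrownianMotion.tendsto_mul_snd (h : IsTwoStateFreeBrownianMotion φ ψ T X)
    (hp : HasParameter ψ T X α) (hφ : IsState φ) (hψ : IsState ψ) (hf : IsFaithfulFunctional φ)
    (hw : HasWeakLimits φ ψ) (h0 : 0 ≤ t) (ht : t ≤ T) {k : ℕ} (hk : 2 ≤ k) :
    Tendsto (fun N : ℕ => (N : ℂ) * ψ (X (t / N) ^ k)) atTop (𝓝 (if k = 2 then (t : ℂ) else 0)) := by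
  set c : ℕ → ℂ := fun N => ((if k = 2 then t / N else 0 : ℝ) : ℂ) with hc
  -- For `k = 2` this is the discrete quadratic variation minus `t`; for larger `k` it is the `k`-th
  -- variation.
  set a : ℕ → A := fun N => ∑ i ∈ Finset.range N, centeredPow X t k N i with ha
  have hcO : c =O[atTop] (fun N : ℕ => (N : ℝ)⁻¹) := by
    by_cases hk2 : k = 2
    · simpa only [hc, hk2, if_true] using isBigO_ofReal_div_natCast
    · simpa only [hc, hk2, if_false, Complex.ofReal_zero] using isBigO_zero _ _
  have hrr : (fun N : ℕ => (N : ℝ)⁻¹ * (N : ℝ)⁻¹) =O[atTop] (fun N : ℕ => (N : ℝ)⁻¹) := by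
    simpa using (isBigO_refl (fun N : ℕ => (N : ℝ)⁻¹) atTop).mul isBigO_natCast_inv_one
  have hNO : (fun N : ℕ => (N : ℂ)) =O[atTop] (fun N : ℕ => (N : ℝ)) :=
    isBigO_of_le _ fun N => by simp
  have hN1O : (fun N : ℕ => (N : ℂ) - 1) =O[atTop] (fun N : ℕ => (N : ℝ)) := by
    refine hNO.sub ?_
    refine IsBigO.of_bound 1 ?_
    filter_upwards [eventually_ge_atTop 1] with N hN
    simpa using hN
  have hNr : ∀ N : ℕ, (N : ℝ) * ((N : ℝ)⁻¹ * (N : ℝ)⁻¹) = (N : ℝ)⁻¹ := fun N => by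
    by_cases hN : (N : ℝ) = 0
    · simp [hN]
    · field_simp
  have hφsq : ∀ N, φ (a N * a N) = N * (φ (X (t / N) ^ (2 * k)) - 2 * c N * φ (X (t / N) ^ k) +
      c N * c N) + N * (N - 1) * ((φ (X (t / N) ^ k) - c N) * (φ (X (t / N) ^ k) - c N)) :=
    fun N => map_sum_mul_self φ _ N
      (fun i hi => (map_centeredPow φ hφ.1 h.stationary_fst h0 ht k hi).2) fun i hi j hj hij => by
        rw [(h.map_centeredPow_mul hφ.1 hψ.1 h0 ht k hi hj hij).1,
          (map_centeredPow φ hφ.1 h.stationary_fst h0 ht k hi).1,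
          (map_centeredPow φ hφ.1 h.stationary_fst h0 ht k hj).1]
  have hψsq : ∀ N, ψ (a N * a N) = N * (ψ (X (t / N) ^ (2 * k)) - 2 * c N * ψ (X (t / N) ^ k) +
      c N * c N) + N * (N - 1) * ((ψ (X (t / N) ^ k) - c N) * (ψ (X (t / N) ^ k) - c N)) :=
    fun N => map_sum_mul_self ψ _ N
      (fun i hi => (map_centeredPow ψ hψ.1 h.stationary_snd h0 ht k hi).2) fun i hi j hj hij => by
        rw [(h.map_centeredPow_mul hφ.1 hψ.1 h0 ht k hi hj hij).2,
          (map_centeredPow ψ hψ.1 h.stationary_snd h0 ht k hi).1,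
          (map_centeredPow ψ hψ.1 h.stationary_snd h0 ht k hj).1]
  have hψa : ∀ N, ψ (a N) = N * (ψ (X (t / N) ^ k) - c N) := fun N => by
    rw [ha, map_sum, Finset.sum_congr rfl fun i hi =>
      (map_centeredPow ψ hψ.1 h.stationary_snd h0 ht k (Finset.mem_range.1 hi)).1,
      Finset.sum_const, Finset.card_range, nsmul_eq_mul]
  -- There are `N` diagonal terms of size `O(N⁻²)`, and fewer than `N²` off-diagonal ones, each
  -- factoring into two means of size `O(N⁻²)`.
  have hφ0 : Tendsto (fun N => φ (a N * a N)) atTop (𝓝 0) := by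
    have h1 : (fun N : ℕ => φ (X (t / N) ^ k) - c N) =O[atTop]
        (fun N : ℕ => (N : ℝ)⁻¹ * (N : ℝ)⁻¹) := by
      by_cases hk2 : k = 2
      · have : (fun N : ℕ => φ (X (t / N) ^ k) - c N) = fun _ => 0 := by
          funext N
          have hv := h.variance 0 (t / N) le_rfl (div_natCast_nonneg h0 N)
            ((div_natCast_le_self h0 N).trans ht)
          rw [h.start, sub_zero, sub_zero] at hv
          simp only [hc, hk2, if_true, hv, sub_self]
        rw [this]
        exact isBigO_zero _ _
      · simp only [hc, hk2, if_false, Complex.ofReal_zero, sub_zero]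
        exact h.isBigO_fst_sq hp hφ hψ h0 ht (by omega)
    have h2 : (fun N : ℕ => φ (X (t / N) ^ (2 * k)) - 2 * c N * φ (X (t / N) ^ k) + c N * c N)
        =O[atTop] (fun N : ℕ => (N : ℝ)⁻¹ * (N : ℝ)⁻¹) :=
      ((h.isBigO_fst_sq hp hφ hψ h0 ht (by omega)).sub
        ((hcO.const_mul_left 2).mul (h.isBigO_fst hp hφ hψ h0 ht (by omega)))).add (hcO.mul hcO)
    have h3 := (hNO.mul h2).congr_right hNr
    have h4 := ((hNO.mul hN1O).mul (h1.mul h1)).congr_right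
      (g₂ := fun N : ℕ => (N : ℝ)⁻¹ * (N : ℝ)⁻¹) (fun N => by
        rw [mul_mul_mul_comm, hNr])
    have h5 := h3.add (h4.trans hrr)
    exact (h5.congr_left fun N => (hφsq N).symm).trans_tendsto tendsto_inv_atTop_nhds_zero_nat
  -- Under `ψ` each mean is only `O(N⁻¹)`, so the second moment is merely bounded; together with
  -- `hφ0` this suffices to transfer the limit from `φ` to `ψ`.
  have hψ1 : (fun N => ψ (a N * a N)) =O[atTop] (fun _ : ℕ => (1 : ℝ)) := by
    have hNr1 : ∀ᶠ N : ℕ in atTop, (N : ℝ) * (N : ℝ)⁻¹ = 1 := by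
      filter_upwards [eventually_gt_atTop 0] with N hN
      exact mul_inv_cancel₀ (by exact_mod_cast hN.ne')
    have h1 := (h.isBigO_snd hp hψ h0 ht (k := k) (by omega)).sub hcO
    have h2 : (fun N : ℕ => ψ (X (t / N) ^ (2 * k)) - 2 * c N * ψ (X (t / N) ^ k) + c N * c N)
        =O[atTop] (fun N : ℕ => (N : ℝ)⁻¹) :=
      ((h.isBigO_snd hp hψ h0 ht (by omega)).sub
        (((hcO.const_mul_left 2).mul (h.isBigO_snd hp hψ h0 ht (by omega))).trans hrr)).add
        ((hcO.mul hcO).trans hrr)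
    have h3 := (hNO.mul h2).congr' EventuallyEq.rfl hNr1
    have h4 := ((hNO.mul hN1O).mul (h1.mul h1)).congr' (g₂ := fun _ => (1 : ℝ)) EventuallyEq.rfl
      (by
        filter_upwards [hNr1] with N hN
        rw [mul_mul_mul_comm, hN, one_mul])
    exact (h3.add h4).congr_left fun N => (hψsq N).symm
  obtain ⟨C, -, hC⟩ := bound_of_isBigO_nat_atTop hψ1
  have h6 : Tendsto (fun N => ψ (a N)) atTop (𝓝 0) := by
    refine hw.tendsto_snd_of_sq_le hφ hf hψ (C := C) (fun N => ?_) (fun N => ?_) ?_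
    · exact isSelfAdjoint_sum _ fun i hi =>
        h.isSelfAdjoint_centeredPow h0 ht k (Finset.mem_range.1 hi)
    · refine (Complex.re_le_norm _).trans ?_
      simpa using hC (x := N) one_ne_zero
    · simpa [Function.comp_def] using (Complex.continuous_re.tendsto _).comp hφ0
  have h7 : Tendsto (fun N : ℕ => (N : ℂ) * c N) atTop (𝓝 (if k = 2 then (t : ℂ) else 0)) := by
    by_cases hk2 : k = 2
    · refine tendsto_const_nhds.congr' ?_
      filter_upwards [eventually_gt_atTop 0] with N hN
      have : (N : ℂ) ≠ 0 := by exact_mod_cast hN.ne'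
      simp only [hc, hk2, if_true]
      push_cast
      field_simp
    · simp only [hc, hk2, if_false, Complex.ofReal_zero, mul_zero]
      exact tendsto_const_nhds
  have h8 := h6.add h7
  rw [zero_add] at h8
  refine h8.congr fun N => ?_
  rw [hψa]
  ring

/-- The second moment of `X t` for `ψ`. -/
theorem IsTwoStateFreeBrownianMotion.snd_sq (h : IsTwoStateFreeBrownianMotion φ ψ T X)
    (hp : HasParameter ψ T X α) (hφ : IsState φ) (hψ : IsState ψ) (hf : IsFaithfulFunctional φ)
    (hw : HasWeakLimits φ ψ) (h0 : 0 ≤ t) (ht : t ≤ T) : ψ (X t ^ 2) = t + (α * t) ^ 2 := by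
  have h1 := h.tendsto_mul_snd hp hφ hψ hf hw h0 ht le_rfl
  have h2 : Tendsto (fun N : ℕ => ψ (X t ^ 2) - (α * t) ^ 2 + (α * t) ^ 2 / (N : ℂ)) atTop
      (𝓝 (ψ (X t ^ 2) - (α * t) ^ 2 + 0)) :=
    tendsto_const_nhds.add (tendsto_const_div_atTop_nhds_zero_nat _)
  have h3 : (fun N : ℕ => (N : ℂ) * ψ (X (t / N) ^ 2)) =ᶠ[atTop]
      fun N : ℕ => ψ (X t ^ 2) - (α * t) ^ 2 + (α * t) ^ 2 / (N : ℂ) := by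
    filter_upwards [eventually_gt_atTop 0] with N hN
    exact h.snd_sq_div hp hψ.1 h0 ht hN.ne'
  have h4 := tendsto_nhds_unique (h1.congr' h3) h2
  rw [if_pos rfl, add_zero] at h4
  linear_combination -h4

end ShortIncrements

/-! ### The `ψ`-distribution of `X t` -/

section ResolventSeries

open Filter Topology PowerSeries

section Algebraic

variable {A : Type*} [Ring A]

theorem coeff_zero_invOfUnit_one (F : PowerSeries A) : coeff 0 (F.invOfUnit 1) = 1 := by
  rw [coeff_invOfUnit, if_pos rfl, inv_one, Units.val_one]

variable [Algebra ℂ A] {m : ℕ → ℂ}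

/-- The power series `1 + z (M - 1) - v M y` in `v`, where `M = ∑ mₙ vⁿ`. -/
noncomputable def incrementSeries (m : ℕ → ℂ) (z : ℂ) (y : A) : PowerSeries A :=
  PowerSeries.mk fun j => if j = 0 then 1 else (z * m j) • (1 : A) - m (j - 1) • y

theorem constantCoeff_incrementSeries (m : ℕ → ℂ) (z : ℂ) (y : A) :
    constantCoeff (incrementSeries m z y) = ((1 : Aˣ) : A) := by
  rw [← coeff_zero_eq_constantCoeff_apply, incrementSeries, coeff_mk, if_pos rfl, Units.val_one]

/-- The nonconstant part is linear in `(z, y)`, so adding an increment of the process has the form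
`D₁ + D₂ - 1` treated in `snd_coeff_inv`. -/
theorem incrementSeries_add (m : ℕ → ℂ) (z : ℂ) (y y' : A) :
    incrementSeries m z y + incrementSeries m 1 y' - 1 = incrementSeries m (z + 1) (y + y') := by
  ext j
  rw [map_sub, map_add, coeff_one, incrementSeries, incrementSeries, incrementSeries, coeff_mk,
    coeff_mk, coeff_mk]
  by_cases hj : j = 0
  · simp [hj]
  · simp only [hj, if_false]
    module

theorem coeff_invOfUnit_mem {F : PowerSeries A} {S : Subalgebra ℂ A} (hF : ∀ n, coeff n F ∈ S)
    (n : ℕ) : coeff n (F.invOfUnit 1) ∈ S := by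
  induction n using Nat.strong_induction_on with
  | _ n ih =>
    rw [coeff_invOfUnit]
    split_ifs with h
    · rw [inv_one, Units.val_one]
      exact one_mem S
    · rw [inv_one, Units.val_one, neg_one_mul]
      refine neg_mem (sum_mem fun x _ => ?_)
      split_ifs with hx
      · exact mul_mem (hF _) (ih _ hx)
      · exact zero_mem S

theorem coeff_incrementSeries_mem (m : ℕ → ℂ) (z : ℂ) (y : A) (n : ℕ) :
    coeff n (incrementSeries m z y) ∈ Algebra.adjoin ℂ {y} := by
  rw [incrementSeries, coeff_mk]
  split_ifs with h
  · exact one_mem _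
  · exact sub_mem (Subalgebra.smul_mem _ (one_mem _) _)
      (Subalgebra.smul_mem _ (Algebra.self_mem_adjoin_singleton ℂ y) _)

/-- If `y` has the moments `m`, then the inverse of `M (1 - v y)` is centered. -/
theorem map_coeff_invOfUnit_incrementSeries {ψ : A →ₗ[ℂ] ℂ} {y : A} (h0 : m 0 = 1)
    (hy : ∀ n, ψ (y ^ n) = m n) {n : ℕ} (hn : n ≠ 0) :
    ψ (coeff n ((incrementSeries m 1 y).invOfUnit 1)) = 0 := by
  set V := (incrementSeries m 1 y).invOfUnit 1 with hV
  set M : PowerSeries A := PowerSeries.mk fun j => algebraMap ℂ A (m j) with hM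
  set G : PowerSeries A := PowerSeries.mk fun j => y ^ j with hG
  have hDV : incrementSeries m 1 y * V = 1 :=
    mul_invOfUnit _ 1 (constantCoeff_incrementSeries m 1 y)
  have hD : incrementSeries m 1 y = (1 - C y * PowerSeries.X) * M := by
    ext j
    rw [sub_mul, one_mul, mul_assoc, map_sub, coeff_C_mul, incrementSeries, coeff_mk]
    obtain _ | j := j
    · simp [hM, h0]
    · rw [coeff_succ_X_mul, hM, coeff_mk, coeff_mk, Algebra.algebraMap_eq_smul_one,
        Algebra.algebraMap_eq_smul_one]
      simp
  have hGE : G * (1 - C y * PowerSeries.X) = 1 := by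
    ext j
    rw [mul_sub, mul_one, ← mul_assoc, map_sub, coeff_one]
    obtain _ | j := j
    · simp [hG]
    · rw [coeff_succ_mul_X, coeff_mul_C, hG, coeff_mk, coeff_mk, pow_succ, sub_self,
        if_neg (Nat.succ_ne_zero j)]
  have hMV : M * V = G := by
    calc M * V = G * (1 - C y * PowerSeries.X) * (M * V) := by rw [hGE, one_mul]
      _ = G * ((1 - C y * PowerSeries.X) * M * V) := by simp only [mul_assoc]
      _ = G := by rw [← hD, hDV, mul_one]
  -- Applying `ψ` to `M V = ∑ yʲ vʲ` turns the right side into `M`; cancelling `M` among scalar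
  -- power series leaves `ψ V = 1`.
  have hc : (PowerSeries.mk m) * (PowerSeries.mk fun j => ψ (coeff j V)) = PowerSeries.mk m := by
    ext j
    have h1 := congrArg (fun P => ψ (coeff j P)) hMV
    simp only [coeff_mul, map_sum, hG, coeff_mk, hy, hM, ← Algebra.smul_def, map_smul] at h1
    simpa only [coeff_mul, coeff_mk, smul_eq_mul] using h1
  have hm : PowerSeries.mk m ≠ 0 := fun h => by
    have := congrArg (coeff 0) h
    simp [h0] at this
  have hW := mul_left_cancel₀ hm (hc.trans (mul_one _).symm)
  have := congrArg (coeff n) hW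
  rwa [coeff_mk, coeff_one, if_neg hn] at this

/-- Monic polynomials in `y` (free Chebyshev polynomials with variance `t`). -/
noncomputable def chebyshevSeq (t : ℂ) (y : A) : ℕ → A
  | 0 => 1
  | 1 => y
  | n + 2 => y * chebyshevSeq t y (n + 1) - t • chebyshevSeq t y n

/-- The three-term recursion is the expansion of `1 / (1 - v y + t v²)`. -/
theorem invOfUnit_eq_mk_chebyshevSeq (t : ℂ) (y : A) :
    (PowerSeries.mk fun j => if j = 0 then (1 : A) else if j = 1 then -y else
      if j = 2 then t • 1 else 0).invOfUnit 1 = PowerSeries.mk (chebyshevSeq t y) := by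
  set F : PowerSeries A := PowerSeries.mk fun j => if j = 0 then (1 : A) else if j = 1 then -y else
      if j = 2 then t • 1 else 0 with hF
  have hF' : F = 1 - C y * PowerSeries.X + C (t • 1) * PowerSeries.X * PowerSeries.X := by
    ext j
    rw [map_add, map_sub, coeff_one, hF, coeff_mk]
    obtain _ | _ | _ | j := j <;> simp [coeff_succ_mul_X, coeff_C]
  have h1 : F * PowerSeries.mk (chebyshevSeq t y) = 1 := by
    ext j
    rw [hF', add_mul, sub_mul, one_mul, mul_assoc, mul_assoc, mul_assoc, map_add, map_sub,
      coeff_C_mul, coeff_C_mul, coeff_mk, coeff_one]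
    obtain _ | _ | j := j
    · simp [chebyshevSeq]
    · rw [coeff_succ_X_mul, coeff_succ_X_mul, coeff_zero_X_mul]
      simp [chebyshevSeq]
    · rw [coeff_succ_X_mul, coeff_succ_X_mul, coeff_succ_X_mul, coeff_mk, coeff_mk, chebyshevSeq]
      simp
  have h2 : F.invOfUnit 1 * F = 1 := invOfUnit_mul F 1 (by
    rw [← coeff_zero_eq_constantCoeff_apply, hF, coeff_mk, if_pos rfl, Units.val_one])
  calc F.invOfUnit 1 = F.invOfUnit 1 * (F * PowerSeries.mk (chebyshevSeq t y)) := by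
        rw [h1, mul_one]
    _ = _ := by rw [← mul_assoc, h2, one_mul]

/-- Increments are added one at a time through `snd_coeff_inv`. This encodes additivity of free
cumulants without introducing those of `X (k * r)`. -/
theorem HasTwoStateFreeIncrements.snd_coeff_invOfUnit [StarRing A] {φ ψ : A →ₗ[ℂ] ℂ} {T r : ℝ}
    {X : ℝ → A} (h : HasTwoStateFreeIncrements φ ψ T X) (hψ : ψ 1 = 1) (hr : 0 ≤ r) (k : ℕ)
    (hk : k * r ≤ T) {n : ℕ} (hn : n ≠ 0) :
    ψ (coeff n ((incrementSeries (fun j => ψ (X r ^ j)) k (X (k * r))).invOfUnit 1)) = 0 := by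
  induction k generalizing n with
  | zero =>
    have h1 : incrementSeries (fun j => ψ (X r ^ j)) (0 : ℕ) (X ((0 : ℕ) * r)) = 1 := by
      ext j
      rw [incrementSeries, coeff_mk, coeff_one]
      simp [h.start]
    have h2 : (1 : PowerSeries A).invOfUnit 1 = 1 := by
      simpa using mul_invOfUnit (1 : PowerSeries A) 1 (by simp)
    rw [h1, h2, coeff_one, if_neg hn, map_zero]
  | succ k ih =>
    have e : ((k + 1 : ℕ) : ℝ) * r = k * r + r := by push_cast; ring
    have hk0 : 0 ≤ (k : ℝ) * r := by positivity
    rw [e] at hk ⊢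
    have hk' : k * r ≤ T := by linarith
    have hf := h.free_pair le_rfl hk0 le_rfl (le_add_of_nonneg_right hr) hk
    have hs := h.stationary_snd (k * r) (k * r + r) hk0 (le_add_of_nonneg_right hr) hk
    rw [add_sub_cancel_left] at hs
    have h1 := incrementSeries_add (fun j => ψ (X r ^ j)) k (X (k * r)) (X (k * r + r) - X (k * r))
    rw [add_sub_cancel, ← Nat.cast_succ] at h1
    refine hf.snd_coeff_inv (i := 0) (j := 1) (by decide)
      (invOfUnit_mul _ 1 (constantCoeff_incrementSeries (fun j => ψ (X r ^ j)) k (X (k * r))))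
      (invOfUnit_mul _ 1 (constantCoeff_incrementSeries (fun j => ψ (X r ^ j)) 1
        (X (k * r + r) - X (k * r))))
      (mul_invOfUnit _ 1 (constantCoeff_incrementSeries (fun j => ψ (X r ^ j)) 1
        (X (k * r + r) - X (k * r))))
      (coeff_zero_invOfUnit_one _) (coeff_zero_invOfUnit_one _) (fun j hj => ⟨?_, ih hk' hj⟩)
      (fun j hj => ⟨?_, ?_⟩) ?_ hn
    · refine coeff_invOfUnit_mem (fun l => ?_) j
      have := coeff_incrementSeries_mem (fun j => ψ (X r ^ j)) k (X (k * r)) l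
      show _ ∈ Algebra.adjoin ℂ {X (k * r) - X 0}
      rwa [h.start, sub_zero]
    · exact coeff_invOfUnit_mem (coeff_incrementSeries_mem _ _ _) j
    · exact map_coeff_invOfUnit_incrementSeries (by simpa using hψ) hs hj
    · rw [h1]
      exact mul_invOfUnit _ 1 (constantCoeff_incrementSeries _ _ _)

end Algebraic

variable {A : Type*} [CStarAlgebra A] {φ ψ : A →ₗ[ℂ] ℂ} {T α t : ℝ} {X : ℝ → A}

theorem tendsto_coeff_invOfUnit {F : ℕ → PowerSeries A} {F' : PowerSeries A}
    (hF : ∀ n, Tendsto (fun N => coeff n (F N)) atTop (𝓝 (coeff n F'))) (n : ℕ) :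
    Tendsto (fun N => coeff n ((F N).invOfUnit 1)) atTop (𝓝 (coeff n (F'.invOfUnit 1))) := by
  induction n using Nat.strong_induction_on with
  | _ n ih =>
    rw [coeff_invOfUnit n F' 1]
    refine Tendsto.congr (fun N => (coeff_invOfUnit n (F N) 1).symm) ?_
    by_cases hn : n = 0
    · simp only [hn, if_true]
      exact tendsto_const_nhds
    · simp only [hn, if_false]
      refine tendsto_const_nhds.mul (tendsto_finsetSum _ fun x _ => ?_)
      by_cases hx : x.2 < n
      · simp only [hx, if_true]
        exact (hF _).mul (ih _ hx)
      · simp only [hx, if_false]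
        exact tendsto_const_nhds

/-- The free Chebyshev polynomials of `X t - α t` are `ψ`-centered. -/
theorem IsTwoStateFreeBrownianMotion.snd_chebyshevSeq (h : IsTwoStateFreeBrownianMotion φ ψ T X)
    (hp : HasParameter ψ T X α) (hφ : IsState φ) (hψ : IsState ψ) (hf : IsFaithfulFunctional φ)
    (hw : HasWeakLimits φ ψ) (h0 : 0 ≤ t) (ht : t ≤ T) {n : ℕ} (hn : n ≠ 0) :
    ψ (chebyshevSeq t (X t - ((α * t : ℝ) : ℂ) • 1) n) = 0 := by
  set y := X t - ((α * t : ℝ) : ℂ) • (1 : A) with hy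
  set m : ℕ → ℕ → ℂ := fun N j => ψ (X (t / N) ^ j) with hm
  have hm0 : ∀ N, m N 0 = 1 := fun N => by simpa [hm] using hψ.1
  have hmt : ∀ j, j ≠ 0 → Tendsto (fun N => m N j) atTop (𝓝 0) := fun j hj =>
    (h.isBigO_snd hp hψ h0 ht hj).trans_tendsto tendsto_inv_atTop_nhds_zero_nat
  have h1 : ∀ᶠ N : ℕ in atTop, ψ (coeff n ((incrementSeries (m N) N (X t)).invOfUnit 1)) = 0 := by
    filter_upwards [eventually_gt_atTop 0] with N hN
    have hN' : (N : ℝ) ≠ 0 := by exact_mod_cast hN.ne'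
    have := h.snd_coeff_invOfUnit hψ.1 (div_natCast_nonneg h0 N) N
      (by rwa [mul_div_cancel₀ t hN']) hn
    rwa [mul_div_cancel₀ t hN'] at this
  -- Here `M → 1` and `N (M - 1) → α t v + t v²`, so the series tends coefficientwise to `1 - v y +
  -- t v²`.
  have h2 : ∀ j, Tendsto (fun N : ℕ => coeff j (incrementSeries (m N) N (X t))) atTop
      (𝓝 (coeff j (PowerSeries.mk fun j => if j = 0 then (1 : A) else if j = 1 then -y else
        if j = 2 then (t : ℂ) • 1 else 0))) := by
    intro j
    simp only [incrementSeries, coeff_mk]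
    obtain _ | _ | j := j
    · simp
    · have h3 : Tendsto (fun N : ℕ => (N : ℂ) * m N 1) atTop (𝓝 ((α * t : ℝ) : ℂ)) := by
        refine tendsto_const_nhds.congr' ?_
        filter_upwards [eventually_gt_atTop 0] with N hN
        have hN' : (N : ℂ) ≠ 0 := by exact_mod_cast hN.ne'
        simp only [hm, pow_one]
        rw [hp.snd_apply (div_natCast_nonneg h0 N) ((div_natCast_le_self h0 N).trans ht)]
        push_cast
        field_simp
      have h4 := (h3.smul_const (1 : A)).sub (tendsto_const_nhds (x := X t))
      simpa [hm0, hy] using h4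
    · have h3 := h.tendsto_mul_snd hp hφ hψ hf hw h0 ht (k := j + 2) (by omega)
      have h4 := (h3.smul_const (1 : A)).sub ((hmt (j + 1) (by omega)).smul_const (X t))
      have e : (if j + 2 = 2 then (t : ℂ) else 0) • (1 : A) - (0 : ℂ) • X t =
          if j + 2 = 2 then (t : ℂ) • 1 else 0 := by
        split_ifs <;> simp
      rw [e] at h4
      simpa using h4
  have h5 := (hψ.continuous.tendsto _).comp (tendsto_coeff_invOfUnit h2 n)
  rw [invOfUnit_eq_mk_chebyshevSeq, coeff_mk] at h5
  exact (tendsto_nhds_unique h5 (tendsto_const_nhds.congr' (h1.mono fun N hN => hN.symm)))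

end ResolventSeries

/-! ### Nonexistence for `T > 1 / α ^ 2` -/

section Nonexistence

open Filter Topology

section Algebraic

variable {A : Type*} [Ring A] [Algebra ℂ A]

theorem commute_chebyshevSeq (t : ℂ) (y : A) (n : ℕ) : Commute y (chebyshevSeq t y n) := by
  induction n using Nat.twoStepInduction with
  | zero => exact Commute.one_right y
  | one => exact Commute.refl y
  | more n h1 h2 => exact ((Commute.refl y).mul_right h2).sub_right (h1.smul_right t)

theorem chebyshevSeq_succ_mul_succ (t : ℂ) (y : A) (m n : ℕ) :
    chebyshevSeq t y (m + 1) * chebyshevSeq t y (n + 1) =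
      chebyshevSeq t y (m + n + 2) + t • (chebyshevSeq t y m * chebyshevSeq t y n) := by
  induction m generalizing n with
  | zero => simp [chebyshevSeq]
  | succ m ih =>
    have h1 := ih (n + 1)
    have h2 := (commute_chebyshevSeq t y (m + 1)).eq
    have h3 : y * chebyshevSeq t y (n + 1) =
        chebyshevSeq t y (n + 2) + t • chebyshevSeq t y n := by
      rw [chebyshevSeq, sub_add_cancel]
    have h4 : chebyshevSeq t y (m + 1 + 1) =
        y * chebyshevSeq t y (m + 1) - t • chebyshevSeq t y m := rfl
    rw [h4, sub_mul, h2, mul_assoc, h3, mul_add, h1, show m + (n + 1) + 2 = m + 1 + n + 2 by ring,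
      mul_smul_comm, smul_mul_assoc]
    abel

theorem chebyshevSeq_mem (t : ℂ) {y : A} {S : Subalgebra ℂ A} (hy : y ∈ S) (n : ℕ) :
    chebyshevSeq t y n ∈ S := by
  induction n using Nat.twoStepInduction with
  | zero => exact one_mem S
  | one => exact hy
  | more n h1 h2 => exact sub_mem (mul_mem hy h2) (S.smul_mem h1 t)

theorem isSelfAdjoint_chebyshevSeq [StarRing A] [StarModule ℂ A] (t : ℝ) {y : A}
    (hy : IsSelfAdjoint y) (n : ℕ) : IsSelfAdjoint (chebyshevSeq (t : ℂ) y n) := by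
  induction n using Nat.twoStepInduction with
  | zero => exact .one A
  | one => exact hy
  | more n h1 h2 =>
    exact ((hy.commute_iff h2).1 (commute_chebyshevSeq _ _ _)).sub (isSelfAdjoint_ofReal_smul h1 t)

theorem map_chebyshevSeq_sq {ψ : A →ₗ[ℂ] ℂ} (h1 : ψ 1 = 1) {t : ℂ} {y : A}
    (h : ∀ n, n ≠ 0 → ψ (chebyshevSeq t y n) = 0) (n : ℕ) :
    ψ (chebyshevSeq t y n * chebyshevSeq t y n) = t ^ n := by
  induction n with
  | zero => simpa [chebyshevSeq] using h1
  | succ n ih =>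
    rw [chebyshevSeq_succ_mul_succ, map_add, h _ (by omega), map_smul, ih, zero_add, smul_eq_mul,
      pow_succ']

/-- The graph of the linear map `xⁿ ↦ ∑_{j < n} ψ (xʲ) xⁿ⁻¹⁻ʲ`. -/
noncomputable def diffQuotientGraph (ψ : A →ₗ[ℂ] ℂ) (x : A) : Submodule ℂ (A × A) :=
  Submodule.span ℂ (Set.range fun n : ℕ =>
    (x ^ n, ∑ j ∈ Finset.range n, ψ (x ^ j) • x ^ (n - 1 - j)))

theorem mul_mem_diffQuotientGraph {ψ : A →ₗ[ℂ] ℂ} {x : A} {q : A × A}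
    (hq : q ∈ diffQuotientGraph ψ x) :
    (x * q.1, ψ q.1 • (1 : A) + x * q.2) ∈ diffQuotientGraph ψ x := by
  let L : A × A →ₗ[ℂ] A × A := ((LinearMap.mulLeft ℂ x).comp (LinearMap.fst ℂ A A)).prod
    (((LinearMap.toSpanSingleton ℂ A 1).comp ψ).comp (LinearMap.fst ℂ A A) +
      (LinearMap.mulLeft ℂ x).comp (LinearMap.snd ℂ A A))
  have : diffQuotientGraph ψ x ≤ (diffQuotientGraph ψ x).comap L := by
    refine Submodule.span_le.2 ?_
    rintro _ ⟨n, rfl⟩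
    refine Submodule.subset_span ⟨n + 1, ?_⟩
    refine Prod.ext (pow_succ' x n) ?_
    show ∑ j ∈ Finset.range (n + 1), ψ (x ^ j) • x ^ (n + 1 - 1 - j) =
      ψ (x ^ n) • (1 : A) + x * ∑ j ∈ Finset.range n, ψ (x ^ j) • x ^ (n - 1 - j)
    rw [Finset.sum_range_succ, Nat.add_sub_cancel, Nat.sub_self, pow_zero, add_comm,
      Finset.mul_sum]
    congr 1
    refine Finset.sum_congr rfl fun j hj => ?_
    have hj' := Finset.mem_range.1 hj
    rw [mul_smul_comm, ← pow_succ', show n - 1 - j + 1 = n - j by omega]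
  exact this hq

/-- The moment recursion reads `φ (x p(x)) = t φ (∂p)` with `∂` the difference quotient integrated
against `ψ`. A graph is used because powers of `x` may be linearly dependent, so `∂` need not be a
map on elements. -/
theorem map_mul_of_mem_diffQuotientGraph {φ ψ : A →ₗ[ℂ] ℂ} {x : A} {t : ℂ} (h1 : φ x = 0)
    (h : ∀ n, φ (x ^ (n + 2)) = t * ∑ j ∈ Finset.range (n + 1), ψ (x ^ j) * φ (x ^ (n - j)))
    {q : A × A} (hq : q ∈ diffQuotientGraph ψ x) : φ (x * q.1) = t * φ q.2 := by
  have : diffQuotientGraph ψ x ≤ LinearMap.ker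
      ((φ.comp (LinearMap.mulLeft ℂ x)).comp (LinearMap.fst ℂ A A) -
        t • (φ.comp (LinearMap.snd ℂ A A))) := by
    refine Submodule.span_le.2 ?_
    rintro _ ⟨n, rfl⟩
    show φ (x * x ^ n) - t * φ (∑ j ∈ Finset.range n, ψ (x ^ j) • x ^ (n - 1 - j)) = 0
    obtain _ | n := n
    · simp [h1]
    · rw [← pow_succ', h n, map_sum]
      simp
  exact sub_eq_zero.1 (this hq)

/-- As the Chebyshev polynomials are `ψ`-centered, the difference quotient takes the one of degree
`n + 1` to the one of degree `n`. The terms with `t` then cancel in the three-term recursion under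
`φ`, which leaves multiplication by `-c`. -/
theorem map_chebyshevSeq_fst {φ ψ : A →ₗ[ℂ] ℂ} {x : A} {t c : ℂ} (hφ : φ 1 = 1) (hψ : ψ 1 = 1)
    (h1 : φ x = 0)
    (h : ∀ n, φ (x ^ (n + 2)) = t * ∑ j ∈ Finset.range (n + 1), ψ (x ^ j) * φ (x ^ (n - j)))
    (hc : ∀ n, n ≠ 0 → ψ (chebyshevSeq t (x - c • 1) n) = 0) (n : ℕ) :
    φ (chebyshevSeq t (x - c • 1) n) = (-c) ^ n := by
  set U := chebyshevSeq t (x - c • (1 : A)) with hU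
  have hU2 : ∀ n, U (n + 2) = x * U (n + 1) - c • U (n + 1) - t • U n := fun n => by
    rw [hU, chebyshevSeq, sub_mul, smul_mul_assoc, one_mul]
  have hG0 : ((1 : A), (0 : A)) ∈ diffQuotientGraph ψ x :=
    Submodule.subset_span ⟨0, by simp⟩
  have hG1 : (U 1, U 0) ∈ diffQuotientGraph ψ x := by
    have h2 : (x, (1 : A)) ∈ diffQuotientGraph ψ x := Submodule.subset_span ⟨1, by simp [hψ]⟩
    have h3 := Submodule.sub_mem _ h2 (Submodule.smul_mem _ c hG0)
    simpa [hU, chebyshevSeq] using h3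
  have hG : ∀ n, (U (n + 1), U n) ∈ diffQuotientGraph ψ x := fun n => by
    induction n using Nat.twoStepInduction with
    | zero => exact hG1
    | one =>
      have h3 := Submodule.sub_mem _ (Submodule.sub_mem _ (mul_mem_diffQuotientGraph hG1)
        (Submodule.smul_mem _ c hG1)) (Submodule.smul_mem _ t hG0)
      have e : U 2 = x * U 1 - c • U 1 - t • (1 : A) := hU2 0
      have e' : U 1 = x * U 0 - c • U 0 := by simp [hU, chebyshevSeq]
      have e3 : ψ (U 1) = 0 := hc 1 one_ne_zero
      simp only [e3, zero_smul, zero_add, smul_zero, sub_zero, Prod.smul_mk, Prod.mk_sub_mk] at h3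
      rw [← e, ← e'] at h3
      exact h3
    | more n h2 h3 =>
      have h4 := Submodule.sub_mem _ (Submodule.sub_mem _ (mul_mem_diffQuotientGraph h3)
        (Submodule.smul_mem _ c h3)) (Submodule.smul_mem _ t h2)
      have e : ψ (U (n + 1 + 1)) = 0 := hc (n + 1 + 1) (by omega)
      simp only [e, zero_smul, zero_add, Prod.smul_mk, Prod.mk_sub_mk, ← hU2] at h4
      exact h4
  induction n with
  | zero => simpa [hU, chebyshevSeq] using hφ
  | succ n ih =>
    obtain _ | n := n
    · simp [hU, chebyshevSeq, h1, hφ]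
    · have h2 := map_mul_of_mem_diffQuotientGraph h1 h (hG n)
      show φ (U (n + 2)) = _
      rw [hU2, map_sub, map_sub, h2, map_smul, map_smul, ih]
      simp only [smul_eq_mul]
      ring

end Algebraic

variable {A : Type*} [CStarAlgebra A] {φ ψ : A →ₗ[ℂ] ℂ} {T α t : ℝ} {X : ℝ → A}

/-- A weak limit `k` of the truncations of `p n` plays the role of the projection onto an atom of
`φ` that is null for `ψ`. Sandwiching by `b` shows `b * k = 0`, whereas ordinary factorization keeps
`φ (b * b * h n)` away from `0`. -/
theorem HasWeakLimits.false_of_free (hw : HasWeakLimits φ ψ) (hφ : IsState φ) (hψ : IsState ψ)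
    (hf : IsFaithfulFunctional φ) {ι : Type*} {S : ι → Subalgebra ℂ A} {i j : ι}
    (hS : IsTwoStateFree φ ψ S) (hij : i ≠ j) {b : A} (hb : b ∈ S j) (hbsa : IsSelfAdjoint b)
    (hb0 : φ b = 0) (hb1 : ψ b = 0) (hb2 : φ (b * b) ≠ 0) {p : ℕ → A} (hp : ∀ n, p n ∈ S i)
    (hpsa : ∀ n, IsSelfAdjoint (p n)) (hp1 : ∀ n, φ (p n) = 1) {K : ℝ}
    (hpK : ∀ n, (φ (p n * p n)).re ≤ K)
    (hp2 : Tendsto (fun n => (ψ (p n * p n)).re) atTop (𝓝 0)) : False := by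
  have hK : 0 ≤ K := (hφ.re_mul_self_nonneg (hpsa 0)).trans (hpK 0)
  -- This `δ` makes truncation change `φ (p n) = 1` by at most one half.
  obtain ⟨δ, hδ, hδK⟩ : ∃ δ : ℝ, 0 < δ ∧ δ * K ≤ 1 / 2 :=
    ⟨1 / (2 * (K + 1)), by positivity, by
      rw [div_mul_eq_mul_div, div_le_div_iff₀ (by positivity) (by positivity)]; nlinarith⟩
  set h : ℕ → A := fun n => truncation δ (p n) with hh
  have hsa : ∀ n, IsSelfAdjoint (h n) := fun n => isSelfAdjoint_truncation δ (p n)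
  have hcl : ∀ n, h n ∈ (S i).topologicalClosure := fun n =>
    truncation_mem_closure δ (hpsa n) (hp n)
  have hc1 : ∀ a ∈ (S i).topologicalClosure, φ (b * a * b) = φ (b * b) * ψ a := by
    have hclosed : IsClosed {a : A | φ (b * a * b) = φ (b * b) * ψ a} :=
      isClosed_eq (hφ.continuous.comp (by fun_prop)) (continuous_const.mul hψ.continuous)
    exact fun a ha => closure_minimal
      (fun a ha => hS.fst_mul_mul_self hψ.1 hij ha hb hb1 hb0) hclosed ha
  have hc2 : ∀ a ∈ (S i).topologicalClosure, φ (b * b * a) = φ (b * b) * φ a := by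
    have hclosed : IsClosed {a : A | φ (b * b * a) = φ (b * b) * φ a} :=
      isClosed_eq (hφ.continuous.comp (by fun_prop)) (continuous_const.mul hφ.continuous)
    exact fun a ha => closure_minimal
      (fun a ha => hS.fst_mul hψ.1 hφ.1 hij.symm (mul_mem hb hb) ha) hclosed ha
  have hh1 : ∀ n, 1 / 2 ≤ ‖φ (h n)‖ := fun n => by
    have h1 := hφ.abs_sub_truncation_le hδ (hpsa n)
    have h2 : δ * (φ (p n * p n)).re ≤ δ * K := mul_le_mul_of_nonneg_left (hpK n) hδ.le
    rw [hp1 n] at h1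
    have h3 := norm_sub_norm_le (1 : ℂ) (φ (h n))
    rw [norm_one] at h3
    linarith
  have hh2 : Tendsto (fun n => ψ (h n * h n)) atTop (𝓝 0) := by
    have h1 : Tendsto (fun n => (ψ (h n * h n)).re) atTop (𝓝 0) :=
      squeeze_zero (fun n => hψ.re_mul_self_nonneg (hsa n))
        (fun n => hψ.truncation_sq_le δ (hpsa n)) hp2
    have h2 := (Complex.continuous_ofReal.tendsto 0).comp h1
    rw [Complex.ofReal_zero] at h2
    refine h2.congr fun n => ?_
    have h3 : IsSelfAdjoint (h n * h n) := by simpa [sq] using (hsa n).pow 2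
    exact hψ.ofReal_re h3
  have hU : ((hyperfilter ℕ : Ultrafilter ℕ) : Filter ℕ) ≤ atTop := Nat.hyperfilter_le_atTop
  obtain ⟨k, hk, -⟩ := hw h (1 / δ) (fun n => norm_truncation_le hδ (p n)) (hyperfilter ℕ)
  -- By Cauchy-Schwarz, `φ (b * h n * d)` is controlled by `φ (b * h n * h n * b) = φ (b * b) * ψ (h
  -- n * h n)`, which tends to `0`.
  have hbk : b * k = 0 := hf.eq_zero_of_forall_mul fun d => by
    refine tendsto_nhds_unique (hk b d) (tendsto_fst_mul_of_tendsto_sq hφ b d ?_)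
    have h1 : Tendsto (fun n => (φ (b * b) * ψ (h n * h n)).re) atTop (𝓝 0) := by
      have := (Complex.continuous_re.tendsto _).comp (hh2.const_mul (φ (b * b)))
      simpa [Function.comp_def] using this
    refine (h1.mono_left hU).congr fun n => ?_
    rw [← hc1 _ (mul_mem (hcl n) (hcl n)), star_mul, (hsa n).star_eq, hbsa.star_eq]
    simp only [mul_assoc]
  have h1 := (hk (b * b) 1).norm
  rw [mul_assoc b b k, hbk, mul_zero, zero_mul, map_zero, norm_zero] at h1
  have h2 : ‖φ (b * b)‖ * (1 / 2) ≤ 0 := by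
    refine ge_of_tendsto' h1 fun n => ?_
    rw [mul_one, hc2 _ (hcl n), norm_mul]
    exact mul_le_mul_of_nonneg_left (hh1 n) (norm_nonneg _)
  have h3 : 0 < ‖φ (b * b)‖ := norm_pos_iff.2 hb2
  linarith

theorem IsTwoStateFreeBrownianMotion.false_of_lt (h : IsTwoStateFreeBrownianMotion φ ψ T X)
    (hp : HasParameter ψ T X α) (hα : α ≠ 0) (hφ : IsState φ) (hψ : IsState ψ)
    (hf : IsFaithfulFunctional φ) (hw : HasWeakLimits φ ψ) (hT : 1 / α ^ 2 < T) : False := by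
  have hα2 : 0 < α ^ 2 := by positivity
  -- The time before `t` exceeds `1 / α ^ 2` and produces the atom; the remaining time `T - t`
  -- leaves room for the free element `b`.
  obtain ⟨t, ht, htT⟩ := exists_between hT
  have h0 : 0 < t := lt_trans (by positivity) ht
  have hαt : 1 < α ^ 2 * t := by rwa [div_lt_iff₀' hα2] at ht
  obtain ⟨s, hs⟩ : ∃ s, s = T - t := ⟨_, rfl⟩
  have hs0 : 0 < s := by linarith
  have hsT : s ≤ T := by linarith
  have hfree := h.free_pair le_rfl h0.le le_rfl htT.le le_rfl
  -- the element `b`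
  set Y := X T - X t with hY
  have hYsa : IsSelfAdjoint Y :=
    (h.selfAdjoint T (h0.trans htT).le le_rfl).sub (h.selfAdjoint t h0.le htT.le)
  have hYφ := h.stationary_fst t T h0.le htT.le le_rfl
  have hYψ := h.stationary_snd t T h0.le htT.le le_rfl
  rw [← hs] at hYφ hYψ
  simp only [← hY] at hYφ hYψ
  have hφr := h.fst_pow_add_two hφ.1 hψ.1 hs0.le hsT
  have hφ1 := h.centered s hs0.le hsT
  have hψ1 := hp.snd_apply hs0.le hsT
  have hψ2 := h.snd_sq hp hφ hψ hf hw hs0.le hsT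
  have hφ2 := hφr 0
  have hφ3 := hφr 1
  have hφ4 := hφr 2
  simp only [Finset.sum_range_succ, Finset.sum_range_zero, zero_add, pow_zero, hφ.1, hψ.1,
    Nat.sub_self, pow_one, hφ1, hψ1, hψ2, Nat.sub_zero, mul_one, one_mul, mul_zero, add_zero,
    Nat.reduceAdd, Nat.reduceSub] at hφ2 hφ3 hφ4
  rw [hφ2] at hφ4
  -- With `c = α s` and `U` the Chebyshev polynomials of `Y - c`, this is `U 2 + c U 1`: both terms
  -- are `ψ`-centered, and their `φ`-means `c²` and `-c²` cancel.
  set b := Y ^ 2 - ((α * s : ℝ) : ℂ) • Y - (s : ℂ) • (1 : A) with hb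
  have hbmem : b ∈ Algebra.adjoin ℂ {X T - X t} := by
    have hm := Algebra.self_mem_adjoin_singleton ℂ (X T - X t)
    exact sub_smul_one_mem (sub_mem (pow_mem hm 2) (Subalgebra.smul_mem _ hm _)) _
  have hbsa : IsSelfAdjoint b :=
    ((hYsa.pow 2).sub (isSelfAdjoint_ofReal_smul hYsa _)).sub (isSelfAdjoint_ofReal_smul (.one A) _)
  have hY1φ := hYφ 1
  have hY1ψ := hYψ 1
  rw [pow_one, pow_one] at hY1φ hY1ψ
  have hbφ : φ b = 0 := by
    rw [hb, map_sub, map_sub, map_smul, map_smul, hYφ, hY1φ, hφ2, hφ1, hφ.1]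
    simp
  have hbψ : ψ b = 0 := by
    rw [hb, map_sub, map_sub, map_smul, map_smul, hYψ, hY1ψ, hψ2, hψ1, hψ.1]
    simp only [smul_eq_mul]
    push_cast
    ring
  have hbb : φ (b * b) = (s : ℂ) ^ 2 := by
    have e : b * b = Y ^ 4 - (2 * ((α * s : ℝ) : ℂ)) • Y ^ 3 +
        (((α * s : ℝ) : ℂ) ^ 2 - 2 * s) • Y ^ 2 + (2 * ((α * s : ℝ) : ℂ) * s) • Y +
        ((s : ℂ) ^ 2) • (1 : A) := by
      rw [hb]
      generalize ((α * s : ℝ) : ℂ) = c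
      simp only [sub_mul, mul_sub, smul_mul_assoc, mul_smul_comm, one_mul, mul_one, ← pow_add,
        ← pow_succ, ← pow_succ', (sq Y).symm, Nat.reduceAdd]
      module
    rw [e]
    simp only [map_add, map_sub, map_smul, hYφ, hY1φ, hφ1, hφ2, hφ3, hφ4, hφ.1, smul_eq_mul]
    push_cast
    ring
  -- the elements `p n`
  set c : ℝ := α * t with hc
  have hc0 : c ≠ 0 := mul_ne_zero hα h0.ne'
  set U := chebyshevSeq (t : ℂ) (X t - (c : ℂ) • (1 : A)) with hU
  have hysa : IsSelfAdjoint (X t - (c : ℂ) • (1 : A)) :=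
    (h.selfAdjoint t h0.le htT.le).sub (isSelfAdjoint_ofReal_smul (.one A) _)
  have hUψ : ∀ n, n ≠ 0 → ψ (U n) = 0 := fun n hn =>
    h.snd_chebyshevSeq hp hφ hψ hf hw h0.le htT.le hn
  have hUφ : ∀ n, φ (U n) = (-c : ℂ) ^ n := map_chebyshevSeq_fst hφ.1 hψ.1
    (h.centered t h0.le htT.le) (h.fst_pow_add_two hφ.1 hψ.1 h0.le htT.le) hUψ
  have hUψ2 : ∀ n, ψ (U n * U n) = (t : ℂ) ^ n := map_chebyshevSeq_sq hψ.1 hUψ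
  -- This ratio equals `1 / (α ^ 2 * t)`, so the critical time is exactly where it reaches `1`.
  set ρ : ℝ := t / c ^ 2 with hρ
  have hρ0 : 0 ≤ ρ := by positivity
  have hρ1 : ρ < 1 := by
    rw [hρ, div_lt_one (by positivity), hc, mul_pow]
    nlinarith
  have hcρ : t = ρ * c ^ 2 := by rw [hρ]; field_simp
  set p : ℕ → A := fun n => ((((-c) ^ n)⁻¹ : ℝ) : ℂ) • U n with hpdef
  have hpp : ∀ ω : A →ₗ[ℂ] ℂ, ∀ n,
      (ω (p n * p n)).re = ((c ^ 2) ^ n)⁻¹ * (ω (U n * U n)).re := fun ω n => by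
    rw [hpdef, smul_mul_smul_comm, map_smul, smul_eq_mul, ← Complex.ofReal_mul,
      Complex.re_ofReal_mul, ← mul_inv, ← mul_pow, neg_mul_neg, sq]
  have hpφ : ∀ n, (φ (p n * p n)).re ≤ 1 / (1 - ρ) := fun n => by
    have h1ρ : 0 < 1 - ρ := by linarith
    induction n with
    | zero =>
      rw [hpp]
      simp only [hU, chebyshevSeq, pow_zero, mul_one, inv_one, hφ.1, Complex.one_re]
      rw [le_div_iff₀ h1ρ]
      linarith
    | succ n ih =>
      -- From `U (n + 1) ^ 2 = U (2 n + 2) + t U n ^ 2` and `φ (U (2 n + 2)) = c ^ (2 n + 2)`; the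
      -- fixed point `1 / (1 - ρ)` of the recursion bounds the sequence.
      have e : (φ (p (n + 1) * p (n + 1))).re = 1 + ρ * (φ (p n * p n)).re := by
        rw [hpp, hpp, hU, chebyshevSeq_succ_mul_succ, ← hU, map_add, hUφ, map_smul, smul_eq_mul,
          Complex.add_re, Complex.re_ofReal_mul]
        have e1 : ((-c : ℂ) ^ (n + n + 2)).re = (c ^ 2) ^ (n + 1) := by
          rw [← Complex.ofReal_neg, ← Complex.ofReal_pow, Complex.ofReal_re,
            show n + n + 2 = 2 * (n + 1) by ring, pow_mul, neg_sq]
        rw [e1, hρ]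
        field_simp
        ring
      rw [e]
      calc 1 + ρ * (φ (p n * p n)).re ≤ 1 + ρ * (1 / (1 - ρ)) := by gcongr
        _ = 1 / (1 - ρ) := by field_simp; ring
  have hpψ : Tendsto (fun n => (ψ (p n * p n)).re) atTop (𝓝 0) := by
    refine (tendsto_pow_atTop_nhds_zero_of_lt_one hρ0 hρ1).congr fun n => ?_
    rw [hpp, hUψ2, ← Complex.ofReal_pow, Complex.ofReal_re, hρ, div_pow, div_eq_inv_mul]
  refine hw.false_of_free hφ hψ hf hfree (i := 0) (j := 1) (by decide) hbmem hbsa hbφ hbψ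
    (by rw [hbb]; exact pow_ne_zero _ (by exact_mod_cast hs0.ne')) (p := p) (fun n => ?_)
    (fun n => isSelfAdjoint_ofReal_smul (isSelfAdjoint_chebyshevSeq t hysa n) _) (fun n => ?_)
    hpφ hpψ
  · refine Subalgebra.smul_mem _ (chebyshevSeq_mem _ (sub_smul_one_mem ?_ _) n) _
    show _ ∈ Algebra.adjoin ℂ {X t - X 0}
    rw [h.start, sub_zero]
    exact Algebra.self_mem_adjoin_singleton ℂ _
  · have : (-c : ℂ) ^ n ≠ 0 := pow_ne_zero _ (neg_ne_zero.2 (by exact_mod_cast hc0))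
    rw [hpdef, map_smul, hUφ, smul_eq_mul]
    push_cast
    exact inv_mul_cancel₀ this

end Nonexistence

/-! ### Weak compactness for normal states on von Neumann algebras -/

section WeakCompactness

open Filter Topology

variable {H : Type*} [NormedAddCommGroup H] [InnerProductSpace ℂ H]

theorem exists_tendsto_inner {U : Ultrafilter ℕ} {h : ℕ → H →L[ℂ] H} {K : ℝ}
    (hK : ∀ n, ‖h n‖ ≤ K) (v w : H) :
    ∃ z : ℂ, ‖z‖ ≤ K * ‖v‖ * ‖w‖ ∧ Tendsto (fun n => inner ℂ (h n v) w) U (𝓝 z) := by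
  have hb : ∀ n, inner ℂ (h n v) w ∈ Metric.closedBall (0 : ℂ) (K * ‖v‖ * ‖w‖) := fun n => by
    rw [mem_closedBall_zero_iff]
    refine (norm_inner_le_norm _ _).trans ?_
    gcongr
    exact (h n).le_of_opNorm_le (hK n) v
  obtain ⟨z, hz, hz'⟩ := (isCompact_closedBall (0 : ℂ) (K * ‖v‖ * ‖w‖)).ultrafilter_le_nhds
    (U.map fun n => inner ℂ (h n v) w)
    (le_principal_iff.2 (Filter.mem_map.2 (Eventually.of_forall hb)))
  exact ⟨z, mem_closedBall_zero_iff.1 hz, hz'⟩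

variable [CompleteSpace H]

/-- Bounded sequences of operators have weak limits along ultrafilters. -/
theorem exists_weak_limit (U : Ultrafilter ℕ) {h : ℕ → H →L[ℂ] H} {K : ℝ}
    (hK : ∀ n, ‖h n‖ ≤ K) :
    ∃ k : H →L[ℂ] H, ∀ v w, Tendsto (fun n => inner ℂ (h n v) w) U (𝓝 (inner ℂ (k v) w)) := by
  -- The limits of the matrix coefficients form a bounded sesquilinear form, which represents the
  -- limit operator.
  choose L hL hL' using fun v w => exists_tendsto_inner (U := U) hK v w
  have hu : ∀ {v w z}, Tendsto (fun n => inner ℂ (h n v) w) U (𝓝 z) → L v w = z := fun h' =>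
    tendsto_nhds_unique (hL' _ _) h'
  let B : H →ₗ⋆[ℂ] H →ₗ[ℂ] ℂ := LinearMap.mk₂'ₛₗ (starRingEnd ℂ) (RingHom.id ℂ) L
    (fun v v' w => hu (by simpa [inner_add_left] using (hL' v w).add (hL' v' w)))
    (fun c v w => hu (by simpa [inner_smul_left, mul_comm] using (hL' v w).const_mul (starRingEnd ℂ c)))
    (fun v w w' => hu (by simpa [inner_add_right] using (hL' v w).add (hL' v w')))
    (fun c v w => hu (by simpa [inner_smul_right] using (hL' v w).const_mul c))
  let B' : H →L⋆[ℂ] H →L[ℂ] ℂ := B.mkContinuous₂ K fun v w => hL v w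
  refine ⟨InnerProductSpace.continuousLinearMapOfBilin B', fun v w => ?_⟩
  rw [InnerProductSpace.continuousLinearMapOfBilin_apply]
  exact hL' v w

/-- Commuting with a fixed operator is a weakly closed condition, and `M` is its own bicommutant. -/
theorem VonNeumannAlgebra.mem_of_weak_limit {M : VonNeumannAlgebra H} {U : Ultrafilter ℕ}
    {h : ℕ → H →L[ℂ] H} (hM : ∀ n, h n ∈ M) {k : H →L[ℂ] H}
    (hk : ∀ v w, Tendsto (fun n => inner ℂ (h n v) w) U (𝓝 (inner ℂ (k v) w))) : k ∈ M := by
  have hc := M.centralizer_centralizer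
  have : k ∈ Set.centralizer (Set.centralizer (M : Set (H →L[ℂ] H))) := by
    intro y hy
    refine ContinuousLinearMap.ext fun v => ext_inner_right ℂ fun w => ?_
    have h1 := hk (y v) w
    have h2 := hk v (ContinuousLinearMap.adjoint y w)
    simp only [ContinuousLinearMap.adjoint_inner_right] at h2
    refine tendsto_nhds_unique h2 (h1.congr fun n => ?_)
    have := congrArg (fun f : H →L[ℂ] H => f v) (hy (h n) (hM n))
    exact congrArg (fun z => inner ℂ z w) this
  rwa [hc] at this

/-- Weak convergence handles each term of the series of a normal functional, and boundedness of `h`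
supplies a dominating multiple of `‖ξ m‖ * ‖η m‖`, which is summable. -/
theorem IsNormalFunctional.tendsto_of_weak_limit {M : VonNeumannAlgebra H}
    {ω : M.toStarSubalgebra →ₗ[ℂ] ℂ} (hω : IsNormalFunctional ω) {U : Ultrafilter ℕ}
    {h : ℕ → M.toStarSubalgebra} {K : ℝ} (hK : ∀ n, ‖(h n : H →L[ℂ] H)‖ ≤ K)
    {k : M.toStarSubalgebra}
    (hk : ∀ v w, Tendsto (fun n => inner ℂ ((h n : H →L[ℂ] H) v) w) U
      (𝓝 (inner ℂ ((k : H →L[ℂ] H) v) w))) (c d : M.toStarSubalgebra) :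
    Tendsto (fun n => ω (c * h n * d)) U (𝓝 (ω (c * k * d))) := by
  obtain ⟨ξ, η, hξ, hη, hs⟩ := hω
  have hterm : ∀ (x : M.toStarSubalgebra) (m : ℕ),
      inner ℂ (ξ m) (((c * x * d : M.toStarSubalgebra) : H →L[ℂ] H) (η m)) =
        (starRingEnd ℂ) (inner ℂ ((x : H →L[ℂ] H) ((d : H →L[ℂ] H) (η m)))
          (ContinuousLinearMap.adjoint (c : H →L[ℂ] H) (ξ m))) := fun x m => by
    rw [inner_conj_symm, ContinuousLinearMap.adjoint_inner_left]
    rfl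
  have hsum : Summable fun m => ‖(c : H →L[ℂ] H)‖ * K * ‖(d : H →L[ℂ] H)‖ * (‖ξ m‖ * ‖η m‖) := by
    refine Summable.mul_left _ (Summable.of_nonneg_of_le (fun m => by positivity) (fun m => ?_)
      (hξ.add hη))
    nlinarith [sq_nonneg (‖ξ m‖ - ‖η m‖), sq_nonneg ‖ξ m‖, sq_nonneg ‖η m‖]
  have h1 := tendsto_tsum_of_dominated_convergence (𝓕 := (U : Filter ℕ))
    (f := fun n m => inner ℂ (ξ m) (((c * h n * d : M.toStarSubalgebra) : H →L[ℂ] H) (η m)))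
    (g := fun m => inner ℂ (ξ m) (((c * k * d : M.toStarSubalgebra) : H →L[ℂ] H) (η m))) hsum
    (fun m => by
      simp only [hterm]
      exact (Complex.continuous_conj.tendsto _).comp (hk _ _))
    (Eventually.of_forall fun n m => by
      refine (norm_inner_le_norm _ _).trans ?_
      have h2 : ‖((c * h n * d : M.toStarSubalgebra) : H →L[ℂ] H)‖ ≤
          ‖(c : H →L[ℂ] H)‖ * K * ‖(d : H →L[ℂ] H)‖ := by
        refine (norm_mul_le ((c * h n : M.toStarSubalgebra) : H →L[ℂ] H) (d : H →L[ℂ] H)).trans ?_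
        gcongr
        refine (norm_mul_le (c : H →L[ℂ] H) (h n : H →L[ℂ] H)).trans ?_
        gcongr
        exact hK n
      calc _ ≤ ‖ξ m‖ * (‖(c : H →L[ℂ] H)‖ * K * ‖(d : H →L[ℂ] H)‖ * ‖η m‖) := by
            gcongr
            exact ContinuousLinearMap.le_of_opNorm_le _ h2 _
        _ = _ := by ring)
  simpa only [(hs _).tsum_eq] using h1

theorem VonNeumannAlgebra.isClosed (M : VonNeumannAlgebra H) :
    IsClosed (M.toStarSubalgebra : Set (H →L[ℂ] H)) := by
  have h1 : (M.toStarSubalgebra : Set (H →L[ℂ] H)) =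
      Set.centralizer (Set.centralizer (M : Set (H →L[ℂ] H))) := M.centralizer_centralizer.symm
  rw [h1]
  exact Set.isClosed_centralizer _

/-- There is no two-state free Brownian motion with parameter `α` on `[0, T]` for `T > 1 / α ^ 2`. -/
theorem not_isTwoStateFreeBrownianMotion {M : VonNeumannAlgebra H}
    {φ ψ : M.toStarSubalgebra →ₗ[ℂ] ℂ} {X : ℝ → M.toStarSubalgebra} {α T : ℝ} (hα : α ≠ 0)
    (hT : 1 / α ^ 2 < T) (hM : IsWStarProbabilitySpace M φ ψ)
    (h : IsTwoStateFreeBrownianMotion φ ψ T X) (hp : HasParameter ψ T X α) : False := by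
  have hcl : IsClosed (M.toStarSubalgebra : Set (H →L[ℂ] H)) := M.isClosed
  let _ : CStarAlgebra M.toStarSubalgebra := StarSubalgebra.cstarAlgebra M.toStarSubalgebra
  refine h.false_of_lt hp hα hM.state_fst hM.state_snd hM.faithful_fst ?_ hT
  intro g K hK U
  obtain ⟨k, hk⟩ := exists_weak_limit U (h := fun n => (g n : H →L[ℂ] H)) hK
  have hkM : k ∈ M.toStarSubalgebra :=
    VonNeumannAlgebra.mem_of_weak_limit (M := M) (fun n => (g n).2) hk
  refine ⟨⟨k, hkM⟩, fun c d => hM.normal_fst.tendsto_of_weak_limit hK hk c d, ?_⟩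
  simpa using hM.normal_snd.tendsto_of_weak_limit hK (k := ⟨k, hkM⟩) hk 1 1

end WeakCompactness
theorem mainTheorem1 (α : ℝ) (hα : α ≠ 0) :
    (∀ T : ℝ, 0 ≤ T → T ≤ 1 / α ^ 2 →
      ∃ (H : Type) (_ : NormedAddCommGroup H) (_ : InnerProductSpace ℂ H) (_ : CompleteSpace H)
        (M : VonNeumannAlgebra H) (φ ψ : M.toStarSubalgebra →ₗ[ℂ] ℂ)
        (X : ℝ → M.toStarSubalgebra),
        IsWStarProbabilitySpace M φ ψ ∧
        IsTwoStateFreeBrownianMotion φ ψ T X ∧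
        HasParameter ψ T X α ∧
        IsGeneratedBy M T X) ∧
    (∀ T : ℝ, 1 / α ^ 2 < T →
      ¬ ∃ (H : Type u) (_ : NormedAddCommGroup H) (_ : InnerProductSpace ℂ H)
        (_ : CompleteSpace H) (M : VonNeumannAlgebra H) (φ ψ : M.toStarSubalgebra →ₗ[ℂ] ℂ)
        (X : ℝ → M.toStarSubalgebra),
        IsWStarProbabilitySpace M φ ψ ∧
        IsTwoStateFreeBrownianMotion φ ψ T X ∧
        HasParameter ψ T X α) := by
  refine ⟨exists_twoStateFreeBrownianMotion α hα, fun T hT => ?_⟩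
  rintro ⟨H, _, _, _, M, φ, ψ, X, hM, h, hp⟩
  exact not_isTwoStateFreeBrownianMotion hα hT hM h hp
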